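/- **Theorem (splitting formula).** Let $d\ge 2$, $V(x)=|x|^2$ on $\mathbb{R}^d$, $W(r)=\log r$ if $d=2$ and $W(r)=-r^{2-d}$ if $d\ge 3$ (with $W(0)=-\infty$), and $k_d=c_d|\mathbb{S}_{d-1}|$ with $c_2=1$, $c_d=d-2$ for $d\ge3$, $|\mathbb{S}_{d-1}|$ the area of the unit sphere of $\mathbb{R}^d$, so that $\Delta W(|\cdot|)=k_d\delta_0$. Let $Q=[q_{\min},q_{\max}]$ with $q_{\min}>0$, let $\nu$ be a probability measure on $Q$, and let $g$ be positive on $Q$ and continuous or monotonic there. For $\mu$ in the set $\mathcal{M}_\nu$ of probability measures on $Q\times\mathbb{R}^d$ with charge marginal $\nu$ put $$\mathcal{I}(\mu)=\int q\,g(q)V(x)\,d\mu(q,x)-\iint qq'\,W(|x-x'|)\,d\mu(q,x)\,d\mu(q',x')\in(-\infty,+\infty],$$ and let $\mu_\nu^\star$ be a minimizer of $\mathcal{I}$ on $\mathcal{M}_\nu$. Set $$\zeta(q,x)=\zeta_0(q,x)-c(q),\qquad \zeta_0(q,x)=\frac{q\,g(q)}{2}V(x)-q\int q'\,W(|x-x'|)\,d\mu_\nu^\star(q',x'),\qquad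 c(q)=\inf_{x\in\mathbb{R}^d}\zeta_0(q,x).$$ Then $\zeta\ge 0$ on $Q\times\mathbb{R}^d$ and $\zeta=0$ $\mu_\nu^\star$-almost everywhere; if $g$ is continuous, $\zeta=0$ on the support of $\mu_\nu^\star$. Let moreover $N$ particles with charges $q_1,\dots,q_N\in Q$ be at distinct positions $x_1,\dots,x_N\in\mathbb{R}^d$; if $d=2$, assume $\sum_i q_i=N\int q\,d\nu(q)$. Let $\tilde\mu_N=\sum_i\delta_{(q_i,x_i)}$, $$H_N=N\sum_{i}q_i\,g(q_i)V(x_i)-\sum_i\sum_{j\ne i}q_iq_j\,W(|x_i-x_j|),\qquad E_N(x)=\int q\,W(|x-x'|)\,d(\tilde\mu_N-N\mu_\nu^\star)(q,x').$$ Then $\Delta E_N=k_d\int_Q q\,d(\tilde\mu_N-N\mu_\nu^\star)(q,\cdot)$ in the sense of distributions, the distributional gradient $\nabla E_N$ is a locally integrable vector field, it is square integrable on $\mathbb{R}^d\setminus\bigcup_i B(x_i,\eta)$ for every $\eta>0$, the limit $$\mathcal{E}(\nabla E_N,1)=\lim_{\eta\to0^+}\Big(\int_{\mathbb{R}^d\setminus\bigcup_iB(x_i,\eta)}|\nabla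 E_N(y)|^2\,dy+k_dW(\eta)\sum_iq_i^2\Big)$$ exists in $\mathbb{R}$, and $$H_N=N^2\mathcal{I}(\mu_\nu^\star)+2N\int\zeta\,d\tilde\mu_N+\frac1{k_d}\mathcal{E}(\nabla E_N,1)+2N\Big(\sum_ic(q_i)-N\int c\,d\nu\Big).$$ In particular $$H_N=N^2\mathcal{I}(\mu_\nu^\star)+2N\int\zeta\,d\tilde\mu_N+\frac1{k_d}\mathcal{E}(\nabla E_N,1)$$ whenever $\sum_i\delta_{q_i}=N\nu$ (the charges are distributed exactly according to $\nu$), and also whenever $g$ is constant on $Q$ and $\sum_iq_i=N\int q\,d\nu(q)$. -/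

import Mathlib

open MeasureTheory Filter Topology
open scoped ENNReal ContDiff

noncomputable section

namespace HeterogeneousGas

/-- Positions live in `ℝ^d` with its Euclidean norm. -/
abbrev Space (d : ℕ) : Type := EuclideanSpace ℝ (Fin d)

/-- The Coulomb kernel as a function of the distance `r > 0`: `log r` if `d = 2` and
`-1 / r^(d-2)` if `d ≥ 3`.  (At `r = 0`, where the kernel is `-∞`, the value is a convention;
coinciding positions are excluded or charge a null set wherever this value could matter.) -/
def coulombW (d : ℕ) (r : ℝ) : ℝ :=
  if d = 2 then Real.log r else -(1 / r ^ (d - 2))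

/-- The confining potential `V(x) = |x|^2`. -/
def confV {d : ℕ} (x : Space d) : ℝ := ‖x‖ ^ 2

/-- The area `|S_{d-1}|` of the unit sphere of `ℝ^d`. -/
def sphereArea (d : ℕ) : ℝ :=
  (((volume : Measure (Space d)).toSphere) Set.univ).toReal

/-- The constant `k_d = c_d |S_{d-1}|`, where `c_2 = 1` and `c_d = d - 2` for `d ≥ 3`. -/
def coulombConst (d : ℕ) : ℝ :=
  (if d = 2 then 1 else (d : ℝ) - 2) * sphereArea d

/-- The `N`-particle Hamiltonian
`N ∑ q_i g(q_i) V(x_i) - ∑_i ∑_{j ≠ i} q_i q_j W(|x_i - x_j|)`. -/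
def hamiltonian {d N : ℕ} (g : ℝ → ℝ) (q : Fin N → ℝ) (x : Fin N → Space d) : ℝ :=
  (N : ℝ) * ∑ i, q i * g (q i) * confV (x i)
    - ∑ i, ∑ j ∈ Finset.univ.erase i, q i * q j * coulombW d ‖x i - x j‖

/-- `N` times the double-layer empirical measure: `∑ δ_{(q_i, x_i)}`. -/
def pointMeasure {d N : ℕ} (q : Fin N → ℝ) (x : Fin N → Space d) : Measure (ℝ × Space d) :=
  ∑ i, Measure.dirac (q i, x i)

/-- Probability measures on charges and positions whose charge marginal is `ν`. -/
def doubleLayer (d : ℕ) (ν : Measure ℝ) : Set (Measure (ℝ × Space d)) :=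
  {μ | IsProbabilityMeasure μ ∧ μ.map Prod.fst = ν}

/-- The intensive energy
`∫ q g(q) V(x) dμ(q,x) - ∬ q q' W(|x - x'|) dμ(q,x) dμ(q',x')` of a measure of finite energy. -/
def intensiveEnergy {d : ℕ} (g : ℝ → ℝ) (μ : Measure (ℝ × Space d)) : ℝ :=
  (∫ p, p.1 * g p.1 * confV p.2 ∂μ)
    - ∫ z, z.1.1 * z.2.1 * coulombW d ‖z.1.2 - z.2.2‖ ∂(μ.prod μ)

/-- `μ` has finite intensive energy.  Since `W(0) = -∞`, this includes that the set of pairs of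
equal positions is null.  For charges in a compact subset of `(0,∞)` the energy of every other
measure is `+∞`. -/
def HasFiniteEnergy {d : ℕ} (g : ℝ → ℝ) (μ : Measure (ℝ × Space d)) : Prop :=
  Integrable (fun p : ℝ × Space d => p.1 * g p.1 * confV p.2) μ ∧
  (∀ᵐ z ∂(μ.prod μ), z.1.2 ≠ z.2.2) ∧
  Integrable (fun z : (ℝ × Space d) × (ℝ × Space d) =>
    z.1.1 * z.2.1 * coulombW d ‖z.1.2 - z.2.2‖) (μ.prod μ)

/-- `μ` minimizes the `(-∞, +∞]`-valued intensive energy among the probability measures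
with charge marginal `ν`. -/
def IsEnergyMinimizer {d : ℕ} (g : ℝ → ℝ) (ν : Measure ℝ) (μ : Measure (ℝ × Space d)) : Prop :=
  μ ∈ doubleLayer d ν ∧ HasFiniteEnergy g μ ∧
  ∀ μ' ∈ doubleLayer d ν, HasFiniteEnergy g μ' → intensiveEnergy g μ ≤ intensiveEnergy g μ'

/-- The potential `x ↦ ∫ q' W(|x - x'|) dμ(q',x')` generated by a charge distribution. -/
def chargePotential {d : ℕ} (μ : Measure (ℝ × Space d)) (x : Space d) : ℝ :=
  ∫ p, p.1 * coulombW d ‖x - p.2‖ ∂μ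

/-- The unnormalized effective potential
`q g(q) V(x) / 2 - q ∫ q' W(|x - x'|) dμ(q',x')`. -/
def zetaRaw {d : ℕ} (g : ℝ → ℝ) (μ : Measure (ℝ × Space d)) (q : ℝ) (x : Space d) : ℝ :=
  q * g q / 2 * confV x - q * chargePotential μ x

/-- The lowest level `c(q) = inf_x` of the unnormalized effective potential for the charge `q`. -/
def groundLevel {d : ℕ} (g : ℝ → ℝ) (μ : Measure (ℝ × Space d)) (q : ℝ) : ℝ :=
  ⨅ x : Space d, zetaRaw g μ q x

/-- The effective potential `ζ`. -/
def zeta {d : ℕ} (g : ℝ → ℝ) (μ : Measure (ℝ × Space d)) (q : ℝ) (x : Space d) : ℝ :=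
  zetaRaw g μ q x - groundLevel g μ q

/-- The potential `E_N` of the point charges minus `N` times the background. -/
def fluctPotential {d N : ℕ} (μ : Measure (ℝ × Space d)) (q : Fin N → ℝ) (x : Fin N → Space d)
    (y : Space d) : ℝ :=
  chargePotential (pointMeasure q x) y - (N : ℝ) * chargePotential μ y

/-- `Δ f = k_d ∫ q (d(∑ δ_{(q_i,x_i)}) - N dμ)` in the sense of distributions. -/
def SolvesPoisson {d N : ℕ} (μ : Measure (ℝ × Space d)) (q : Fin N → ℝ) (x : Fin N → Space d)
    (f : Space d → ℝ) : Prop :=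
  LocallyIntegrable f ∧
  ∀ φ : Space d → ℝ, ContDiff ℝ ∞ φ → HasCompactSupport φ →
    ∫ y, f y * Laplacian.laplacian φ y =
      coulombConst d * ((∫ p, p.1 * φ p.2 ∂(pointMeasure q x)) - (N : ℝ) * ∫ p, p.1 * φ p.2 ∂μ)

/-- `G` is the gradient of `f` in the sense of distributions, both being locally integrable. -/
def HasWeakGradient {d : ℕ} (f : Space d → ℝ) (G : Space d → Space d) : Prop :=
  LocallyIntegrable f ∧ LocallyIntegrable G ∧
  ∀ φ : Space d → ℝ, ContDiff ℝ ∞ φ → HasCompactSupport φ →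
    ∫ y, f y • gradient φ y = -∫ y, φ y • G y

/-- `L` is the heterogeneous renormalized energy of the vector field `G` with point charges `q_i`
at `x_i` and weight `χ`: the limit as `η → 0` of
`∫_{ℝ^d \ ⋃ B(x_i,η)} χ |G|^2 + k_d W(η) ∑ χ(x_i) q_i^2`, the integrals being convergent.
Note that `W(η) < 0` for small `η`: the last term removes the self-interactions. -/
def HasRenormalizedEnergy {d N : ℕ} (q : Fin N → ℝ) (x : Fin N → Space d)
    (G : Space d → Space d) (χ : Space d → ℝ) (L : ℝ) : Prop :=
  (∀ η : ℝ, 0 < η →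
    IntegrableOn (fun y => χ y * ‖G y‖ ^ 2) (⋃ i, Metric.ball (x i) η)ᶜ) ∧
  Tendsto (fun η : ℝ =>
      (∫ y in (⋃ i, Metric.ball (x i) η)ᶜ, χ y * ‖G y‖ ^ 2)
        + coulombConst d * coulombW d η * ∑ i, χ (x i) * q i ^ 2)
    (𝓝[>] 0) (𝓝 L)

end HeterogeneousGas

end

open HeterogeneousGas

noncomputable section

namespace HeterogeneousGas

open Set Metric
open scoped RealInnerProductSpace

/-! Let ρ be the distribution of charge in space of the minimizer (`chargeMeasure`) and P its
Coulomb potential (`pot`). Up to signs the formula is the expansion of a square: the pair energy of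
the points is the renormalized energy of the points minus N times ρ, together with the cross term 2N
∑ q_i P(x_i) and N² times the energy of ρ. The cross term joins the confinement to form ζ + c. The
constant that remains is the mean of c over ν, which is known because ζ vanishes almost everywhere
on the minimizer (`integral_groundLevel`). The analysis lies in two places.

Euler–Lagrange equation. Competitors must keep the law of the charges, so mass may move in space as
long as each particle retains its charge. `ae_zetaRaw_le_aux` moves an arbitrary measurable portion
of the minimizer to random positions and reads off from `first_variation` that the effective
potential cannot drop. This speaks only of almost every target, whereas ζ involves an infimum over
all positions. Two facts of potential theory close the gap: a potential bounded below almost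
everywhere on its own source is finite everywhere (`integrable_potential_of_bounded`), and a
continuous upper bound valid almost everywhere is valid everywhere (`pot_le_of_ae_le`). Comparison
with one fixed position bounds P from below on the source; since P grows at most linearly and the
confinement quadratically, it also bounds the support (`exists_isTame`). Upper semicontinuity of P
and continuity of g carry ζ = 0 to the whole support.

Field energy. In polar coordinates around x the Jacobian cancels the Coulomb field of x, so the
pairing of that field with a gradient ∇φ outside a ball is a spherical mean of φ
(`integral_inner_gradW_compl_closedBall`). For φ a test function this is Poisson's equation; for φ
the potential of another point it produces the mutual energy -k_d W(|x - x'|); for φ the potential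
of x itself it produces -k_d W(η), exactly the divergence that renormalization removes. In dimension
two a single Coulomb field is not square integrable at infinity, so a smooth reference field is
subtracted from each (`relField`). Symmetry of the pairing fixes the resulting extra terms up to one
constant (`exists_refPairing_eq`), and in the total they carry the excess charge as a factor, which
neutrality makes zero. Background energies come from integrating the two-point identity; Fubini's
theorem applies because the overlap of two fields is at most a constant times 1 + |W|
(`exists_lintegral_mul_le`). Uniqueness of weak gradients makes the limit independent of the
representative. -/

/-- The surface measure on the unit sphere of `ℝ^d`. -/
abbrev sphereMeasure (d : ℕ) : Measure (sphere (0 : Space d) 1) :=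
  (volume : Measure (Space d)).toSphere

/-! ### Polar coordinates. -/

lemma nontrivial_space {d : ℕ} (hd : 2 ≤ d) : Nontrivial (Space d) := by
  have : Nonempty (Fin d) := ⟨⟨0, by omega⟩⟩
  infer_instance

lemma lintegral_polar {d : ℕ} (hd : 2 ≤ d) {F : Space d → ℝ≥0∞} (hF : Measurable F) :
    ∫⁻ z, F z = ∫⁻ w : sphere (0 : Space d) 1, ∫⁻ r in Ioi (0 : ℝ),
      ENNReal.ofReal (r ^ (d - 1)) * F (r • (w : Space d)) ∂volume ∂(sphereMeasure d) := by
  have := nontrivial_space hd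
  have hfin : Module.finrank ℝ (Space d) = d := by simp
  have hm := (volume : Measure (Space d)).measurePreserving_homeomorphUnitSphereProd
  rw [hfin] at hm
  have hG : Measurable fun p : sphere (0 : Space d) 1 × Ioi (0 : ℝ) =>
      F ((p.2 : ℝ) • (p.1 : Space d)) := by fun_prop
  calc ∫⁻ z, F z = ∫⁻ z in {(0 : Space d)}ᶜ, F z := by rw [restrict_compl_singleton]
    _ = ∫⁻ z : ({(0 : Space d)}ᶜ : Set (Space d)), F z ∂(volume.comap Subtype.val) := by
      rw [← lintegral_subtype_comap (measurableSet_singleton _).compl]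
    _ = ∫⁻ p : sphere (0 : Space d) 1 × Ioi (0 : ℝ), F ((p.2 : ℝ) • (p.1 : Space d))
          ∂((sphereMeasure d).prod (Measure.volumeIoiPow (d - 1))) := by
      rw [← hm.lintegral_comp hG]
      refine lintegral_congr fun z => ?_
      congr 1
      simpa using (smul_inv_smul₀ (norm_ne_zero_iff.2 z.2) (z : Space d)).symm
    _ = _ := by
      rw [lintegral_prod _ hG.aemeasurable]
      refine lintegral_congr fun w => ?_
      rw [Measure.volumeIoiPow, lintegral_withDensity_eq_lintegral_mul _ (by fun_prop) (by fun_prop)]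
      exact lintegral_subtype_comap measurableSet_Ioi
        (fun r : ℝ => ENNReal.ofReal (r ^ (d - 1)) * F (r • (w : Space d)))

lemma integral_polar {d : ℕ} (hd : 2 ≤ d) {F : Space d → ℝ} (hF : Integrable F) :
    (∫ z, F z = ∫ w : sphere (0 : Space d) 1, ∫ r in Ioi (0 : ℝ),
      r ^ (d - 1) * F (r • (w : Space d)) ∂volume ∂(sphereMeasure d)) ∧
    ∀ᵐ w : sphere (0 : Space d) 1 ∂(sphereMeasure d), IntegrableOn (fun r => r ^ (d - 1) * F (r • (w : Space d))) (Ioi 0) := by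
  have := nontrivial_space hd
  have hfin : Module.finrank ℝ (Space d) = d := by simp
  have hm := (volume : Measure (Space d)).measurePreserving_homeomorphUnitSphereProd
  rw [hfin] at hm
  have hem := (homeomorphUnitSphereProd (Space d)).measurableEmbedding
  have hcongr : ∀ z : ({(0 : Space d)}ᶜ : Set (Space d)),
      F ((((homeomorphUnitSphereProd (Space d)) z).2 : ℝ) •
        (((homeomorphUnitSphereProd (Space d)) z).1 : Space d)) = F z := by
    intro z
    congr 1
    simpa using smul_inv_smul₀ (norm_ne_zero_iff.2 z.2) (z : Space d)
  have hint : Integrable (fun p : sphere (0 : Space d) 1 × Ioi (0 : ℝ) =>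
      F ((p.2 : ℝ) • (p.1 : Space d))) ((sphereMeasure d).prod (Measure.volumeIoiPow (d - 1))) := by
    rw [← hm.integrable_comp_emb hem]
    have : IntegrableOn F ({(0 : Space d)}ᶜ : Set (Space d)) := hF.integrableOn
    rw [integrableOn_iff_comap_subtypeVal (by measurability)] at this
    refine this.congr (Eventually.of_forall fun z => ?_)
    exact (hcongr z).symm
  have hsub : ∀ (w : sphere (0 : Space d) 1) , 
      (fun r : Ioi (0 : ℝ) => (ENNReal.ofReal ((r : ℝ) ^ (d - 1))).toReal • F ((r : ℝ) • (w : Space d)))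
       = (fun r : ℝ => r ^ (d - 1) * F (r • (w : Space d))) ∘ (↑) := by
    intro w
    ext r
    have : (0 : ℝ) ≤ (r : ℝ) ^ (d - 1) := pow_nonneg (le_of_lt r.2) _
    simp [ENNReal.toReal_ofReal this]
  constructor
  · calc ∫ z, F z = ∫ z in {(0 : Space d)}ᶜ, F z := by rw [restrict_compl_singleton]
      _ = ∫ z : ({(0 : Space d)}ᶜ : Set (Space d)), F z ∂(volume.comap Subtype.val) := by
        rw [← integral_subtype_comap (measurableSet_singleton _).compl]
      _ = ∫ p : sphere (0 : Space d) 1 × Ioi (0 : ℝ), F ((p.2 : ℝ) • (p.1 : Space d))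
            ∂((sphereMeasure d).prod (Measure.volumeIoiPow (d - 1))) := by
        rw [← hm.integral_comp hem]
        exact integral_congr_ae (Eventually.of_forall fun z => (hcongr z).symm)
      _ = _ := by
        rw [integral_prod _ hint]
        refine integral_congr_ae (Eventually.of_forall fun w => ?_)
        simp only
        rw [Measure.volumeIoiPow, integral_withDensity_eq_integral_toReal_smul (by fun_prop) (by simp), hsub]
        exact integral_subtype_comap measurableSet_Ioi
          (fun r : ℝ => r ^ (d - 1) * F (r • (w : Space d)))
  · filter_upwards [hint.prod_right_ae] with w hw
    rw [integrableOn_iff_comap_subtypeVal measurableSet_Ioi, ← hsub]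
    rw [Measure.volumeIoiPow, integrable_withDensity_iff_integrable_smul' (by fun_prop) (by simp)] at hw
    exact hw

lemma sphereMeasure_univ (d : ℕ) : sphereMeasure d univ = ENNReal.ofReal (sphereArea d) := by
  rw [sphereArea, ENNReal.ofReal_toReal (measure_ne_top _ _)]

lemma sphereArea_pos {d : ℕ} (hd : 2 ≤ d) : 0 < sphereArea d := by
  have := nontrivial_space hd
  rw [sphereArea]
  refine ENNReal.toReal_pos ?_ (measure_ne_top _ _)
  rw [Measure.measure_univ_ne_zero]
  exact Measure.toSphere_ne_zero _

lemma lintegral_radial {d : ℕ} (hd : 2 ≤ d) {f : ℝ → ℝ≥0∞} (hf : Measurable f) :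
    ∫⁻ z : Space d, f ‖z‖ = ENNReal.ofReal (sphereArea d) *
      ∫⁻ r in Ioi (0 : ℝ), ENNReal.ofReal (r ^ (d - 1)) * f r := by
  rw [lintegral_polar hd (by fun_prop)]
  have : ∀ w : sphere (0 : Space d) 1, ∫⁻ r in Ioi (0 : ℝ),
      ENNReal.ofReal (r ^ (d - 1)) * f ‖r • (w : Space d)‖ =
      ∫⁻ r in Ioi (0 : ℝ), ENNReal.ofReal (r ^ (d - 1)) * f r := by
    intro w
    refine setLIntegral_congr_fun measurableSet_Ioi fun r hr => ?_
    have hr' : (0 : ℝ) < r := hr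
    simp [norm_smul, abs_of_pos hr']
  simp_rw [this]
  rw [lintegral_const, sphereMeasure_univ, mul_comm]

/-- The sphere measure of a point vanishes. -/
lemma sphereMeasure_ae_ne {d : ℕ} (hd : 2 ≤ d) (v : Space d) :
    ∀ᵐ w : sphere (0 : Space d) 1 ∂(sphereMeasure d), (w : Space d) ≠ v := by
  have := nontrivial_space hd
  rw [ae_iff]
  have hs : MeasurableSet {a : sphere (0 : Space d) 1 | ¬ (a : Space d) ≠ v} := by
    have : {a : sphere (0 : Space d) 1 | ¬ (a : Space d) ≠ v} = (↑) ⁻¹' {v} := by ext; simp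
    rw [this]
    exact measurable_subtype_coe (measurableSet_singleton v)
  rw [Measure.toSphere_apply' _ hs]
  -- The sphere measure of a set is a multiple of the volume of the cone over it. Here the cone lies
  -- in a line, which is null since d ≥ 2.
  have hnull : volume ((ℝ ∙ v : Submodule ℝ (Space d)) : Set (Space d)) = 0 := by
    apply Measure.addHaar_submodule
    intro h
    have h1 := finrank_span_le_card (R := ℝ) ({v} : Set (Space d))
    rw [h, finrank_top] at h1
    simp at h1
    omega
  rw [measure_mono_null _ hnull, mul_zero]
  rintro _ ⟨t, _, _, ⟨w, hw, rfl⟩, rfl⟩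
  simp only [ne_eq, not_not, mem_ofPred_eq] at hw
  simp only [hw]
  exact Submodule.smul_mem _ _ (Submodule.mem_span_singleton_self v)

/-! ### Elementary bounds for the Coulomb kernel. -/

/-- The constant `c_d` with `c_2 = 1` and `c_d = d - 2` for `d ≥ 3`. -/
def dimConst (d : ℕ) : ℝ := if d = 2 then 1 else (d : ℝ) - 2

lemma one_le_dimConst {d : ℕ} (hd : 2 ≤ d) : 1 ≤ dimConst d := by
  unfold dimConst
  split_ifs with h
  · exact le_rfl
  · have : 3 ≤ d := by omega
    have : (3 : ℝ) ≤ d := by exact_mod_cast this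
    linarith

lemma dimConst_pos {d : ℕ} (hd : 2 ≤ d) : 0 < dimConst d :=
  one_pos.trans_le (one_le_dimConst hd)

lemma coulombConst_eq (d : ℕ) : coulombConst d = dimConst d * sphereArea d := rfl

lemma coulombConst_pos {d : ℕ} (hd : 2 ≤ d) : 0 < coulombConst d :=
  mul_pos (dimConst_pos hd) (sphereArea_pos hd)

lemma coulombW_two (r : ℝ) : coulombW 2 r = Real.log r := by simp [coulombW]

lemma coulombW_add_three (n : ℕ) (r : ℝ) : coulombW (n + 3) r = -(r ^ (n + 1))⁻¹ := by
  have : n + 3 ≠ 2 := by omega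
  simp [coulombW, this]

lemma eq_two_or_eq_add_three {d : ℕ} (hd : 2 ≤ d) : d = 2 ∨ ∃ n, d = n + 3 := by
  rcases Nat.lt_or_ge d 3 with h | h
  · left; omega
  · right; exact ⟨d - 3, by omega⟩

lemma coulombW_zero {d : ℕ} (hd : 2 ≤ d) : coulombW d 0 = 0 := by
  rcases eq_two_or_eq_add_three hd with rfl | ⟨n, rfl⟩
  · simp [coulombW_two]
  · simp [coulombW_add_three]

@[fun_prop]
lemma measurable_coulombW (d : ℕ) : Measurable (coulombW d) := by
  unfold coulombW
  split_ifs <;> fun_prop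

lemma hasDerivAt_coulombW {d : ℕ} (hd : 2 ≤ d) {r : ℝ} (hr : 0 < r) :
    HasDerivAt (coulombW d) (dimConst d * (r ^ (d - 1))⁻¹) r := by
  rcases eq_two_or_eq_add_three hd with rfl | ⟨n, rfl⟩
  · have : coulombW 2 = Real.log := funext coulombW_two
    simpa [this, dimConst] using Real.hasDerivAt_log hr.ne'
  · have h1 : coulombW (n + 3) = fun r => -(r ^ (n + 1))⁻¹ := funext (coulombW_add_three n)
    have h2 : n + 3 ≠ 2 := by omega
    rw [h1]
    refine ((hasDerivAt_pow (n + 1) r).fun_inv (by positivity)).fun_neg.congr_deriv ?_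
    have h3 : n + 3 - 1 = n + 2 := by omega
    rw [dimConst, if_neg h2, h3]
    push_cast
    field_simp
    ring

lemma coulombW_le_coulombW {d : ℕ} (hd : 2 ≤ d) {r s : ℝ} (hr : 0 < r) (hrs : r ≤ s) :
    coulombW d r ≤ coulombW d s := by
  rcases eq_two_or_eq_add_three hd with rfl | ⟨n, rfl⟩
  · simpa [coulombW_two] using Real.log_le_log hr hrs
  · rw [coulombW_add_three, coulombW_add_three]
    gcongr

lemma coulombW_le_self {d : ℕ} (hd : 2 ≤ d) {r : ℝ} (hr : 0 ≤ r) : coulombW d r ≤ r := by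
  rcases eq_two_or_eq_add_three hd with rfl | ⟨n, rfl⟩
  · simpa [coulombW_two] using Real.log_le_self hr
  · rw [coulombW_add_three]
    have : 0 ≤ (r ^ (n + 1))⁻¹ := by positivity
    linarith

/-- For d = 2 this is log u ≤ u at u = t/s; for d ≥ 3 the term in t has the good sign and s^{2-d} =
s · s^{1-d}. The bound trades differences of W for the kernel |z|^{1-d}, whose integrals are
explicit. -/
lemma coulombW_sub_le {d : ℕ} (hd : 2 ≤ d) {s t : ℝ} (hs : 0 < s) (ht : 0 < t) :
    coulombW d t - coulombW d s ≤ t * (s ^ (d - 1))⁻¹ := by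
  rcases le_total t s with h | h
  · have := coulombW_le_coulombW hd ht h
    have : 0 ≤ t * (s ^ (d - 1))⁻¹ := by positivity
    linarith
  rcases eq_two_or_eq_add_three hd with rfl | ⟨n, rfl⟩
  · rw [coulombW_two, coulombW_two, ← Real.log_div ht.ne' hs.ne']
    simpa [div_eq_mul_inv] using Real.log_le_self (by positivity : 0 ≤ t / s)
  · rw [coulombW_add_three, coulombW_add_three]
    have h1 : 0 ≤ (t ^ (n + 1))⁻¹ := by positivity
    have h2 : (s ^ (n + 1))⁻¹ = s * (s ^ (n + 3 - 1))⁻¹ := by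
      have : n + 3 - 1 = n + 2 := by omega
      rw [this]; field_simp; ring
    have h3 : s * (s ^ (n + 3 - 1))⁻¹ ≤ t * (s ^ (n + 3 - 1))⁻¹ := by gcongr
    linarith

/-- Compare with distance one from below, and use W(r) ≤ r from above. The case r = 0 holds by
convention: W(0) is 0 there. -/
lemma abs_coulombW_le {d : ℕ} (hd : 2 ≤ d) {r : ℝ} (hr : 0 ≤ r) :
    |coulombW d r| ≤ 1 + r + (r ^ (d - 1))⁻¹ := by
  have hp : 0 ≤ (r ^ (d - 1))⁻¹ := by positivity
  rcases hr.eq_or_lt with rfl | hr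
  · rw [coulombW_zero hd, abs_zero]; positivity
  rw [abs_le]
  constructor
  · have h1 := coulombW_sub_le hd hr one_pos
    have h2 : -1 ≤ coulombW d 1 := by
      rcases eq_two_or_eq_add_three hd with rfl | ⟨n, rfl⟩
      · simp [coulombW_two]
      · simp [coulombW_add_three]
    linarith
  · linarith [coulombW_le_self hd hr.le]

/-- Doubling property: halving the distance costs a factor and, for the logarithm, an additive
constant. It lets |W| at comparable distances be exchanged freely. -/
lemma abs_coulombW_half_le {d : ℕ} (hd : 2 ≤ d) {r : ℝ} (hr : 0 < r) :
    |coulombW d (r / 2)| ≤ 2 ^ d * (1 + |coulombW d r|) := by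
  rcases eq_two_or_eq_add_three hd with rfl | ⟨n, rfl⟩
  · rw [coulombW_two, coulombW_two, Real.log_div hr.ne' two_ne_zero]
    have h1 := abs_sub (Real.log r) (Real.log 2)
    have h2 : |Real.log 2| ≤ 1 := by
      rw [abs_of_nonneg (Real.log_nonneg (by norm_num))]
      linarith [Real.log_two_lt_d9]
    have := abs_nonneg (Real.log r)
    norm_num
    linarith
  · rw [coulombW_add_three, coulombW_add_three, abs_neg, abs_neg, abs_of_pos (by positivity),
      abs_of_pos (by positivity), div_pow, inv_div, div_eq_mul_inv]
    have h : (2 : ℝ) ^ (n + 1) ≤ 2 ^ (n + 3) := by gcongr <;> norm_num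
    have : 0 < (r ^ (n + 1))⁻¹ := by positivity
    gcongr
    linarith

lemma mul_inv_pow_le {d : ℕ} (hd : 2 ≤ d) {r : ℝ} (hr : 0 < r) :
    r * (r ^ (d - 1))⁻¹ ≤ 1 + |coulombW d r| := by
  rcases eq_two_or_eq_add_three hd with rfl | ⟨n, rfl⟩
  · simp [hr.ne']
  · rw [coulombW_add_three, abs_neg, abs_of_pos (by positivity)]
    have : n + 3 - 1 = n + 2 := by omega
    rw [this]
    have : r * (r ^ (n + 2))⁻¹ = (r ^ (n + 1))⁻¹ := by field_simp; ring
    linarith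

/-! ### Integrals of the kernel of order 1 - d. -/

/-- The kernel `|z|^{1-d}`. -/
def riesz {d : ℕ} (z : Space d) : ℝ := (‖z‖ ^ (d - 1))⁻¹

lemma riesz_nonneg {d : ℕ} (z : Space d) : 0 ≤ riesz z := by unfold riesz; positivity

@[fun_prop]
lemma measurable_riesz {d : ℕ} : Measurable (riesz (d := d)) := by unfold riesz; fun_prop

lemma riesz_le_of_le {d : ℕ} {z : Space d} {t : ℝ} (_ht : 0 < t) (h : t ≤ ‖z‖) :
    riesz z ≤ (t ^ (d - 1))⁻¹ := by
  unfold riesz; gcongr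

/-- In polar coordinates the Jacobian cancels the kernel exactly, so each unit of radius contributes
the area of the unit sphere. -/
lemma lintegral_riesz_ball {d : ℕ} (hd : 2 ≤ d) (x : Space d) (t : ℝ) :
    ∫⁻ y in ball x t, ENNReal.ofReal (riesz (y - x)) = ENNReal.ofReal (sphereArea d * t) := by
  have h1 : ∫⁻ y in ball x t, ENNReal.ofReal (riesz (y - x)) =
      ∫⁻ y, (Iio t).indicator (fun r : ℝ => ENNReal.ofReal (r ^ (d - 1))⁻¹) ‖y - x‖ := by
    rw [← lintegral_indicator measurableSet_ball]
    refine lintegral_congr fun y => ?_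
    simp only [indicator, mem_ball, dist_eq_norm, mem_Iio, riesz]
  rw [h1, lintegral_sub_right_eq_self (fun y : Space d =>
      (Iio t).indicator (fun r : ℝ => ENNReal.ofReal (r ^ (d - 1))⁻¹) ‖y‖) x,
    lintegral_radial hd (Measurable.indicator (by fun_prop) measurableSet_Iio),
    ENNReal.ofReal_mul (sphereArea_pos hd).le]
  congr 1
  have h2 : ∫⁻ r in Ioi (0 : ℝ), ENNReal.ofReal (r ^ (d - 1)) *
      (Iio t).indicator (fun r : ℝ => ENNReal.ofReal (r ^ (d - 1))⁻¹) r =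
      ∫⁻ r in Ioi (0 : ℝ), (Iio t).indicator 1 r := by
    refine setLIntegral_congr_fun measurableSet_Ioi fun r hr => ?_
    have hr' : (0 : ℝ) < r := hr
    by_cases h : r ∈ Iio t
    · simp only [indicator_of_mem h, Pi.one_apply]
      rw [← ENNReal.ofReal_mul (by positivity), mul_inv_cancel₀ (by positivity), ENNReal.ofReal_one]
    · simp [h]
  rw [h2, lintegral_indicator_one measurableSet_Iio, Measure.restrict_apply measurableSet_Iio,
    inter_comm, Ioi_inter_Iio, Real.volume_Ioo, sub_zero]

/-- Outside the unit ball around x the kernel is at most 1. The point is uniformity in x. -/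
lemma lintegral_riesz_le {d : ℕ} (hd : 2 ≤ d) (x : Space d) (s : Set (Space d)) :
    ∫⁻ y in s, ENNReal.ofReal (riesz (y - x)) ≤ ENNReal.ofReal (sphereArea d) + volume s := by
  calc ∫⁻ y in s, ENNReal.ofReal (riesz (y - x))
      ≤ ∫⁻ y in s, ((ball x 1).indicator (fun y => ENNReal.ofReal (riesz (y - x))) y + 1) := by
        refine lintegral_mono fun y => ?_
        by_cases h : y ∈ ball x 1
        · rw [indicator_of_mem h]; exact le_self_add
        · simp only [indicator_of_notMem h, zero_add]
          rw [ENNReal.ofReal_le_one]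
          have h' : 1 ≤ ‖y - x‖ := by simpa [dist_eq_norm] using h
          simpa using riesz_le_of_le one_pos h'
    _ = (∫⁻ y in s, (ball x 1).indicator (fun y => ENNReal.ofReal (riesz (y - x))) y)
          + volume s := by
        rw [lintegral_add_right _ measurable_const]; simp
    _ ≤ _ := by
        gcongr
        refine (setLIntegral_le_lintegral _ _).trans ?_
        rw [lintegral_indicator measurableSet_ball, lintegral_riesz_ball hd x 1, mul_one]

/-- W is c_d times a primitive of the integrand with c_d ≥ 1; dropping c_d gives the inequality. -/
lemma lintegral_inv_pow_le {d : ℕ} (hd : 2 ≤ d) {s t : ℝ} (hs : 0 < s) (hst : s ≤ t) :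
    ∫⁻ r in Ioc s t, ENNReal.ofReal (r ^ (d - 1))⁻¹ ≤
      ENNReal.ofReal (coulombW d t - coulombW d s) := by
  have hcont : ContinuousOn (fun r : ℝ => dimConst d * (r ^ (d - 1))⁻¹) (uIcc s t) := by
    rw [uIcc_of_le hst]
    refine continuousOn_const.mul (ContinuousOn.inv₀ (by fun_prop) ?_)
    intro r hr
    have : 0 < r := hs.trans_le hr.1
    positivity
  have hint := hcont.intervalIntegrable (μ := volume)
  have h := intervalIntegral.integral_eq_sub_of_hasDerivAt (f := coulombW d) (fun r hr => by
    rw [uIcc_of_le hst] at hr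
    exact hasDerivAt_coulombW hd (hs.trans_le hr.1)) hint
  rw [intervalIntegral.integral_of_le hst] at h
  rw [← h, ofReal_integral_eq_lintegral_ofReal hint.1 ?_]
  · refine setLIntegral_mono (by fun_prop) fun r hr => ENNReal.ofReal_le_ofReal ?_
    have : 0 < r := hs.trans hr.1
    exact le_mul_of_one_le_left (by positivity) (one_le_dimConst hd)
  · filter_upwards [ae_restrict_mem measurableSet_Ioc] with r hr
    have : 0 < r := hs.trans hr.1
    have := one_le_dimConst hd
    simp only [Pi.zero_apply]
    positivity

lemma lintegral_riesz_sq_le {d : ℕ} (hd : 2 ≤ d) (x : Space d) {s t : ℝ} (hs : 0 < s)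
    (hst : s ≤ t) :
    ∫⁻ y in {y | s < ‖y - x‖ ∧ ‖y - x‖ ≤ t}, ENNReal.ofReal (riesz (y - x) ^ 2) ≤
      ENNReal.ofReal (sphereArea d * (coulombW d t - coulombW d s)) := by
  have hmeas : MeasurableSet {y : Space d | s < ‖y - x‖ ∧ ‖y - x‖ ≤ t} := by measurability
  have h1 : ∫⁻ y in {y | s < ‖y - x‖ ∧ ‖y - x‖ ≤ t}, ENNReal.ofReal (riesz (y - x) ^ 2) =
      ∫⁻ y, (Ioc s t).indicator (fun r : ℝ => ENNReal.ofReal ((r ^ (d - 1))⁻¹ ^ 2)) ‖y - x‖ := by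
    rw [← lintegral_indicator hmeas]
    refine lintegral_congr fun y => ?_
    simp only [indicator, mem_Ioc, riesz, mem_ofPred_eq]
    split_ifs <;> rfl
  rw [h1, lintegral_sub_right_eq_self (fun y : Space d =>
      (Ioc s t).indicator (fun r : ℝ => ENNReal.ofReal ((r ^ (d - 1))⁻¹ ^ 2)) ‖y‖) x,
    lintegral_radial hd (Measurable.indicator (by fun_prop) measurableSet_Ioc),
    ENNReal.ofReal_mul (sphereArea_pos hd).le]
  gcongr
  refine le_trans (le_of_eq ?_) (lintegral_inv_pow_le hd hs hst)
  rw [← lintegral_indicator measurableSet_Ioi, ← lintegral_indicator measurableSet_Ioc]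
  refine lintegral_congr fun r => ?_
  by_cases h : r ∈ Ioc s t
  · have hr : (0 : ℝ) < r := hs.trans h.1
    rw [indicator_of_mem (show r ∈ Ioi (0 : ℝ) from hr), indicator_of_mem h, indicator_of_mem h,
      ← ENNReal.ofReal_mul (by positivity)]
    congr 1
    field_simp
  · rw [indicator_of_notMem h]
    by_cases h' : r ∈ Ioi (0 : ℝ)
    · rw [indicator_of_mem h', indicator_of_notMem h, mul_zero]
    · rw [indicator_of_notMem h']

/-- Every y is at distance at least |x - x'|/2 from one of the two points. Close to one of them, the
other factor is bounded; away from both, the product is at most the sum of the squares. -/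
lemma riesz_mul_riesz_le {d : ℕ} {x x' y : Space d} {t : ℝ} (hxx' : 0 < ‖x - x'‖)
    (hx : ‖y - x‖ ≤ t) (hx' : ‖y - x'‖ ≤ t) :
    ENNReal.ofReal (riesz (y - x) * riesz (y - x')) ≤
      (ball x (‖x - x'‖ / 2)).indicator
          (fun y => ENNReal.ofReal (((‖x - x'‖ / 2) ^ (d - 1))⁻¹) * ENNReal.ofReal (riesz (y - x))) y
      + (ball x' (‖x - x'‖ / 2)).indicator
          (fun y => ENNReal.ofReal (((‖x - x'‖ / 2) ^ (d - 1))⁻¹) * ENNReal.ofReal (riesz (y - x'))) y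
      + {y | ‖x - x'‖ / 2 / 2 < ‖y - x‖ ∧ ‖y - x‖ ≤ t}.indicator
          (fun y => ENNReal.ofReal (riesz (y - x) ^ 2)) y
      + {y | ‖x - x'‖ / 2 / 2 < ‖y - x'‖ ∧ ‖y - x'‖ ≤ t}.indicator
          (fun y => ENNReal.ofReal (riesz (y - x') ^ 2)) y := by
  have htri : ‖x - x'‖ ≤ ‖y - x‖ + ‖y - x'‖ := by
    have := norm_sub_le (y - x') (y - x)
    rw [sub_sub_sub_cancel_left] at this
    linarith
  by_cases h1 : ‖y - x‖ < ‖x - x'‖ / 2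
  · rw [indicator_of_mem (by simpa [dist_eq_norm] using h1), ← ENNReal.ofReal_mul (by positivity)]
    refine le_trans ?_ (le_trans (le_trans le_self_add le_self_add) le_self_add)
    refine ENNReal.ofReal_le_ofReal ?_
    rw [mul_comm]
    exact mul_le_mul_of_nonneg_right (riesz_le_of_le (by positivity) (by linarith)) (riesz_nonneg _)
  by_cases h2 : ‖y - x'‖ < ‖x - x'‖ / 2
  · rw [indicator_of_mem (a := y) (s := ball x' _) (by simpa [dist_eq_norm] using h2),
      ← ENNReal.ofReal_mul (by positivity)]
    refine le_trans ?_ (le_trans (le_trans le_add_self le_self_add) le_self_add)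
    refine ENNReal.ofReal_le_ofReal ?_
    exact mul_le_mul_of_nonneg_right (riesz_le_of_le (by positivity) (by linarith)) (riesz_nonneg _)
  push Not at h1 h2
  -- The radius |x - x'|/4 turns the weak inequalities available here into the strict ones defining
  -- the annuli.
  rw [indicator_of_mem (a := y) (s := {y | ‖x - x'‖ / 2 / 2 < ‖y - x‖ ∧ ‖y - x‖ ≤ t})
      ⟨by linarith, hx⟩,
    indicator_of_mem (a := y) (s := {y | ‖x - x'‖ / 2 / 2 < ‖y - x'‖ ∧ ‖y - x'‖ ≤ t})
      ⟨by linarith, hx'⟩, add_assoc]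
  refine le_trans ?_ le_add_self
  rw [← ENNReal.ofReal_add (by positivity) (by positivity)]
  refine ENNReal.ofReal_le_ofReal ?_
  nlinarith [sq_nonneg (riesz (y - x) - riesz (y - x')), sq_nonneg (riesz (y - x)),
    sq_nonneg (riesz (y - x'))]

/-- With r = |x - x'|, the two small balls contribute multiples of r · r^{1-d} and the two annuli
multiples of W(2t) - W(r/4). Both are controlled by 1 + |W(r)| through the doubling property, so
finiteness of Coulomb energy will imply integrability of field overlaps. -/
lemma exists_lintegral_riesz_mul_riesz_le {d : ℕ} (hd : 2 ≤ d) {t : ℝ} (ht : 0 < t) :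
    ∃ C : ℝ, 0 ≤ C ∧ ∀ x x' : Space d, ‖x‖ ≤ t → ‖x'‖ ≤ t → x ≠ x' →
      ∫⁻ y in ball 0 t, ENNReal.ofReal (riesz (y - x) * riesz (y - x')) ≤
        ENNReal.ofReal (C * (1 + |coulombW d ‖x - x'‖|)) := by
  have hA := sphereArea_pos hd
  refine ⟨2 * sphereArea d * ((1 + 2 ^ d) + (|coulombW d (2 * t)| + 2 ^ d * (1 + 2 ^ d))),
    by positivity, fun x x' hx hx' hne => ?_⟩
  set r := ‖x - x'‖ with hr
  have hr0 : 0 < r := norm_pos_iff.2 (sub_ne_zero.2 hne)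
  have hrt : r ≤ 2 * t := by linarith [norm_sub_le x x']
  set K := ((r / 2) ^ (d - 1))⁻¹ with hK
  have hmeas : ∀ z : Space d, MeasurableSet {y : Space d | r / 2 / 2 < ‖y - z‖ ∧ ‖y - z‖ ≤ 2 * t} :=
    fun z => by measurability
  have hb : ∀ z : Space d, ∫⁻ y, (ball z (r / 2)).indicator
      (fun y => ENNReal.ofReal K * ENNReal.ofReal (riesz (y - z))) y =
      ENNReal.ofReal (sphereArea d * (r / 2 * K)) := by
    intro z
    rw [lintegral_indicator measurableSet_ball, lintegral_const_mul _ (by fun_prop),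
      lintegral_riesz_ball hd z, ← ENNReal.ofReal_mul (by positivity)]
    congr 1; ring
  have ha : ∀ z : Space d, ∫⁻ y, {y | r / 2 / 2 < ‖y - z‖ ∧ ‖y - z‖ ≤ 2 * t}.indicator
      (fun y => ENNReal.ofReal (riesz (y - z) ^ 2)) y ≤
      ENNReal.ofReal (sphereArea d * (coulombW d (2 * t) - coulombW d (r / 2 / 2))) := by
    intro z
    rw [lintegral_indicator (hmeas z)]
    exact lintegral_riesz_sq_le hd z (by positivity) (by linarith)
  have hW2 := abs_coulombW_half_le hd hr0
  have hW4 := abs_coulombW_half_le hd (half_pos hr0)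
  have hKb : r / 2 * K ≤ 1 + |coulombW d (r / 2)| := mul_inv_pow_le hd (half_pos hr0)
  have hmono : coulombW d (r / 2 / 2) ≤ coulombW d (2 * t) :=
    coulombW_le_coulombW hd (by positivity) (by linarith)
  have hpt : ∀ y ∈ ball (0 : Space d) t, _ := fun y hy => by
    have hy' : ‖y‖ < t := by simpa using hy
    exact riesz_mul_riesz_le (t := 2 * t) hr0 (by linarith [norm_sub_le y x])
      (by linarith [norm_sub_le y x'])
  refine (setLIntegral_mono' measurableSet_ball hpt).trans
    ((setLIntegral_le_lintegral _ _).trans ?_)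
  calc _ ≤ ENNReal.ofReal (sphereArea d * (r / 2 * K)) + ENNReal.ofReal (sphereArea d * (r / 2 * K))
        + ENNReal.ofReal (sphereArea d * (coulombW d (2 * t) - coulombW d (r / 2 / 2)))
        + ENNReal.ofReal (sphereArea d * (coulombW d (2 * t) - coulombW d (r / 2 / 2))) := by
        rw [lintegral_add_right _ (Measurable.indicator (by fun_prop) (hmeas x')),
          lintegral_add_right _ (Measurable.indicator (by fun_prop) (hmeas x)),
          lintegral_add_right _ (Measurable.indicator (by fun_prop) measurableSet_ball), hb, hb]
        gcongr
        · exact ha x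
        · exact ha x'
    _ = ENNReal.ofReal (2 * sphereArea d *
          (r / 2 * K + (coulombW d (2 * t) - coulombW d (r / 2 / 2)))) := by
        have h1 : 0 ≤ sphereArea d * (r / 2 * K) := by positivity
        have h2 : 0 ≤ sphereArea d * (coulombW d (2 * t) - coulombW d (r / 2 / 2)) :=
          mul_nonneg hA.le (by linarith)
        rw [← ENNReal.ofReal_add h1 h1, ← ENNReal.ofReal_add (by linarith) h2,
          ← ENNReal.ofReal_add (by linarith) h2]
        congr 1; ring
    _ ≤ _ := by
        refine ENNReal.ofReal_le_ofReal ?_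
        rw [mul_assoc (2 * sphereArea d)]
        refine mul_le_mul_of_nonneg_left ?_ (by positivity)
        have e1 := le_abs_self (coulombW d (2 * t))
        have e2 := neg_abs_le (coulombW d (r / 2 / 2))
        have e3 := abs_nonneg (coulombW d r)
        have e4 := abs_nonneg (coulombW d (2 * t))
        have e5 : (1 : ℝ) ≤ 2 ^ d := one_le_pow₀ (by norm_num)
        have e6 : (2 : ℝ) ^ d * (1 + |coulombW d (r / 2)|) ≤
            2 ^ d * (1 + 2 ^ d * (1 + |coulombW d r|)) := by gcongr
        have e7 : 0 ≤ |coulombW d (2 * t)| * |coulombW d r| := by positivity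
        nlinarith

/-! ### First variation of the energy and displacement of mass. -/

/-- The interaction `q q' W(|x - x'|)` of two charged points. -/
def interaction {d : ℕ} (z : (ℝ × Space d) × (ℝ × Space d)) : ℝ :=
  z.1.1 * z.2.1 * coulombW d ‖z.1.2 - z.2.2‖

@[fun_prop]
lemma measurable_interaction {d : ℕ} : Measurable (interaction (d := d)) := by
  unfold interaction; fun_prop

lemma interaction_swap {d : ℕ} (z : (ℝ × Space d) × (ℝ × Space d)) :
    interaction z.swap = interaction z := by
  simp only [interaction, Prod.fst_swap, Prod.snd_swap, norm_sub_rev z.2.2]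
  ring

lemma intensiveEnergy_eq {d : ℕ} (g : ℝ → ℝ) (μ : Measure (ℝ × Space d)) :
    intensiveEnergy g μ =
      (∫ p, p.1 * g p.1 * confV p.2 ∂μ) - ∫ z, interaction z ∂(μ.prod μ) := rfl

lemma nonneg_of_forall_add_mul_nonneg {a b : ℝ} (h : ∀ t, 0 < t → t < 1 → 0 ≤ a + t * b) :
    0 ≤ a := by
  have h1 : Tendsto (fun t : ℝ => a + t * b) (𝓝[>] 0) (𝓝 (a + 0 * b)) :=
    ((continuous_const.add (continuous_id.mul continuous_const)).tendsto 0).mono_left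
      nhdsWithin_le_nhds
  simp only [zero_mul, add_zero] at h1
  refine ge_of_tendsto h1 ?_
  filter_upwards [Ioo_mem_nhdsGT (zero_lt_one (α := ℝ))] with t ht using h t ht.1 ht.2

/-- First variation of the energy at a minimizer. -/
lemma IsEnergyMinimizer.first_variation {d : ℕ} {g : ℝ → ℝ} {ν : Measure ℝ}
    {μ μ' : Measure (ℝ × Space d)} (hμ : IsEnergyMinimizer g ν μ) (hμ' : μ' ∈ doubleLayer d ν)
    (hE : HasFiniteEnergy g μ') (hne : ∀ᵐ z ∂(μ.prod μ'), z.1.2 ≠ z.2.2)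
    (hint : Integrable interaction (μ.prod μ')) :
    (∫ p, p.1 * g p.1 * confV p.2 ∂μ) - 2 * ∫ z, interaction z ∂(μ.prod μ) ≤
      (∫ p, p.1 * g p.1 * confV p.2 ∂μ') - 2 * ∫ z, interaction z ∂(μ.prod μ') := by
  obtain ⟨⟨hp, hm⟩, ⟨hV, hn, hK⟩, hmin⟩ := hμ
  obtain ⟨hp', hm'⟩ := hμ'
  obtain ⟨hV', hn', hK'⟩ := hE
  change Integrable interaction (μ.prod μ) at hK
  change Integrable interaction (μ'.prod μ') at hK'
  have hsw : μ'.prod μ = (μ.prod μ').map Prod.swap := Measure.prod_swap.symm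
  have hint2 : Integrable interaction (μ'.prod μ) := by
    have := hint.swap
    refine this.congr (Eventually.of_forall fun z => ?_)
    exact interaction_swap z
  have hne2 : ∀ᵐ z ∂(μ'.prod μ), z.1.2 ≠ z.2.2 := by
    rw [hsw]
    refine (ae_map_iff measurable_swap.aemeasurable ?_).2 ?_
    · exact (measurableSet_eq_fun (by fun_prop) (by fun_prop)).compl
    · filter_upwards [hne] with z hz using hz.symm
  have hval2 : ∫ z, interaction z ∂(μ'.prod μ) = ∫ z, interaction z ∂(μ.prod μ') := by
    rw [← integral_prod_swap]
    simp_rw [interaction_swap]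
  set F := ∫ p, p.1 * g p.1 * confV p.2 ∂μ
  set F' := ∫ p, p.1 * g p.1 * confV p.2 ∂μ'
  set k := ∫ z, interaction z ∂(μ.prod μ) with hk
  set k1 := ∫ z, interaction z ∂(μ.prod μ') with hk1
  set k2 := ∫ z, interaction z ∂(μ'.prod μ') with hk2
  -- Energy difference along the segment (1 - t)μ + tμ', divided by t. The sign of the quadratic
  -- coefficient is irrelevant, since t tends to 0.
  suffices h : ∀ t : ℝ, 0 < t → t < 1 →
      0 ≤ (F' - F - 2 * (k1 - k)) + t * (-(k - 2 * k1 + k2)) by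
    linarith [nonneg_of_forall_add_mul_nonneg h]
  intro t ht0 ht1
  have hs0 : 0 < 1 - t := by linarith
  set a := ENNReal.ofReal (1 - t) with ha
  set b := ENNReal.ofReal t with hb
  have hab : a + b = 1 := by
    rw [ha, hb, ← ENNReal.ofReal_add hs0.le ht0.le]; simp
  have ha' : a ≠ ⊤ := ENNReal.ofReal_ne_top
  have hb' : b ≠ ⊤ := ENNReal.ofReal_ne_top
  have hat : a.toReal = 1 - t := ENNReal.toReal_ofReal hs0.le
  have hbt : b.toReal = t := ENNReal.toReal_ofReal ht0.le
  have hfa : IsFiniteMeasure (a • μ) := Measure.smul_finite μ ha'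
  have hfb : IsFiniteMeasure (b • μ') := Measure.smul_finite μ' hb'
  have hprod : (a • μ + b • μ').prod (a • μ + b • μ') =
      ((a * a) • (μ.prod μ) + (a * b) • (μ.prod μ')) +
        ((b * a) • (μ'.prod μ) + (b * b) • (μ'.prod μ')) := by
    rw [Measure.add_prod, Measure.prod_add, Measure.prod_add]
    simp only [Measure.prod_smul_left, Measure.prod_smul_right, smul_smul]
    simp only [mul_comm b a]
  have hmem : a • μ + b • μ' ∈ doubleLayer d ν := by
    refine ⟨⟨?_⟩, ?_⟩
    · simp [hab]
    · rw [Measure.map_add _ _ measurable_fst, Measure.map_smul, Measure.map_smul, hm, hm',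
        ← add_smul, hab, one_smul]
  have hfin : HasFiniteEnergy g (a • μ + b • μ') := by
    refine ⟨(hV.smul_measure ha').add_measure (hV'.smul_measure hb'), ?_, ?_⟩
    · rw [hprod]
      simp only [ae_add_measure_iff]
      exact ⟨⟨Measure.ae_smul_measure hn _, Measure.ae_smul_measure hne _⟩,
        ⟨Measure.ae_smul_measure hne2 _, Measure.ae_smul_measure hn' _⟩⟩
    · change Integrable interaction _
      rw [hprod]
      exact ((hK.smul_measure (ENNReal.mul_ne_top ha' ha')).add_measure
        (hint.smul_measure (ENNReal.mul_ne_top ha' hb'))).add_measure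
        ((hint2.smul_measure (ENNReal.mul_ne_top hb' ha')).add_measure
        (hK'.smul_measure (ENNReal.mul_ne_top hb' hb')))
  have h := hmin _ hmem hfin
  rw [intensiveEnergy_eq, intensiveEnergy_eq, hprod,
    integral_add_measure (hV.smul_measure ha') (hV'.smul_measure hb'),
    integral_add_measure ((hK.smul_measure (ENNReal.mul_ne_top ha' ha')).add_measure
        (hint.smul_measure (ENNReal.mul_ne_top ha' hb')))
        ((hint2.smul_measure (ENNReal.mul_ne_top hb' ha')).add_measure
        (hK'.smul_measure (ENNReal.mul_ne_top hb' hb'))),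
    integral_add_measure (hK.smul_measure (ENNReal.mul_ne_top ha' ha'))
        (hint.smul_measure (ENNReal.mul_ne_top ha' hb')),
    integral_add_measure (hint2.smul_measure (ENNReal.mul_ne_top hb' ha'))
        (hK'.smul_measure (ENNReal.mul_ne_top hb' hb'))] at h
  simp only [integral_smul_measure, ENNReal.toReal_mul, hat, hbt, hval2, smul_eq_mul,
    ← hk, ← hk1, ← hk2] at h
  have h2 : 0 ≤ t * ((F' - F - 2 * (k1 - k)) + t * (-(k - 2 * k1 + k2))) := by
    nlinarith
  exact nonneg_of_mul_nonneg_right h2 ht0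

/-- A measure β with uniformly bounded potential for this kernel is integrated first, whatever the
law of the other point. -/
lemma integrable_riesz_prod {d : ℕ} {α : Type*} [MeasurableSpace α] (τ : Measure α)
    [IsProbabilityMeasure τ] (β : Measure (Space d)) [IsProbabilityMeasure β] {C : ℝ≥0∞}
    (hC : C ≠ ⊤) (hβ : ∀ x : Space d, ∫⁻ y, ENNReal.ofReal (riesz (y - x)) ∂β ≤ C)
    {u : α → Space d} (hu : Measurable u) :
    Integrable (fun z : α × Space d => riesz (z.2 - u z.1)) (τ.prod β) := by
  refine ⟨Measurable.aestronglyMeasurable (by fun_prop), ?_⟩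
  rw [hasFiniteIntegral_iff_ofReal (Eventually.of_forall fun z => riesz_nonneg _),
    lintegral_prod _ (by fun_prop)]
  refine lt_of_le_of_lt (lintegral_mono fun z => hβ (u z)) ?_
  simpa using hC.lt_top

lemma measurableSet_position_ne {d : ℕ} :
    MeasurableSet {z : (ℝ × Space d) × (ℝ × Space d) | z.1.2 ≠ z.2.2} :=
  (measurableSet_eq_fun (by fun_prop) (by fun_prop)).compl

lemma ae_map_position_ne_iff {d : ℕ} {α : Type*} [MeasurableSpace α] {τ : Measure α}
    {u : α → (ℝ × Space d) × (ℝ × Space d)} (hu : Measurable u) :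
    (∀ᵐ z ∂(τ.map u), z.1.2 ≠ z.2.2) ↔ ∀ᵐ w ∂τ, (u w).1.2 ≠ (u w).2.2 :=
  ae_map_iff (p := fun z : (ℝ × Space d) × (ℝ × Space d) => z.1.2 ≠ z.2.2) hu.aemeasurable
    measurableSet_position_ne

/-- The second position is independent and has law β, so the singularity of W is absorbed by the
bounded potential of β, and its growth by the first moment of the first position. Charges are
bounded. -/
lemma integrable_interaction_move {d : ℕ} (hd : 2 ≤ d) {qmin qmax : ℝ} (hq : 0 < qmin)
    {μ : Measure (ℝ × Space d)} [IsProbabilityMeasure μ]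
    (hμQ : ∀ᵐ p ∂μ, p.1 ∈ Icc qmin qmax)
    {β : Measure (Space d)} [IsProbabilityMeasure β] {C : ℝ≥0∞}
    (hC : C ≠ ⊤) (hβ : ∀ x : Space d, ∫⁻ y, ENNReal.ofReal (riesz (y - x)) ∂β ≤ C)
    {R : ℝ} (hβR : ∀ᵐ y ∂β, ‖y‖ ≤ R)
    {u : (ℝ × Space d) × Space d → ℝ × Space d} (hu : Measurable u)
    (huQ : ∀ᵐ z ∂(μ.prod β), (u z).1 ∈ Icc qmin qmax)
    (hui : Integrable (fun z => ‖(u z).2‖) (μ.prod β)) :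
    Integrable (fun w : ((ℝ × Space d) × Space d) × ((ℝ × Space d) × Space d) =>
      interaction (u w.1, (w.2.1.1, w.2.2))) ((μ.prod β).prod (μ.prod β)) := by
  have h1 : Integrable (fun w : ((ℝ × Space d) × Space d) × ((ℝ × Space d) × Space d) =>
      riesz (w.2.2 - (u w.1).2)) ((μ.prod β).prod (μ.prod β)) := by
    have hmp : MeasurePreserving (Prod.map id Prod.snd :
        ((ℝ × Space d) × Space d) × ((ℝ × Space d) × Space d) → _)
        ((μ.prod β).prod (μ.prod β)) ((μ.prod β).prod β) :=
      (MeasurePreserving.id _).prod measurePreserving_snd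
    exact hmp.integrable_comp_of_integrable (integrable_riesz_prod (μ.prod β) β hC hβ
      (u := fun z => (u z).2) (by fun_prop))
  have h2 : Integrable (fun w : ((ℝ × Space d) × Space d) × ((ℝ × Space d) × Space d) =>
      ‖(u w.1).2‖) ((μ.prod β).prod (μ.prod β)) := hui.comp_fst _
  refine ((((integrable_const (1 + R)).add h2).add h1).const_mul (qmax * qmax)).mono'
    (Measurable.aestronglyMeasurable (by fun_prop)) ?_
  have e1 : ∀ᵐ w ∂((μ.prod β).prod (μ.prod β)), (u w.1).1 ∈ Icc qmin qmax :=
    Measure.quasiMeasurePreserving_fst.ae huQ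
  have e2 : ∀ᵐ w ∂((μ.prod β).prod (μ.prod β)), w.2.1.1 ∈ Icc qmin qmax :=
    Measure.quasiMeasurePreserving_snd.ae (Measure.quasiMeasurePreserving_fst.ae hμQ)
  have e3 : ∀ᵐ w ∂((μ.prod β).prod (μ.prod β)), ‖w.2.2‖ ≤ R :=
    Measure.quasiMeasurePreserving_snd.ae (Measure.quasiMeasurePreserving_snd.ae hβR)
  filter_upwards [e1, e2, e3] with w w1 w2 w3
  simp only [interaction, Pi.add_apply, norm_mul, Real.norm_eq_abs]
  have hb := abs_coulombW_le hd (norm_nonneg ((u w.1).2 - w.2.2))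
  have hs : (‖(u w.1).2 - w.2.2‖ ^ (d - 1))⁻¹ = riesz (w.2.2 - (u w.1).2) := by
    rw [riesz, norm_sub_rev]
  rw [hs] at hb
  have hn := norm_sub_le (u w.1).2 w.2.2
  have a1 : |(u w.1).1| ≤ qmax := by rw [abs_of_pos (hq.trans_le w1.1)]; exact w1.2
  have a2 : |w.2.1.1| ≤ qmax := by rw [abs_of_pos (hq.trans_le w2.1)]; exact w2.2
  have a0 : 0 ≤ qmax := (abs_nonneg _).trans a1
  gcongr
  linarith

/-- Moving mass away from a minimizer does not pay: the effective potential at a point charged by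
the minimizer is at most its value at almost every other position. -/
lemma IsEnergyMinimizer.ae_zetaRaw_le_aux {d : ℕ} (hd : 2 ≤ d) {qmin qmax : ℝ} (hq : 0 < qmin)
    {ν : Measure ℝ} {g : ℝ → ℝ} (hg : AEMeasurable g ν) {M : ℝ}
    (hgM : ∀ t ∈ Icc qmin qmax, |g t| ≤ M)
    {μ : Measure (ℝ × Space d)} (hμ : IsEnergyMinimizer g ν μ)
    (hμQ : ∀ᵐ p ∂μ, p.1 ∈ Icc qmin qmax) (hμn : Integrable (fun p => ‖p.2‖) μ)
    {β : Measure (Space d)} [IsProbabilityMeasure β] [NullSingletonClass β] {C : ℝ≥0∞}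
    (hC : C ≠ ⊤) (hβ : ∀ x : Space d, ∫⁻ y, ENNReal.ofReal (riesz (y - x)) ∂β ≤ C)
    {R : ℝ} (hβR : ∀ᵐ y ∂β, ‖y‖ ≤ R) :
    ∀ᵐ z ∂(μ.prod β), zetaRaw g μ z.1.1 z.1.2 ≤ zetaRaw g μ z.1.1 z.2 := by
  classical
  have hp : IsProbabilityMeasure μ := hμ.1.1
  have hmν : μ.map Prod.fst = ν := hμ.1.2
  obtain ⟨hV, hn, hK⟩ := hμ.2.1
  change Integrable interaction (μ.prod μ) at hK
  set m := μ.prod β with hm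
  -- A sample of μ ⊗ β is a charged particle with a proposed new position: `a` leaves the particle
  -- in place, `b` moves it without changing its charge.
  let a : (ℝ × Space d) × Space d → ℝ × Space d := Prod.fst
  let b : (ℝ × Space d) × Space d → ℝ × Space d := fun z => (z.1.1, z.2)
  have hameas : Measurable a := measurable_fst
  have hbmeas : Measurable b := by fun_prop
  have hmapa : m.map a = μ := (measurePreserving_fst (μ := μ) (ν := β)).map_eq
  have haQ : ∀ᵐ z ∂m, (a z).1 ∈ Icc qmin qmax := Measure.quasiMeasurePreserving_fst.ae hμQ
  have hbQ : ∀ᵐ z ∂m, (b z).1 ∈ Icc qmin qmax := haQ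
  have hai : Integrable (fun z => ‖(a z).2‖) m := hμn.comp_fst β
  have hbR : ∀ᵐ z ∂m, ‖(b z).2‖ ≤ R := Measure.quasiMeasurePreserving_snd.ae hβR
  have hbi : Integrable (fun z => ‖(b z).2‖) m :=
    Integrable.mono' (integrable_const R) (by fun_prop) (by simpa using hbR)
  have hmapprod : ∀ T : (ℝ × Space d) × Space d → ℝ × Space d, Measurable T →
      (μ.prod (m.map T)) = (m.prod m).map (Prod.map a T) := by
    intro T hT
    conv_lhs => rw [← hmapa]
    exact Measure.map_prod_map m m hameas hT
  have iaa : Integrable (fun w => interaction (a w.1, a w.2)) (m.prod m) := by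
    have := hmapprod a hameas
    rw [hmapa] at this
    rw [this, integrable_map_measure measurable_interaction.aestronglyMeasurable (by fun_prop)] at hK
    exact hK
  have iab : Integrable (fun w => interaction (a w.1, b w.2)) (m.prod m) :=
    integrable_interaction_move hd hq hμQ hC hβ hβR hameas haQ hai
  have ibb : Integrable (fun w => interaction (b w.1, b w.2)) (m.prod m) :=
    integrable_interaction_move hd hq hμQ hC hβ hβR hbmeas hbQ hbi
  have iba : Integrable (fun w => interaction (b w.1, a w.2)) (m.prod m) := by
    refine iab.swap.congr (Eventually.of_forall fun w => ?_)
    exact interaction_swap (b w.1, a w.2)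
  have naa : ∀ᵐ w ∂(m.prod m), (a w.1).2 ≠ (a w.2).2 := by
    have := hmapprod a hameas
    rw [hmapa] at this
    rw [this] at hn
    exact (ae_map_position_ne_iff (by fun_prop)).1 hn
  -- A moved particle almost surely coincides with no other one because β has no atoms.
  have nb : ∀ u : (ℝ × Space d) × Space d → ℝ × Space d, Measurable u →
      ∀ᵐ w ∂(m.prod m), (u w.1).2 ≠ (b w.2).2 := by
    intro u hu
    have hms : MeasurableSet {w : ((ℝ × Space d) × Space d) × ((ℝ × Space d) × Space d) |
        (u w.1).2 ≠ (b w.2).2} := (measurableSet_eq_fun (by fun_prop) (by fun_prop)).compl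
    rw [Measure.ae_prod_iff_ae_ae hms]
    refine Eventually.of_forall fun z => ?_
    refine Measure.quasiMeasurePreserving_snd.ae (p := fun y => (u z).2 ≠ y) ?_
    simp [ae_iff]
  have nab := nb a hameas
  have nbb := nb b hbmeas
  have nba : ∀ᵐ w ∂(m.prod m), (b w.1).2 ≠ (a w.2).2 := by
    have : ∀ᵐ w ∂((m.prod m).map Prod.swap), (a w.1).2 ≠ (b w.2).2 := by
      rw [Measure.prod_swap]; exact nab
    filter_upwards [ae_of_ae_map measurable_swap.aemeasurable this] with w hw using hw.symm
  let f : ℝ × Space d → ℝ := fun p => p.1 * g p.1 * confV p.2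
  let e : ℝ × Space d → ℝ := fun p => p.1 * chargePotential μ p.2
  have hVa : Integrable (fun z => f (a z)) m := hV.comp_fst β
  have hgμ : AEMeasurable (fun p : ℝ × Space d => g p.1) μ := by
    rw [← hmν] at hg
    exact hg.comp_measurable measurable_fst
  have hVb : Integrable (fun z => f (b z)) m := by
    have h1 : Integrable (fun p : ℝ × Space d => p.1 * g p.1) μ := by
      refine Integrable.mono' (integrable_const (qmax * M))
        (measurable_fst.aemeasurable.mul hgμ).aestronglyMeasurable ?_
      filter_upwards [hμQ] with p hp
      rw [norm_mul, Real.norm_eq_abs, Real.norm_eq_abs, abs_of_pos (hq.trans_le hp.1)]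
      have := hgM _ hp
      have := hp.2
      have h0 : 0 ≤ qmax := (hq.trans_le hp.1).le.trans hp.2
      gcongr
    have h2 : Integrable (fun y : Space d => confV y) β := by
      refine Integrable.mono' (integrable_const (R ^ 2)) (by unfold confV; fun_prop) ?_
      filter_upwards [hβR] with y hy
      simp only [confV, norm_pow, norm_norm]
      gcongr
    exact h1.mul_prod h2
  have hpot : ∀ (u : (ℝ × Space d) × Space d → ℝ × Space d),
      Integrable (fun w => interaction (a w.1, u w.2)) (m.prod m) →
      Integrable (fun z => e (u z)) m ∧
        ∫ w, interaction (a w.1, u w.2) ∂(m.prod m) = ∫ z, e (u z) ∂m := by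
    intro u hi
    have hinner : ∀ z, ∫ z', interaction (a z', u z) ∂m = e (u z) := by
      intro z
      have : ∀ z', interaction (a z', u z) =
          (u z).1 * ((fun p : ℝ × Space d => p.1 * coulombW d ‖(u z).2 - p.2‖) z'.1) := by
        intro z'
        simp only [interaction, a]
        rw [norm_sub_rev]; ring
      have h2 := integral_fun_fst (μ := μ) (ν := β)
        (fun p : ℝ × Space d => p.1 * coulombW d ‖(u z).2 - p.2‖)
      simp_rw [this]
      rw [integral_const_mul]
      exact congrArg _ (h2.trans (by simp [chargePotential]))
    constructor
    · exact hi.integral_prod_right.congr (Eventually.of_forall hinner)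
    · rw [integral_prod_symm _ hi]
      exact integral_congr_ae (Eventually.of_forall hinner)
  have hea := (hpot a iaa).1
  have heb := (hpot b iab).1
  -- This is twice `zetaRaw`, the derivative of the energy at μ.
  let Z : ℝ × Space d → ℝ := fun p => f p - 2 * e p
  have hZa : Integrable (fun z => Z (a z)) m := hVa.sub (hea.const_mul 2)
  have hZb : Integrable (fun z => Z (b z)) m := hVb.sub (heb.const_mul 2)
  have key : ∀ s : Set ((ℝ × Space d) × Space d), MeasurableSet s → m s < ⊤ →
      0 ≤ ∫ z in s, (Z (b z) - Z (a z)) ∂m := by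
    intro s hs _
    -- Only the samples in s are moved. Charges are untouched, so the image of μ ⊗ β is an
    -- admissible competitor, and since s is arbitrary the integral inequality localizes to an
    -- almost everywhere one.
    let T : (ℝ × Space d) × Space d → ℝ × Space d := s.piecewise b a
    have hT : Measurable T := hbmeas.piecewise hs hameas
    have hTin : ∀ {z}, z ∈ s → T z = b z := fun hz => piecewise_eq_of_mem _ _ _ hz
    have hTout : ∀ {z}, z ∉ s → T z = a z := fun hz => piecewise_eq_of_notMem _ _ _ hz
    have hT1 : ∀ z, (T z).1 = z.1.1 := by
      intro z
      by_cases hz : z ∈ s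
      · rw [hTin hz]
      · rw [hTout hz]
    have hTcase : ∀ z, T z = a z ∨ T z = b z := by
      intro z
      by_cases hz : z ∈ s
      · exact Or.inr (hTin hz)
      · exact Or.inl (hTout hz)
    have hmem : m.map T ∈ doubleLayer d ν := by
      refine ⟨Measure.isProbabilityMeasure_map hT.aemeasurable, ?_⟩
      rw [Measure.map_map measurable_fst hT]
      have : Prod.fst ∘ T = Prod.fst ∘ a := funext hT1
      rw [this, ← Measure.map_map measurable_fst hameas, hmapa, hmν]
    have iaT : Integrable (fun w => interaction (a w.1, T w.2)) (m.prod m) := by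
      refine (iaa.norm.add iab.norm).mono' (Measurable.aestronglyMeasurable (by fun_prop)) (Eventually.of_forall fun w => ?_)
      have n1 := norm_nonneg (interaction (a w.1, a w.2))
      have n2 := norm_nonneg (interaction (a w.1, b w.2))
      simp only [Pi.add_apply]
      rcases hTcase w.2 with h | h <;> rw [h] <;> linarith
    have iTT : Integrable (fun w => interaction (T w.1, T w.2)) (m.prod m) := by
      refine ((iaa.norm.add iab.norm).add (iba.norm.add ibb.norm)).mono'
        (Measurable.aestronglyMeasurable (by fun_prop)) (Eventually.of_forall fun w => ?_)
      have n1 := norm_nonneg (interaction (a w.1, a w.2))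
      have n2 := norm_nonneg (interaction (a w.1, b w.2))
      have n3 := norm_nonneg (interaction (b w.1, a w.2))
      have n4 := norm_nonneg (interaction (b w.1, b w.2))
      simp only [Pi.add_apply]
      rcases hTcase w.1 with h | h <;> rcases hTcase w.2 with h' | h' <;> rw [h, h'] <;> linarith
    have hVT : Integrable (fun z => f (T z)) m := by
      have : (fun z => f (T z)) = s.piecewise (fun z => f (b z)) (fun z => f (a z)) := by
        ext z
        by_cases hz : z ∈ s
        · simp [hTin hz, hz]
        · simp [hTout hz, hz]
      rw [this]
      exact Integrable.piecewise hs hVb.integrableOn hVa.integrableOn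
    have hfT : AEStronglyMeasurable f (m.map T) := by
      have h1 : AEMeasurable (fun p : ℝ × Space d => g p.1) (m.map T) := by
        rw [← hmem.2] at hg
        exact hg.comp_measurable measurable_fst
      refine AEMeasurable.aestronglyMeasurable ?_
      refine (measurable_fst.aemeasurable.mul h1).mul ?_
      unfold confV
      fun_prop
    have hprod2 : (m.map T).prod (m.map T) = (m.prod m).map (Prod.map T T) :=
      Measure.map_prod_map m m hT hT
    have hE : HasFiniteEnergy g (m.map T) := by
      refine ⟨(integrable_map_measure hfT hT.aemeasurable).2 hVT, ?_, ?_⟩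
      · rw [hprod2, ae_map_position_ne_iff (by fun_prop)]
        filter_upwards [naa, nab, nba, nbb] with w w1 w2 w3 w4
        simp only [Prod.map]
        rcases hTcase w.1 with h | h <;> rcases hTcase w.2 with h' | h' <;> rw [h, h'] <;>
          assumption
      · change Integrable interaction _
        rw [hprod2, integrable_map_measure measurable_interaction.aestronglyMeasurable (by fun_prop)]
        exact iTT
    have hne : ∀ᵐ z ∂(μ.prod (m.map T)), z.1.2 ≠ z.2.2 := by
      rw [hmapprod T hT, ae_map_position_ne_iff (by fun_prop)]
      filter_upwards [naa, nab] with w w1 w2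
      simp only [Prod.map]
      rcases hTcase w.2 with h' | h' <;> rw [h'] <;> assumption
    have hint : Integrable interaction (μ.prod (m.map T)) := by
      rw [hmapprod T hT, integrable_map_measure measurable_interaction.aestronglyMeasurable (by fun_prop)]
      exact iaT
    have hfv := hμ.first_variation hmem hE hne hint
    have hl1 : ∫ p, p.1 * g p.1 * confV p.2 ∂μ = ∫ z, f (a z) ∂m := by
      
      have h2 := integral_fun_fst (μ := μ) (ν := β) f
      simpa [f] using h2.symm
    have hl2 : ∫ z, interaction z ∂(μ.prod μ) = ∫ z, e (a z) ∂m := by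
      have := hmapprod a hameas
      rw [hmapa] at this
      rw [this, integral_map (by fun_prop) measurable_interaction.aestronglyMeasurable]
      exact (hpot a iaa).2
    have hr1 : ∫ p, p.1 * g p.1 * confV p.2 ∂(m.map T) = ∫ z, f (T z) ∂m :=
      integral_map hT.aemeasurable hfT
    have hr2 : ∫ z, interaction z ∂(μ.prod (m.map T)) = ∫ z, e (T z) ∂m := by
      rw [hmapprod T hT, integral_map (by fun_prop) measurable_interaction.aestronglyMeasurable]
      exact (hpot T iaT).2
    rw [hl1, hl2, hr1, hr2, ← integral_const_mul, ← integral_const_mul,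
      ← integral_sub hVa (hea.const_mul 2), ← integral_sub hVT ((hpot T iaT).1.const_mul 2)] at hfv
    have hZT : Integrable (fun z => Z (T z)) m := hVT.sub ((hpot T iaT).1.const_mul 2)
    have h1 : ∫ z in s, (Z (b z) - Z (a z)) ∂m = ∫ z, (Z (T z) - Z (a z)) ∂m := by
      rw [← integral_indicator hs]
      refine integral_congr_ae (Eventually.of_forall fun z => ?_)
      by_cases hz : z ∈ s
      · simp [hz, hTin hz]
      · simp [hz, hTout hz]
    rw [h1, integral_sub hZT hZa]
    simp only [Z] at *
    linarith
  have hfinal := ae_nonneg_of_forall_setIntegral_nonneg (hZb.sub hZa) key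
  filter_upwards [hfinal] with z hz
  simp only [Pi.zero_apply, Pi.sub_apply, Z, f, e, a, b] at hz
  simp only [zetaRaw]
  linarith

/-- The uniform probability on a ball has no atoms and a bounded potential; rescaling it to Lebesgue
measure leaves the null sets unchanged. -/
lemma IsEnergyMinimizer.ae_zetaRaw_le_ball {d : ℕ} (hd : 2 ≤ d) {qmin qmax : ℝ} (hq : 0 < qmin)
    {ν : Measure ℝ} {g : ℝ → ℝ} (hg : AEMeasurable g ν) {M : ℝ}
    (hgM : ∀ t ∈ Icc qmin qmax, |g t| ≤ M)
    {μ : Measure (ℝ × Space d)} (hμ : IsEnergyMinimizer g ν μ)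
    (hμQ : ∀ᵐ p ∂μ, p.1 ∈ Icc qmin qmax) (hμn : Integrable (fun p => ‖p.2‖) μ)
    {R : ℝ} (hR : 0 < R) :
    ∀ᵐ z ∂(μ.prod (volume.restrict (ball (0 : Space d) R))),
      zetaRaw g μ z.1.1 z.1.2 ≤ zetaRaw g μ z.1.1 z.2 := by
  have hp : IsProbabilityMeasure μ := hμ.1.1
  have hv0 : volume (ball (0 : Space d) R) ≠ 0 := (measure_ball_pos _ _ hR).ne'
  have hv : volume (ball (0 : Space d) R) ≠ ⊤ := measure_ball_lt_top.ne
  have hc : (volume (ball (0 : Space d) R))⁻¹ ≠ ⊤ := ENNReal.inv_ne_top.2 hv0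
  set β : Measure (Space d) :=
    (volume (ball (0 : Space d) R))⁻¹ • volume.restrict (ball (0 : Space d) R) with hβ
  have hβp : IsProbabilityMeasure β := ⟨by
    rw [hβ, Measure.smul_apply, Measure.restrict_apply_univ, smul_eq_mul,
      ENNReal.inv_mul_cancel hv0 hv]⟩
  have hnt := nontrivial_space hd
  have hβn : NullSingletonClass β := ⟨fun y => by
    rw [hβ, Measure.smul_apply, Measure.restrict_apply (measurableSet_singleton y)]
    simp [measure_mono_null inter_subset_left (measure_singleton y)]⟩
  have h := hμ.ae_zetaRaw_le_aux hd hq hg hgM hμQ hμn (β := β) (R := R)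
    (C := (volume (ball (0 : Space d) R))⁻¹ *
      (ENNReal.ofReal (sphereArea d) + volume (ball (0 : Space d) R)))
    (ENNReal.mul_ne_top hc (ENNReal.add_ne_top.2 ⟨ENNReal.ofReal_ne_top, hv⟩))
    (fun x => by
      rw [hβ, lintegral_smul_measure, smul_eq_mul]
      gcongr
      exact lintegral_riesz_le hd x _)
    (by
      refine Measure.ae_smul_measure ?_ _
      filter_upwards [ae_restrict_mem measurableSet_ball] with y hy
      exact (by simpa using hy : ‖y‖ < R).le)
  rw [hβ, Measure.prod_smul_right] at h
  rwa [Measure.ae_ennreal_smul_measure_eq (ENNReal.inv_ne_zero.2 hv)] at h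

lemma IsEnergyMinimizer.ae_ae_zetaRaw_le {d : ℕ} (hd : 2 ≤ d) {qmin qmax : ℝ} (hq : 0 < qmin)
    {ν : Measure ℝ} {g : ℝ → ℝ} (hg : AEMeasurable g ν) {M : ℝ}
    (hgM : ∀ t ∈ Icc qmin qmax, |g t| ≤ M)
    {μ : Measure (ℝ × Space d)} (hμ : IsEnergyMinimizer g ν μ)
    (hμQ : ∀ᵐ p ∂μ, p.1 ∈ Icc qmin qmax) (hμn : Integrable (fun p => ‖p.2‖) μ) :
    ∀ᵐ p ∂μ, ∀ᵐ y : Space d, zetaRaw g μ p.1 p.2 ≤ zetaRaw g μ p.1 y := by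
  have hp : IsProbabilityMeasure μ := hμ.1.1
  have h : ∀ n : ℕ, ∀ᵐ p ∂μ, ∀ᵐ y ∂(volume.restrict (ball (0 : Space d) (n + 1))),
      zetaRaw g μ p.1 p.2 ≤ zetaRaw g μ p.1 y := fun n =>
    Measure.ae_ae_of_ae_prod (hμ.ae_zetaRaw_le_ball hd hq hg hgM hμQ hμn
      (by positivity : (0 : ℝ) < n + 1))
  filter_upwards [ae_all_iff.2 h] with p hp
  have := ae_restrict_iUnion_iff (fun n : ℕ => ball (0 : Space d) (n + 1))
    (fun y => zetaRaw g μ p.1 p.2 ≤ zetaRaw g μ p.1 y) (μ := volume)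
  rw [iUnion_eq_univ_iff.2, Measure.restrict_univ] at this
  · exact this.2 hp
  · intro y
    obtain ⟨n, hn⟩ := exists_nat_gt ‖y‖
    exact ⟨n, by simpa using hn.trans (lt_add_one _)⟩

/-- Fubini's theorem with the target as outer variable. A single y that serves almost every particle
makes the lower bound on the potential uniform in the charge. -/
lemma IsEnergyMinimizer.exists_zetaRaw_le {d : ℕ} (hd : 2 ≤ d) {qmin qmax : ℝ} (hq : 0 < qmin)
    {ν : Measure ℝ} {g : ℝ → ℝ} (hg : AEMeasurable g ν) {M : ℝ}
    (hgM : ∀ t ∈ Icc qmin qmax, |g t| ≤ M)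
    {μ : Measure (ℝ × Space d)} (hμ : IsEnergyMinimizer g ν μ)
    (hμQ : ∀ᵐ p ∂μ, p.1 ∈ Icc qmin qmax) (hμn : Integrable (fun p => ‖p.2‖) μ) :
    ∃ y : Space d, ∀ᵐ p ∂μ, zetaRaw g μ p.1 p.2 ≤ zetaRaw g μ p.1 y := by
  have hp : IsProbabilityMeasure μ := hμ.1.1
  have h := hμ.ae_zetaRaw_le_ball hd hq hg hgM hμQ hμn (one_pos : (0 : ℝ) < 1)
  rw [← Measure.prod_swap] at h
  have h2 := Measure.ae_ae_of_ae_prod (ae_of_ae_map measurable_swap.aemeasurable h)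
  have : NeZero (volume.restrict (ball (0 : Space d) 1)) := ⟨by
    rw [Ne, Measure.restrict_eq_zero]
    exact (measure_ball_pos _ _ one_pos).ne'⟩
  exact h2.exists

/-! ### Potential theory: finiteness, semicontinuity and a mean value inequality. -/

/-- The Coulomb potential of a measure on positions. -/
def pot {d : ℕ} (ρ : Measure (Space d)) (x : Space d) : ℝ := ∫ x', coulombW d ‖x - x'‖ ∂ρ

/-- The potential with the kernel truncated at distance `s`. -/
def truncPot {d : ℕ} (ρ : Measure (Space d)) (s : ℝ) (x : Space d) : ℝ :=
  ∫ x', coulombW d (max ‖x - x'‖ s) ∂ρ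

lemma tendsto_coulombW_zero {d : ℕ} (hd : 2 ≤ d) : Tendsto (coulombW d) (𝓝[>] 0) atBot := by
  rcases eq_two_or_eq_add_three hd with rfl | ⟨n, rfl⟩
  · have : coulombW 2 = Real.log := funext coulombW_two
    rw [this]
    exact Real.tendsto_log_nhdsGT_zero
  · have h1 : coulombW (n + 3) = fun r => -(r ^ (n + 1))⁻¹ := funext (coulombW_add_three n)
    rw [h1, tendsto_neg_atBot_iff]
    refine Tendsto.inv_tendsto_nhdsGT_zero ?_
    refine tendsto_nhdsWithin_iff.2 ⟨?_, ?_⟩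
    · have : Tendsto (fun r : ℝ => r ^ (n + 1)) (𝓝 0) (𝓝 (0 ^ (n + 1))) :=
        (continuous_pow (n + 1)).tendsto 0
      rw [zero_pow (by omega)] at this
      exact this.mono_left nhdsWithin_le_nhds
    · filter_upwards [self_mem_nhdsWithin] with r hr
      exact pow_pos (mem_Ioi.1 hr) _

lemma abs_coulombW_max_le {d : ℕ} (hd : 2 ≤ d) {r s : ℝ} (hr : 0 ≤ r) (hs : 0 < s) :
    |coulombW d (max r s)| ≤ 1 + (r + s) + (s ^ (d - 1))⁻¹ := by
  refine (abs_coulombW_le hd (hr.trans (le_max_left _ _))).trans ?_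
  have h1 : max r s ≤ r + s := max_le (by linarith) (by linarith)
  have h2 : ((max r s) ^ (d - 1))⁻¹ ≤ (s ^ (d - 1))⁻¹ := by
    have := le_max_right r s
    gcongr
  linarith

lemma integrable_truncPot {d : ℕ} (hd : 2 ≤ d) {ρ : Measure (Space d)} [IsFiniteMeasure ρ] {R : ℝ}
    (hR : ∀ᵐ x ∂ρ, ‖x‖ ≤ R) {s : ℝ} (hs : 0 < s) (x : Space d) :
    Integrable (fun x' => coulombW d (max ‖x - x'‖ s)) ρ := by
  refine Integrable.mono' (integrable_const (1 + (‖x‖ + R + s) + (s ^ (d - 1))⁻¹))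
    (Measurable.aestronglyMeasurable (by fun_prop)) ?_
  filter_upwards [hR] with x' hx'
  rw [Real.norm_eq_abs]
  refine (abs_coulombW_max_le hd (norm_nonneg _) hs).trans ?_
  linarith [norm_sub_le x x']

lemma continuous_truncPot {d : ℕ} (hd : 2 ≤ d) {ρ : Measure (Space d)} [IsFiniteMeasure ρ] {R : ℝ}
    (hR : ∀ᵐ x ∂ρ, ‖x‖ ≤ R) {s : ℝ} (hs : 0 < s) : Continuous (truncPot ρ s) := by
  rw [continuous_iff_continuousAt]
  intro x
  refine continuousAt_of_dominated (bound := fun _ => 1 + (‖x‖ + 1 + R + s) + (s ^ (d - 1))⁻¹)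
    (Eventually.of_forall fun y => Measurable.aestronglyMeasurable (by fun_prop)) ?_
    (integrable_const _) ?_
  · filter_upwards [ball_mem_nhds x one_pos] with y hy
    filter_upwards [hR] with x' hx'
    rw [Real.norm_eq_abs]
    refine (abs_coulombW_max_le hd (norm_nonneg _) hs).trans ?_
    have h1 := norm_sub_le y x'
    have h2 : ‖y - x‖ < 1 := by simpa [dist_eq_norm] using hy
    have h3 := norm_le_norm_add_norm_sub' y x
    linarith
  · refine Eventually.of_forall fun x' => ?_
    have h0 : 0 < max ‖x - x'‖ s := hs.trans_le (le_max_right _ _)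
    exact ContinuousAt.comp (f := fun y : Space d => max ‖y - x'‖ s)
      (hasDerivAt_coulombW hd h0).continuousAt (by fun_prop)

/-- A potential that is bounded from below almost everywhere on its own source is finite
everywhere, and its source has no atoms. -/
theorem integrable_potential_of_bounded {d : ℕ} (hd : 2 ≤ d) {ρ : Measure (Space d)}
    [IsFiniteMeasure ρ] {R M : ℝ} (hR : ∀ᵐ x ∂ρ, ‖x‖ ≤ R)
    (hint : ∀ᵐ x ∂ρ, Integrable (fun x' => coulombW d ‖x - x'‖) ρ)
    (hM : ∀ᵐ x ∂ρ, -M ≤ pot ρ x) (hat : ∀ᵐ x ∂ρ, ρ {x} = 0) (x : Space d) :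
    Integrable (fun x' => coulombW d ‖x - x'‖) ρ ∧ ρ {x} = 0 := by
  rcases eq_or_ne ρ 0 with rfl | hρ
  · simp
  have : NeZero ρ := ⟨hρ⟩
  set G : Set (Space d) := {x | ‖x‖ ≤ R ∧ Integrable (fun x' => coulombW d ‖x - x'‖) ρ ∧
    -M ≤ pot ρ x ∧ ρ {x} = 0} with hG
  have hGae : ∀ᵐ x ∂ρ, x ∈ G := by
    filter_upwards [hR, hint, hM, hat] with x h1 h2 h3 h4 using ⟨h1, h2, h3, h4⟩
  obtain ⟨x0, hx0⟩ := hGae.exists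
  have hR0 : 0 ≤ R := (norm_nonneg x0).trans hx0.1
  -- Truncation raises the kernel, so the lower bound persists; truncated potentials are continuous,
  -- so it passes to the closure.
  have hGs : ∀ s, 0 < s → ∀ x ∈ closure G, -M ≤ truncPot ρ s x := by
    intro s hs
    have hcl : IsClosed {x | -M ≤ truncPot ρ s x} :=
      isClosed_le continuous_const (continuous_truncPot hd hR hs)
    refine closure_minimal ?_ hcl
    rintro y ⟨-, hy2, hy3, hy4⟩
    refine hy3.trans (integral_mono_ae hy2 (integrable_truncPot hd hR hs y) ?_)
    have hne : ∀ᵐ x' ∂ρ, x' ≠ y := by simpa [ae_iff] using hy4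
    filter_upwards [hne] with x' hx'
    exact coulombW_le_coulombW hd (norm_pos_iff.2 (sub_ne_zero.2 hx'.symm)) (le_max_left _ _)
  -- As in the classical maximum principle, x is compared with the closest point z of the closed
  -- source: distances from z to the source are at most twice those from x.
  obtain ⟨z, hz, hzd⟩ := isClosed_closure.exists_infDist_eq_dist (s := closure G)
    ⟨x0, subset_closure hx0⟩ x
  have hdist : ∀ x' ∈ G, ‖z - x'‖ ≤ 2 * ‖x - x'‖ := by
    intro x' hx'
    have h1 : dist x z ≤ dist x x' := by
      rw [← hzd]; exact infDist_le_dist_of_mem (subset_closure hx')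
    have h2 := dist_triangle z x x'
    rw [dist_comm z x] at h2
    rw [← dist_eq_norm, ← dist_eq_norm]
    linarith
  set C0 : ℝ := max ((∫ _x', ((‖x‖ + R + 1) + 2 ^ d * (1 + 4 * (‖x‖ + R + 1))) ∂ρ) + 2 ^ d * M) 0
  have hbound : ∀ s, 0 < s → s ≤ 1 →
      ∫⁻ x', ENNReal.ofReal |coulombW d (max ‖x - x'‖ s)| ∂ρ ≤ ENNReal.ofReal C0 := by
    intro s hs hs1
    rw [← ofReal_integral_eq_lintegral_ofReal (integrable_truncPot hd hR hs x).abs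
      (Eventually.of_forall fun _ => abs_nonneg _)]
    refine ENNReal.ofReal_le_ofReal ?_
    -- The truncation radius doubles together with the distances, so b ≤ 2a below holds for the
    -- truncated distances as well.
    have hi := integrable_truncPot hd hR (by positivity : 0 < 2 * s) z
    have hGz := hGs (2 * s) (by positivity) z hz
    calc ∫ x', |coulombW d (max ‖x - x'‖ s)| ∂ρ
        ≤ ∫ x', (((‖x‖ + R + 1) + 2 ^ d * (1 + 4 * (‖x‖ + R + 1)))
            - 2 ^ d * coulombW d (max ‖z - x'‖ (2 * s))) ∂ρ := by
          refine integral_mono_ae (integrable_truncPot hd hR hs x).abs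
            ((integrable_const _).sub (hi.const_mul _)) ?_
          filter_upwards [hGae] with x' hx'
          set a := max ‖x - x'‖ s with ha
          set b := max ‖z - x'‖ (2 * s) with hb
          have ha0 : 0 < a := hs.trans_le (le_max_right _ _)
          have hb0 : 0 < b := (by positivity : 0 < 2 * s).trans_le (le_max_right _ _)
          have hba : b ≤ 2 * a := by
            refine max_le ((hdist x' hx').trans ?_) ?_
            · linarith [le_max_left ‖x - x'‖ s]
            · linarith [le_max_right ‖x - x'‖ s]
          have haR : a ≤ ‖x‖ + R + 1 := by
            refine max_le ?_ (by linarith [norm_nonneg x])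
            linarith [norm_sub_le x x', hx'.1]
          have e1 : coulombW d (b / 2) ≤ coulombW d a :=
            coulombW_le_coulombW hd (by positivity) (by linarith)
          have e2 := coulombW_le_self hd ha0.le
          have e3 := abs_coulombW_half_le hd hb0
          have e4 := coulombW_le_self hd hb0.le
          have e5 : |coulombW d b| ≤ 2 * b - coulombW d b := by
            rw [abs_le]; constructor <;> linarith
          have e6 : |coulombW d a| ≤ a + |coulombW d (b / 2)| := by
            rw [abs_le]
            constructor
            · linarith [neg_abs_le (coulombW d (b / 2))]
            · linarith [abs_nonneg (coulombW d (b / 2))]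
          have e7 : (2 : ℝ) ^ d * (1 + |coulombW d b|) ≤
              2 ^ d * (1 + 4 * (‖x‖ + R + 1) - coulombW d b) := by
            gcongr
            linarith
          linarith
      _ = _ := by
          rw [integral_sub (integrable_const _) (hi.const_mul _), integral_const_mul]
      _ ≤ C0 := by
          have : (2 : ℝ) ^ d * (-M) ≤ 2 ^ d * truncPot ρ (2 * s) z := by gcongr
          have e : ∫ x', coulombW d (max ‖z - x'‖ (2 * s)) ∂ρ = truncPot ρ (2 * s) z := rfl
          rw [e]
          exact le_trans (by linarith) (le_max_left _ _)
  -- An atom at x would contribute |W(s)| times its mass, unbounded as s → 0, against the bound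
  -- uniform in s.
  have hatom : ρ {x} = 0 := by
    by_contra hne
    have hpos : 0 < ρ {x} := pos_iff_ne_zero.2 hne
    have hlim := (tendsto_coulombW_zero hd).eventually
      (eventually_lt_atBot (-(C0 / (ρ {x}).toReal) - 1))
    obtain ⟨s, hs, hs2⟩ := (hlim.and (Ioo_mem_nhdsGT (zero_lt_one (α := ℝ)))).exists
    have h1 := hbound s hs2.1 hs2.2.le
    have h2 : ∫⁻ x' in {x}, ENNReal.ofReal |coulombW d (max ‖x - x'‖ s)| ∂ρ ≤ ENNReal.ofReal C0 :=
      (setLIntegral_le_lintegral _ _).trans h1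
    rw [lintegral_singleton] at h2
    simp only [sub_self, norm_zero, max_eq_right hs2.1.le] at h2
    have hfin : ρ {x} ≠ ⊤ := measure_ne_top _ _
    have htr : 0 < (ρ {x}).toReal := ENNReal.toReal_pos hne hfin
    rw [← ENNReal.ofReal_toReal hfin, ← ENNReal.ofReal_mul (abs_nonneg _)] at h2
    have hC0n : 0 ≤ C0 := le_max_right _ _
    have h3 := (ENNReal.ofReal_le_ofReal_iff hC0n).1 h2
    have h4 : C0 / (ρ {x}).toReal + 1 < |coulombW d s| := by
      have := neg_le_abs (coulombW d s)
      linarith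
    have h5 := mul_lt_mul_of_pos_right h4 htr
    rw [add_mul, div_mul_cancel₀ _ htr.ne'] at h5
    linarith
  refine ⟨⟨Measurable.aestronglyMeasurable (by fun_prop), ?_⟩, hatom⟩
  have hne : ∀ᵐ x' ∂ρ, x' ≠ x := by simpa [ae_iff] using hatom
  -- Fatou's lemma removes the truncation; without an atom at x the truncated kernel is eventually
  -- the true one.
  have hlim : ∀ᵐ x' ∂ρ, ENNReal.ofReal |coulombW d ‖x - x'‖| = liminf (fun n : ℕ =>
      ENNReal.ofReal |coulombW d (max ‖x - x'‖ (1 / ((n : ℝ) + 1)))|) atTop := by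
    filter_upwards [hne] with x' hx'
    have hpos : 0 < ‖x - x'‖ := norm_pos_iff.2 (sub_ne_zero.2 hx'.symm)
    refine (Tendsto.liminf_eq ?_).symm
    refine tendsto_const_nhds.congr' ?_
    filter_upwards [tendsto_one_div_add_atTop_nhds_zero_nat.eventually (gt_mem_nhds hpos)] with n hn
    rw [max_eq_left hn.le]
  rw [hasFiniteIntegral_iff_norm]
  simp_rw [Real.norm_eq_abs]
  rw [lintegral_congr_ae hlim]
  refine lt_of_le_of_lt (lintegral_liminf_le fun n => by fun_prop) ?_
  refine lt_of_le_of_lt (liminf_le_liminf (v := fun _ => ENNReal.ofReal C0)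
    (Eventually.of_forall fun n => ?_)) ?_
  · refine hbound _ (by positivity) ?_
    rw [div_le_one (by positivity)]
    linarith [(Nat.cast_nonneg n : (0 : ℝ) ≤ n)]
  · simp

/-- The Coulomb potential is upper semicontinuous. -/
lemma eventually_pot_lt {d : ℕ} (hd : 2 ≤ d) {ρ : Measure (Space d)} [IsFiniteMeasure ρ] {R : ℝ}
    (hR : ∀ᵐ x ∂ρ, ‖x‖ ≤ R) (hint : ∀ x, Integrable (fun x' => coulombW d ‖x - x'‖) ρ)
    (hat : ∀ x, ρ {x} = 0) (x : Space d) {b : ℝ} (hb : pot ρ x < b) :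
    ∀ᶠ y in 𝓝 x, pot ρ y < b := by
  have hne : ∀ y, ∀ᵐ x' ∂ρ, 0 < ‖y - x'‖ := by
    intro y
    have : ∀ᵐ x' ∂ρ, x' ≠ y := by simpa [ae_iff] using hat y
    filter_upwards [this] with x' hx' using norm_pos_iff.2 (sub_ne_zero.2 hx'.symm)
  -- The potential lies below its continuous truncations and, at x, is their limit.
  have hle : ∀ s, 0 < s → ∀ y, pot ρ y ≤ truncPot ρ s y := by
    intro s hs y
    refine integral_mono_ae (hint y) (integrable_truncPot hd hR hs y) ?_
    filter_upwards [hne y] with x' hx'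
    exact coulombW_le_coulombW hd hx' (le_max_left _ _)
  have hlim : Tendsto (fun n : ℕ => truncPot ρ (1 / ((n : ℝ) + 1)) x) atTop (𝓝 (pot ρ x)) := by
    refine tendsto_integral_of_dominated_convergence
      (fun x' => |coulombW d ‖x - x'‖| + |coulombW d (max ‖x - x'‖ 1)|)
      (fun n => Measurable.aestronglyMeasurable (by fun_prop))
      ((hint x).abs.add (integrable_truncPot hd hR one_pos x).abs) ?_ ?_
    · intro n
      filter_upwards [hne x] with x' hx'
      have hn : 1 / ((n : ℝ) + 1) ≤ 1 := by
        rw [div_le_one (by positivity)]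
        linarith [(Nat.cast_nonneg n : (0 : ℝ) ≤ n)]
      have h1 := coulombW_le_coulombW hd hx' (le_max_left _ (1 / ((n : ℝ) + 1)))
      have h2 := coulombW_le_coulombW hd (hx'.trans_le (le_max_left _ (1 / ((n : ℝ) + 1))))
        (max_le_max_left ‖x - x'‖ hn)
      rw [Real.norm_eq_abs, abs_le]
      constructor
      · linarith [neg_abs_le (coulombW d ‖x - x'‖), abs_nonneg (coulombW d (max ‖x - x'‖ 1))]
      · linarith [le_abs_self (coulombW d (max ‖x - x'‖ 1)), abs_nonneg (coulombW d ‖x - x'‖)]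
    · filter_upwards [hne x] with x' hx'
      refine tendsto_const_nhds.congr' ?_
      filter_upwards [tendsto_one_div_add_atTop_nhds_zero_nat.eventually (gt_mem_nhds hx')] with n hn
      rw [max_eq_left hn.le]
  obtain ⟨n, hn⟩ := (hlim.eventually (gt_mem_nhds hb)).exists
  have hpos : 0 < 1 / ((n : ℝ) + 1) := by positivity
  filter_upwards [(continuous_truncPot hd hR hpos).continuousAt.eventually (gt_mem_nhds hn)]
    with y hy using (hle _ hpos y).trans_lt hy

/-- `ENNReal.ofReal` keeps the positive part. The mean over a ball of the drop of W below its
central value is bounded uniformly in the radius by a quantity integrable in x'; it serves as the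
dominating function for the mean value inequality. -/
lemma exists_lintegral_coulombW_sub_le {d : ℕ} (hd : 2 ≤ d) :
    ∃ C : ℝ, 0 ≤ C ∧ ∀ (x x' : Space d) (r : ℝ), x ≠ x' → 0 < r →
      ∫⁻ y in ball x r, ENNReal.ofReal (coulombW d ‖x - x'‖ - coulombW d ‖y - x'‖) ≤
        volume (ball x r) * ENNReal.ofReal (C * (1 + |coulombW d ‖x - x'‖|)) := by
  have hnt := nontrivial_space hd
  have hA := sphereArea_pos hd
  set v := (volume (ball (0 : Space d) 1)).toReal with hv
  have hv0 : 0 < v := ENNReal.toReal_pos (measure_ball_pos _ _ one_pos).ne' measure_ball_lt_top.ne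
  refine ⟨2 * (1 + 2 ^ d) + sphereArea d * 2 ^ d / v, by positivity, fun x x' r hne hr => ?_⟩
  set D := ‖x - x'‖ with hD
  have hD0 : 0 < D := norm_pos_iff.2 (sub_ne_zero.2 hne)
  have habs := abs_nonneg (coulombW d D)
  -- If D ≥ 2r, the whole ball stays at distance at least D/2 from x' and the drop is bounded
  -- pointwise. Otherwise the drop is positive only closer than D to x', where its integral is of
  -- order D², and the volume of the ball exceeds a multiple of D^d.
  rcases le_or_gt (2 * r) D with h | h
  · calc ∫⁻ y in ball x r, ENNReal.ofReal (coulombW d D - coulombW d ‖y - x'‖)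
        ≤ ∫⁻ _y in ball x r, ENNReal.ofReal
            ((2 * (1 + 2 ^ d) + sphereArea d * 2 ^ d / v) * (1 + |coulombW d D|)) := by
          refine setLIntegral_mono measurable_const fun y hy => ENNReal.ofReal_le_ofReal ?_
          have hy' : ‖y - x‖ < r := by simpa [dist_eq_norm] using hy
          have hs : D / 2 ≤ ‖y - x'‖ := by
            have := norm_sub_le (y - x') (y - x)
            rw [sub_sub_sub_cancel_left, ← hD] at this
            linarith
          have h1 := coulombW_sub_le hd (by linarith : 0 < ‖y - x'‖) hD0
          have h2 : D * (‖y - x'‖ ^ (d - 1))⁻¹ ≤ 2 * (D / 2 * ((D / 2) ^ (d - 1))⁻¹) := by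
            rw [← mul_assoc, mul_div_cancel₀ D two_ne_zero]
            gcongr
          have h3 := mul_inv_pow_le hd (half_pos hD0)
          have h4 := abs_coulombW_half_le hd hD0
          have h5 : 0 ≤ sphereArea d * 2 ^ d / v * (1 + |coulombW d D|) := by positivity
          have h6 : (2 : ℝ) * (1 + |coulombW d (D / 2)|) ≤ 2 * ((1 + 2 ^ d) * (1 + |coulombW d D|)) := by
            nlinarith
          linarith
      _ = _ := by rw [setLIntegral_const, mul_comm]
  · have hvol : volume (ball x r) = ENNReal.ofReal (r ^ d * v) := by
      rw [Measure.addHaar_ball_of_pos _ _ hr, ENNReal.ofReal_mul (by positivity), hv,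
        ENNReal.ofReal_toReal measure_ball_lt_top.ne]
      simp
    have hae : ∀ᵐ y ∂(volume.restrict (ball x r)), y ≠ x' :=
      ae_restrict_of_ae (by simp [ae_iff])
    calc ∫⁻ y in ball x r, ENNReal.ofReal (coulombW d D - coulombW d ‖y - x'‖)
        ≤ ∫⁻ y in ball x r, (ball x' D).indicator
            (fun y => ENNReal.ofReal D * ENNReal.ofReal (riesz (y - x'))) y := by
          refine lintegral_mono_ae ?_
          filter_upwards [hae] with y hy
          have hpos : 0 < ‖y - x'‖ := norm_pos_iff.2 (sub_ne_zero.2 hy)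
          by_cases hb : y ∈ ball x' D
          · rw [indicator_of_mem hb, ← ENNReal.ofReal_mul hD0.le]
            exact ENNReal.ofReal_le_ofReal (coulombW_sub_le hd hpos hD0)
          · rw [indicator_of_notMem hb]
            have : D ≤ ‖y - x'‖ := by simpa [dist_eq_norm] using hb
            have := coulombW_le_coulombW hd hD0 this
            rw [ENNReal.ofReal_of_nonpos (by linarith)]
      _ ≤ ENNReal.ofReal D * ENNReal.ofReal (sphereArea d * D) := by
          refine (setLIntegral_le_lintegral _ _).trans ?_
          rw [lintegral_indicator measurableSet_ball, lintegral_const_mul _ (by fun_prop),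
            lintegral_riesz_ball hd]
      _ ≤ _ := by
          rw [hvol, ← ENNReal.ofReal_mul hD0.le, ← ENNReal.ofReal_mul (by positivity)]
          refine ENNReal.ofReal_le_ofReal ?_
          have h1 : D * D = D ^ d * (D * (D ^ (d - 1))⁻¹) := by
            have : D ^ d = D * D ^ (d - 1) := by
              rw [← pow_succ']; congr 1; omega
            rw [this]; field_simp
          have h2 : D ^ d ≤ 2 ^ d * r ^ d := by
            rw [← mul_pow]; gcongr
          have h3 := mul_inv_pow_le hd hD0
          have h4 : D * D ≤ 2 ^ d * r ^ d * (1 + |coulombW d D|) := by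
            rw [h1]; gcongr
          calc D * (sphereArea d * D) = sphereArea d * (D * D) := by ring
            _ ≤ sphereArea d * (2 ^ d * r ^ d * (1 + |coulombW d D|)) := by gcongr
            _ = r ^ d * v * (sphereArea d * 2 ^ d / v * (1 + |coulombW d D|)) := by
              field_simp
            _ ≤ _ := by
              gcongr
              linarith [(by positivity : (0 : ℝ) ≤ 2 * (1 + 2 ^ d))]

/-- Potentials satisfy a mean value inequality: a continuous upper bound that holds almost
everywhere holds everywhere. -/
theorem pot_le_of_ae_le {d : ℕ} (hd : 2 ≤ d) {ρ : Measure (Space d)} [IsFiniteMeasure ρ]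
    (hint : ∀ x, Integrable (fun x' => coulombW d ‖x - x'‖) ρ)
    (hat : ∀ x, ρ {x} = 0) {h : Space d → ℝ} (x : Space d) (hh : ContinuousAt h x)
    (hle : ∀ᵐ y, pot ρ y ≤ h y) : pot ρ x ≤ h x := by
  by_contra hlt
  push Not at hlt
  obtain ⟨C, hC, hCb⟩ := exists_lintegral_coulombW_sub_le hd
  set ε := (pot ρ x - h x) / 2 with hε
  have hε0 : 0 < ε := by linarith
  have hball : ∀ r : ℝ, 0 < r → volume (ball x r) ≠ 0 ∧ volume (ball x r) ≠ ⊤ := fun r hr =>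
    ⟨(measure_ball_pos _ _ hr).ne', measure_ball_lt_top.ne⟩
  have hne : ∀ᵐ x' ∂ρ, x' ≠ x := by simpa [ae_iff] using hat x
  set F : ℕ → Space d → ℝ≥0∞ := fun n x' => (volume (ball x (1 / ((n : ℝ) + 1))))⁻¹ *
    ∫⁻ y in ball x (1 / ((n : ℝ) + 1)),
      ENNReal.ofReal (coulombW d ‖x - x'‖ - coulombW d ‖y - x'‖) with hF
  have hmeas2 : Measurable (fun z : Space d × Space d =>
      ENNReal.ofReal (coulombW d ‖x - z.1‖ - coulombW d ‖z.2 - z.1‖)) := by fun_prop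
  have hFm : ∀ n, Measurable (F n) := fun n =>
    (Measurable.lintegral_prod_right' hmeas2).const_mul _
  -- The mean drop over shrinking balls tends to zero: pointwise because W is continuous away from
  -- 0, and after integration in x' by domination.
  have hlim : Tendsto (fun n => ∫⁻ x', F n x' ∂ρ) atTop (𝓝 (∫⁻ _x', 0 ∂ρ)) := by
    refine tendsto_lintegral_of_dominated_convergence
      (fun x' => ENNReal.ofReal (C * (1 + |coulombW d ‖x - x'‖|))) hFm ?_ ?_ ?_
    · intro n
      filter_upwards [hne] with x' hx'
      have hr : 0 < 1 / ((n : ℝ) + 1) := by positivity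
      refine (mul_le_mul_right (hCb x x' _ hx'.symm hr) _).trans ?_
      rw [← mul_assoc, ENNReal.inv_mul_cancel (hball _ hr).1 (hball _ hr).2, one_mul]
    · have hi : Integrable (fun x' => C * (1 + |coulombW d ‖x - x'‖|)) ρ :=
        ((integrable_const 1).add (hint x).abs).const_mul C
      exact hi.lintegral_lt_top.ne
    · filter_upwards [hne] with x' hx'
      rw [ENNReal.tendsto_nhds_zero]
      intro δ hδ
      rcases eq_or_ne δ ⊤ with rfl | hδt
      · exact Eventually.of_forall fun n => le_top
      have hδr : 0 < δ.toReal := ENNReal.toReal_pos hδ.ne' hδt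
      have hpos : 0 < ‖x - x'‖ := norm_pos_iff.2 (sub_ne_zero.2 hx'.symm)
      have hcont : ContinuousAt (fun y : Space d => coulombW d ‖y - x'‖) x :=
        ContinuousAt.comp (f := fun y : Space d => ‖y - x'‖)
          (hasDerivAt_coulombW hd hpos).continuousAt (by fun_prop)
      have hev := hcont.eventually (lt_mem_nhds (sub_lt_self (coulombW d ‖x - x'‖) hδr))
      obtain ⟨r, hr, hrb⟩ := Metric.eventually_nhds_iff_ball.1 hev
      filter_upwards [tendsto_one_div_add_atTop_nhds_zero_nat.eventually (gt_mem_nhds hr)] with n hn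
      have hr' : 0 < 1 / ((n : ℝ) + 1) := by positivity
      calc F n x' ≤ (volume (ball x (1 / ((n : ℝ) + 1))))⁻¹ *
            ∫⁻ _y in ball x (1 / ((n : ℝ) + 1)), δ := by
            refine mul_le_mul_right (setLIntegral_mono measurable_const fun y hy => ?_) _
            have := hrb y (ball_subset_ball hn.le hy)
            rw [← ENNReal.ofReal_toReal hδt]
            exact ENNReal.ofReal_le_ofReal (by linarith)
        _ = δ := by
            rw [setLIntegral_const, mul_comm δ, ← mul_assoc,
              ENNReal.inv_mul_cancel (hball _ hr').1 (hball _ hr').2, one_mul]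
  -- If the bound failed at x, then almost everywhere on a small ball the potential would lie at
  -- least ε below its value at x, with ε half the gap and continuity of h at x using the other
  -- half. After exchanging integrals the mean drop would be at least ε.
  have hlow : ∀ᶠ n : ℕ in atTop, ENNReal.ofReal ε ≤ ∫⁻ x', F n x' ∂ρ := by
    obtain ⟨r, hr, hrb⟩ := Metric.eventually_nhds_iff_ball.1
      (hh.eventually (gt_mem_nhds (by linarith : h x < h x + ε)))
    filter_upwards [tendsto_one_div_add_atTop_nhds_zero_nat.eventually (gt_mem_nhds hr)] with n hn
    have hr' : 0 < 1 / ((n : ℝ) + 1) := by positivity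
    have hsub : ball x (1 / ((n : ℝ) + 1)) ⊆ ball x r := ball_subset_ball hn.le
    have hswap : ∫⁻ x', F n x' ∂ρ = (volume (ball x (1 / ((n : ℝ) + 1))))⁻¹ *
        ∫⁻ y in ball x (1 / ((n : ℝ) + 1)), ∫⁻ x',
          ENNReal.ofReal (coulombW d ‖x - x'‖ - coulombW d ‖y - x'‖) ∂ρ := by
      rw [lintegral_const_mul _ (Measurable.lintegral_prod_right' hmeas2),
        lintegral_lintegral_swap hmeas2.aemeasurable]
    rw [hswap]
    calc ENNReal.ofReal ε = (volume (ball x (1 / ((n : ℝ) + 1))))⁻¹ *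
          ∫⁻ _y in ball x (1 / ((n : ℝ) + 1)), ENNReal.ofReal ε := by
          rw [setLIntegral_const, mul_comm (ENNReal.ofReal ε), ← mul_assoc,
            ENNReal.inv_mul_cancel (hball _ hr').1 (hball _ hr').2, one_mul]
      _ ≤ _ := by
          refine mul_le_mul_right (lintegral_mono_ae ?_) _
          filter_upwards [ae_restrict_of_ae hle, ae_restrict_mem measurableSet_ball] with y hy hyb
          have h1 := hrb y (hsub hyb)
          have h2 : ε ≤ ∫ x', (coulombW d ‖x - x'‖ - coulombW d ‖y - x'‖) ∂ρ := by
            rw [integral_sub (hint x) (hint y)]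
            change ε ≤ pot ρ x - pot ρ y
            linarith
          refine (ENNReal.ofReal_le_ofReal h2).trans ?_
          have hi : Integrable (fun x' => coulombW d ‖x - x'‖ - coulombW d ‖y - x'‖) ρ :=
            (hint x).sub (hint y)
          calc ENNReal.ofReal (∫ x', (coulombW d ‖x - x'‖ - coulombW d ‖y - x'‖) ∂ρ)
              ≤ ENNReal.ofReal (∫ x', max (coulombW d ‖x - x'‖ - coulombW d ‖y - x'‖) 0 ∂ρ) :=
                ENNReal.ofReal_le_ofReal (integral_mono hi hi.pos_part fun _ => le_max_left _ _)
            _ = _ := by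
                rw [ofReal_integral_eq_lintegral_ofReal hi.pos_part
                  (Eventually.of_forall fun _ => le_max_right _ _)]
                refine lintegral_congr fun x' => ?_
                rcases le_total (coulombW d ‖x - x'‖ - coulombW d ‖y - x'‖) 0 with h0 | h0
                · rw [max_eq_right h0, ENNReal.ofReal_of_nonpos h0, ENNReal.ofReal_zero]
                · rw [max_eq_left h0]
  rw [lintegral_zero] at hlim
  have h1 := hlim.eventually (gt_mem_nhds (ENNReal.ofReal_pos.2 hε0))
  obtain ⟨n, hn1, hn2⟩ := (h1.and hlow).exists
  exact absurd hn1 (not_lt.2 hn2)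

/-! ### From charged particles to a charge distribution in space. -/

/-- The charge distribution in space of a measure on charges and positions. -/
def chargeMeasure {d : ℕ} (μ : Measure (ℝ × Space d)) : Measure (Space d) :=
  (μ.withDensity fun p => ENNReal.ofReal p.1).map Prod.snd

section chargeMeasure

variable {d : ℕ} {μ : Measure (ℝ × Space d)} {E : Type*} [NormedAddCommGroup E] [NormedSpace ℝ E]

lemma integrable_chargeMeasure_iff (hpos : ∀ᵐ p ∂μ, 0 < p.1) {f : Space d → E}
    (hf : StronglyMeasurable f) :
    Integrable f (chargeMeasure μ) ↔ Integrable (fun p => p.1 • f p.2) μ := by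
  rw [chargeMeasure, integrable_map_measure hf.aestronglyMeasurable measurable_snd.aemeasurable,
    integrable_withDensity_iff_integrable_smul' (by fun_prop) (by simp)]
  refine integrable_congr ?_
  filter_upwards [hpos] with p hp
  simp [ENNReal.toReal_ofReal hp.le]

lemma integral_chargeMeasure (hpos : ∀ᵐ p ∂μ, 0 < p.1) {f : Space d → E}
    (hf : StronglyMeasurable f) :
    ∫ x, f x ∂(chargeMeasure μ) = ∫ p, p.1 • f p.2 ∂μ := by
  rw [chargeMeasure, integral_map measurable_snd.aemeasurable hf.aestronglyMeasurable,
    integral_withDensity_eq_integral_toReal_smul (by fun_prop) (by simp)]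
  refine integral_congr_ae ?_
  filter_upwards [hpos] with p hp
  simp [ENNReal.toReal_ofReal hp.le]

lemma ae_chargeMeasure_of_ae {P : Space d → Prop} (hP : MeasurableSet {x | P x})
    (h : ∀ᵐ p ∂μ, P p.2) : ∀ᵐ x ∂(chargeMeasure μ), P x := by
  rw [chargeMeasure, ae_map_iff measurable_snd.aemeasurable hP]
  exact (withDensity_absolutelyContinuous μ _).ae_le h

lemma isFiniteMeasure_chargeMeasure [IsFiniteMeasure μ] {qmin qmax : ℝ}
    (hμQ : ∀ᵐ p ∂μ, p.1 ∈ Icc qmin qmax) : IsFiniteMeasure (chargeMeasure μ) := by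
  have : IsFiniteMeasure (μ.withDensity fun p => ENNReal.ofReal p.1) := by
    refine isFiniteMeasure_withDensity (ne_of_lt ?_)
    calc ∫⁻ p, ENNReal.ofReal p.1 ∂μ ≤ ∫⁻ _p, ENNReal.ofReal qmax ∂μ := by
          refine lintegral_mono_ae ?_
          filter_upwards [hμQ] with p hp using ENNReal.ofReal_le_ofReal hp.2
      _ < ⊤ := by
          rw [lintegral_const]
          exact ENNReal.mul_lt_top ENNReal.ofReal_lt_top (measure_lt_top _ _)
  unfold chargeMeasure
  infer_instance

lemma chargeMeasure_prod [SFinite μ] :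
    (chargeMeasure μ).prod (chargeMeasure μ) =
      ((μ.prod μ).withDensity fun z => ENNReal.ofReal z.1.1 * ENNReal.ofReal z.2.1).map
        (Prod.map Prod.snd Prod.snd) := by
  rw [chargeMeasure, Measure.map_prod_map _ _ measurable_snd measurable_snd,
    prod_withDensity (by fun_prop) (by fun_prop)]

lemma ae_pos_prod [SFinite μ] (hpos : ∀ᵐ p ∂μ, 0 < p.1) :
    ∀ᵐ z ∂(μ.prod μ), 0 < z.1.1 ∧ 0 < z.2.1 := by
  filter_upwards [Measure.quasiMeasurePreserving_fst.ae hpos,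
    Measure.quasiMeasurePreserving_snd.ae hpos] with z h1 h2 using ⟨h1, h2⟩

lemma integrable_chargeMeasure_prod_iff [SFinite μ] (hpos : ∀ᵐ p ∂μ, 0 < p.1)
    {F : Space d × Space d → ℝ} (hF : Measurable F) :
    Integrable F ((chargeMeasure μ).prod (chargeMeasure μ)) ↔
      Integrable (fun z : (ℝ × Space d) × (ℝ × Space d) => z.1.1 * z.2.1 * F (z.1.2, z.2.2))
        (μ.prod μ) := by
  rw [chargeMeasure_prod, integrable_map_measure hF.aestronglyMeasurable (by fun_prop),
    integrable_withDensity_iff_integrable_smul' (by fun_prop)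
      (by simp [ENNReal.mul_lt_top])]
  refine integrable_congr ?_
  filter_upwards [ae_pos_prod hpos] with z hz
  simp [ENNReal.toReal_ofReal hz.1.le, ENNReal.toReal_ofReal hz.2.le, Prod.map]

lemma integral_chargeMeasure_prod [SFinite μ] (hpos : ∀ᵐ p ∂μ, 0 < p.1)
    {F : Space d × Space d → ℝ} (hF : Measurable F) :
    ∫ z, F z ∂((chargeMeasure μ).prod (chargeMeasure μ)) =
      ∫ z, z.1.1 * z.2.1 * F (z.1.2, z.2.2) ∂(μ.prod μ) := by
  rw [chargeMeasure_prod, integral_map (by fun_prop) hF.aestronglyMeasurable,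
    integral_withDensity_eq_integral_toReal_smul (by fun_prop) (by simp [ENNReal.mul_lt_top])]
  refine integral_congr_ae ?_
  filter_upwards [ae_pos_prod hpos] with z hz
  simp [ENNReal.toReal_ofReal hz.1.le, ENNReal.toReal_ofReal hz.2.le, Prod.map]

lemma pot_chargeMeasure (hpos : ∀ᵐ p ∂μ, 0 < p.1) (x : Space d) :
    pot (chargeMeasure μ) x = chargePotential μ x := by
  rw [pot, integral_chargeMeasure hpos (Measurable.stronglyMeasurable (by fun_prop))]
  rfl

end chargeMeasure

/-! ### Regularity of the charge distribution of a minimizer. -/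

/-- A charge distribution of bounded support and finite energy whose potential is finite
everywhere. -/
structure IsTame {d : ℕ} (ρ : Measure (Space d)) (R : ℝ) : Prop where
  bounded : ∀ᵐ x ∂ρ, ‖x‖ ≤ R
  integrable : ∀ x, Integrable (fun x' => coulombW d ‖x - x'‖) ρ
  singleton : ∀ x, ρ {x} = 0
  energy : Integrable (fun z : Space d × Space d => coulombW d ‖z.1 - z.2‖) (ρ.prod ρ)

lemma pot_le_affine {d : ℕ} (hd : 2 ≤ d) {ρ : Measure (Space d)} [IsFiniteMeasure ρ]
    (hn : Integrable (fun x => ‖x‖) ρ) :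
    ∃ a b : ℝ, 0 ≤ a ∧ 0 ≤ b ∧ ∀ x, pot ρ x ≤ a + b * ‖x‖ := by
  have ha : 0 ≤ ∫ x', ‖x'‖ ∂ρ := integral_nonneg fun _ => norm_nonneg _
  refine ⟨∫ x', ‖x'‖ ∂ρ, ρ.real univ, ha, measureReal_nonneg, fun x => ?_⟩
  by_cases hi : Integrable (fun x' => coulombW d ‖x - x'‖) ρ
  · calc pot ρ x ≤ ∫ x', (‖x'‖ + ‖x‖) ∂ρ := by
          refine integral_mono hi (hn.add (integrable_const _)) fun x' => ?_
          refine (coulombW_le_self hd (norm_nonneg _)).trans ?_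
          rw [add_comm]; exact norm_sub_le _ _
      _ = _ := by rw [integral_add hn (integrable_const _), integral_const, smul_eq_mul]
  -- Where the kernel is not integrable the potential has the default value 0, which obeys the bound
  -- too. Finiteness of the potential is not yet available when this lemma is first used.
  · rw [pot, integral_undef hi]
    positivity

lemma exists_bounds {qmin qmax : ℝ} {g : ℝ → ℝ} (hqq : qmin ≤ qmax)
    (hgpos : ∀ t ∈ Icc qmin qmax, 0 < g t)
    (hg : ContinuousOn g (Icc qmin qmax) ∨ MonotoneOn g (Icc qmin qmax) ∨
      AntitoneOn g (Icc qmin qmax)) :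
    ∃ m M : ℝ, 0 < m ∧ ∀ t ∈ Icc qmin qmax, m ≤ g t ∧ g t ≤ M := by
  have hl : qmin ∈ Icc qmin qmax := left_mem_Icc.2 hqq
  have hr : qmax ∈ Icc qmin qmax := right_mem_Icc.2 hqq
  rcases hg with hg | hg | hg
  · obtain ⟨a, ha, hamin⟩ := isCompact_Icc.exists_isMinOn ⟨_, hl⟩ hg
    obtain ⟨b, hb, hbmax⟩ := isCompact_Icc.exists_isMaxOn ⟨_, hl⟩ hg
    exact ⟨g a, g b, hgpos a ha, fun t ht => ⟨hamin ht, hbmax ht⟩⟩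
  · exact ⟨g qmin, g qmax, hgpos _ hl, fun t ht => ⟨hg hl ht ht.1, hg ht hr ht.2⟩⟩
  · exact ⟨g qmax, g qmin, hgpos _ hr, fun t ht => ⟨hg ht hr ht.2, hg hl ht ht.1⟩⟩

lemma aemeasurable_of_continuousOn_or_monotoneOn {ν : Measure ℝ} {s : Set ℝ}
    (hs : MeasurableSet s) (hν : ν sᶜ = 0) {g : ℝ → ℝ}
    (hg : ContinuousOn g s ∨ MonotoneOn g s ∨ AntitoneOn g s) : AEMeasurable g ν := by
  have : ν.restrict s = ν := Measure.restrict_eq_self_of_ae_mem (by rwa [ae_iff])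
  rw [← this]
  rcases hg with hg | hg | hg
  · exact hg.aemeasurable hs
  · exact aemeasurable_restrict_of_monotoneOn hs hg
  · exact aemeasurable_restrict_of_antitoneOn hs hg

section minimizer

variable {d : ℕ} {qmin qmax : ℝ} {ν : Measure ℝ} {g : ℝ → ℝ} {m M : ℝ}
  {μ : Measure (ℝ × Space d)}

lemma IsEnergyMinimizer.ae_mem (hμ : IsEnergyMinimizer g ν μ) (hν : ν (Icc qmin qmax)ᶜ = 0) :
    ∀ᵐ p ∂μ, p.1 ∈ Icc qmin qmax := by
  have : ∀ᵐ t ∂(μ.map Prod.fst), t ∈ Icc qmin qmax := by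
    rw [hμ.1.2, ae_iff]; exact hν
  exact ae_of_ae_map measurable_fst.aemeasurable this

/-- The confinement energy controls the second moment because q g(q) is at least `qmin * m`. -/
lemma HasFiniteEnergy.integrable_norm [IsProbabilityMeasure μ] (hE : HasFiniteEnergy g μ)
    (hq : 0 < qmin) (hμQ : ∀ᵐ p ∂μ, p.1 ∈ Icc qmin qmax) (hm : 0 < m)
    (hgm : ∀ t ∈ Icc qmin qmax, m ≤ g t ∧ g t ≤ M) : Integrable (fun p => ‖p.2‖) μ := by
  refine ((integrable_const 1).add (hE.1.const_mul (qmin * m)⁻¹)).mono' (by fun_prop) ?_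
  filter_upwards [hμQ] with p hp
  simp only [Pi.add_apply, norm_norm, confV]
  have h1 : qmin * m ≤ p.1 * g p.1 := mul_le_mul hp.1 (hgm _ hp).1 hm.le (hq.le.trans hp.1)
  have h2 : ‖p.2‖ ^ 2 ≤ (qmin * m)⁻¹ * (p.1 * g p.1 * ‖p.2‖ ^ 2) := by
    rw [← div_eq_inv_mul, le_div_iff₀ (by positivity), mul_comm]
    gcongr
  nlinarith [sq_nonneg (‖p.2‖ - 1)]

/-- Comparing a particle with the fixed target y and dividing by its charge gives (m/2)|x|² ≤ B +
P(x) almost everywhere, with B independent of the charge. Read from right to left this is a lower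
bound for P on its own source, hence finiteness everywhere and absence of atoms; with P at most
affine in |x| it bounds the support. -/
theorem IsEnergyMinimizer.exists_isTame (hd : 2 ≤ d) (hq : 0 < qmin)
    (hν : ν (Icc qmin qmax)ᶜ = 0) (hg : AEMeasurable g ν) (hm : 0 < m)
    (hgm : ∀ t ∈ Icc qmin qmax, m ≤ g t ∧ g t ≤ M) (hμ : IsEnergyMinimizer g ν μ) :
    ∃ R : ℝ, 0 < R ∧ IsTame (chargeMeasure μ) R := by
  have hp : IsProbabilityMeasure μ := hμ.1.1
  have hμQ := hμ.ae_mem hν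
  have hpos : ∀ᵐ p ∂μ, 0 < p.1 := hμQ.mono fun p hp => hq.trans_le hp.1
  have hfin := isFiniteMeasure_chargeMeasure hμQ
  have hμn := hμ.2.1.integrable_norm hq hμQ hm hgm
  have hgM : ∀ t ∈ Icc qmin qmax, |g t| ≤ M := fun t ht => by
    rw [abs_of_pos (hm.trans_le (hgm t ht).1)]; exact (hgm t ht).2
  obtain ⟨y, hy⟩ := hμ.exists_zetaRaw_le hd hq hg hgM hμQ hμn
  set ρ := chargeMeasure μ with hρ
  have hρn : Integrable (fun x => ‖x‖) ρ := by
    rw [integrable_chargeMeasure_iff hpos (by fun_prop)]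
    refine (hμn.const_mul qmax).mono' (Measurable.aestronglyMeasurable (by fun_prop)) ?_
    filter_upwards [hμQ] with p hp
    rw [norm_smul, norm_norm, Real.norm_eq_abs, abs_of_pos (hq.trans_le hp.1)]
    exact mul_le_mul_of_nonneg_right hp.2 (norm_nonneg _)
  obtain ⟨a, b, ha, hb, hab⟩ := pot_le_affine hd hρn
  set B := M / 2 * ‖y‖ ^ 2 + |pot ρ y| with hB
  have hkey : ∀ᵐ p ∂μ, m / 2 * ‖p.2‖ ^ 2 ≤ B + pot ρ p.2 := by
    filter_upwards [hy, hμQ] with p hp hpQ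
    simp only [zetaRaw, confV, ← pot_chargeMeasure hpos] at hp
    rw [← hρ] at hp
    have hp0 : 0 < p.1 := hq.trans_le hpQ.1
    have h1 : g p.1 / 2 * ‖p.2‖ ^ 2 - pot ρ p.2 ≤ g p.1 / 2 * ‖y‖ ^ 2 - pot ρ y := by
      refine le_of_mul_le_mul_left ?_ hp0
      linarith
    have h2 : m / 2 * ‖p.2‖ ^ 2 ≤ g p.1 / 2 * ‖p.2‖ ^ 2 := by
      have := (hgm _ hpQ).1
      gcongr
    have h3 : g p.1 / 2 * ‖y‖ ^ 2 ≤ M / 2 * ‖y‖ ^ 2 := by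
      have := (hgm _ hpQ).2
      gcongr
    have h4 := neg_abs_le (pot ρ y)
    linarith
  have hpotm : Measurable (pot ρ) :=
    (StronglyMeasurable.integral_prod_right' (f := fun z : Space d × Space d =>
      coulombW d ‖z.1 - z.2‖) (Measurable.stronglyMeasurable (by fun_prop))).measurable
  have hlow : ∀ᵐ x ∂ρ, -B ≤ pot ρ x := by
    refine ae_chargeMeasure_of_ae (measurableSet_le measurable_const hpotm) ?_
    filter_upwards [hkey] with p hp
    have : 0 ≤ m / 2 * ‖p.2‖ ^ 2 := by positivity
    linarith
  -- For |x| > 1 the inequality (m/2)|x|² ≤ B + a + b|x| can be divided by |x|; the summand 1 covers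
  -- the remaining points.
  set R := 1 + (|B| + a + b) / (m / 2) with hR
  have hR0 : 0 < R := by positivity
  have hbd : ∀ᵐ x ∂ρ, ‖x‖ ≤ R := by
    refine ae_chargeMeasure_of_ae (measurableSet_le (by fun_prop) (by fun_prop)) ?_
    filter_upwards [hkey] with p hp
    rcases le_or_gt ‖p.2‖ 1 with h1 | h1
    · have : 0 ≤ (|B| + a + b) / (m / 2) := by positivity
      linarith
    · have h2 := hab p.2
      have h3 : m / 2 * ‖p.2‖ * ‖p.2‖ ≤ (|B| + a + b) * ‖p.2‖ := by
        have := le_abs_self B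
        nlinarith [abs_nonneg B]
      have h4 := le_of_mul_le_mul_right h3 (by linarith)
      rw [mul_comm, ← le_div_iff₀ (by positivity)] at h4
      linarith
  have hen : Integrable (fun z : Space d × Space d => coulombW d ‖z.1 - z.2‖) (ρ.prod ρ) := by
    rw [integrable_chargeMeasure_prod_iff hpos (by fun_prop)]
    exact hμ.2.1.2.2
  have hne : ∀ᵐ z ∂(ρ.prod ρ), z.1 ≠ z.2 := by
    rw [hρ, chargeMeasure_prod, ae_map_iff (p := fun z : Space d × Space d => z.1 ≠ z.2)
      (by fun_prop) (measurableSet_eq_fun measurable_fst measurable_snd).compl]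
    exact (withDensity_absolutelyContinuous _ _).ae_le hμ.2.1.2.1
  have hat : ∀ᵐ x ∂ρ, ρ {x} = 0 := by
    filter_upwards [Measure.ae_ae_of_ae_prod hne] with x hx
    simpa [ae_iff] using hx
  have hall := integrable_potential_of_bounded hd hbd hen.prod_right_ae hlow hat
  exact ⟨R, hR0, hbd, fun x => (hall x).1, fun x => (hall x).2, hen⟩

end minimizer

/-! ### The Euler–Lagrange equation, almost everywhere and on the support. -/

section minimizer

variable {d : ℕ} {qmin qmax : ℝ} {ν : Measure ℝ} {g : ℝ → ℝ} {m M : ℝ}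
  {μ : Measure (ℝ × Space d)}

lemma IsTame.integrable_norm {ρ : Measure (Space d)} [IsFiniteMeasure ρ] {R : ℝ}
    (hρ : IsTame ρ R) : Integrable (fun x => ‖x‖) ρ :=
  (integrable_const R).mono' (by fun_prop) (by simpa using hρ.bounded)

/-- After factoring out the charge t > 0, the position problem depends on t only through g(t). -/
lemma zetaRaw_eq (hpos : ∀ᵐ p ∂μ, 0 < p.1) (t : ℝ) (y : Space d) :
    zetaRaw g μ t y = t * (g t / 2 * ‖y‖ ^ 2 - pot (chargeMeasure μ) y) := by
  rw [zetaRaw, confV, pot_chargeMeasure hpos]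
  ring

/-- The reduced potential `s |y|² / 2 - P(y)` is bounded from below for `s ≥ m > 0`. -/
lemma exists_le_confined_pot (hd : 2 ≤ d) {ρ : Measure (Space d)} [IsFiniteMeasure ρ]
    (hn : Integrable (fun x => ‖x‖) ρ) (hm : 0 < m) :
    ∃ B : ℝ, ∀ s, m ≤ s → ∀ y : Space d, B ≤ s / 2 * ‖y‖ ^ 2 - pot ρ y := by
  obtain ⟨a, b, ha, hb, hab⟩ := pot_le_affine hd hn
  refine ⟨-(a + b ^ 2 / (2 * m)), fun s hs y => ?_⟩
  have h1 := hab y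
  have h2 : m / 2 * ‖y‖ ^ 2 ≤ s / 2 * ‖y‖ ^ 2 := by gcongr
  have h3 : b * ‖y‖ ≤ m / 2 * ‖y‖ ^ 2 + b ^ 2 / (2 * m) := by
    have : m / 2 * ‖y‖ ^ 2 + b ^ 2 / (2 * m) - b * ‖y‖ = (m * ‖y‖ - b) ^ 2 / (2 * m) := by
      field_simp; ring
    have h4 : 0 ≤ (m * ‖y‖ - b) ^ 2 / (2 * m) := by positivity
    linarith
  linarith

lemma bddBelow_zetaRaw (hd : 2 ≤ d) (hpos : ∀ᵐ p ∂μ, 0 < p.1)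
    [IsFiniteMeasure (chargeMeasure μ)] (hn : Integrable (fun x => ‖x‖) (chargeMeasure μ))
    {t : ℝ} (ht : 0 < t) (hgt : 0 < g t) : BddBelow (range (zetaRaw g μ t)) := by
  obtain ⟨B, hB⟩ := exists_le_confined_pot hd hn hgt
  refine ⟨t * B, ?_⟩
  rintro _ ⟨y, rfl⟩
  rw [zetaRaw_eq hpos]
  exact mul_le_mul_of_nonneg_left (hB _ le_rfl y) ht.le

lemma zeta_nonneg_of_bddBelow {t : ℝ} (h : BddBelow (range (zetaRaw g μ t))) (y : Space d) :
    0 ≤ zeta g μ t y :=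
  sub_nonneg.2 (ciInf_le h y)

/-- The Euler–Lagrange equation for a minimizer. -/
theorem IsEnergyMinimizer.ae_zeta_eq_zero (hd : 2 ≤ d) (hq : 0 < qmin)
    (hν : ν (Icc qmin qmax)ᶜ = 0) (hg : AEMeasurable g ν) (hm : 0 < m)
    (hgm : ∀ t ∈ Icc qmin qmax, m ≤ g t ∧ g t ≤ M) (hμ : IsEnergyMinimizer g ν μ) :
    ∀ᵐ p ∂μ, zeta g μ p.1 p.2 = 0 := by
  have hp : IsProbabilityMeasure μ := hμ.1.1
  have hμQ := hμ.ae_mem hν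
  have hpos : ∀ᵐ p ∂μ, 0 < p.1 := hμQ.mono fun p hp => hq.trans_le hp.1
  have hfin := isFiniteMeasure_chargeMeasure hμQ
  obtain ⟨R, hR, hT⟩ := hμ.exists_isTame hd hq hν hg hm hgm
  have hμn := hμ.2.1.integrable_norm hq hμQ hm hgm
  have hgM : ∀ t ∈ Icc qmin qmax, |g t| ≤ M := fun t ht => by
    rw [abs_of_pos (hm.trans_le (hgm t ht).1)]; exact (hgm t ht).2
  filter_upwards [hμ.ae_ae_zetaRaw_le hd hq hg hgM hμQ hμn, hμQ] with p hp hpQ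
  have hp0 : 0 < p.1 := hq.trans_le hpQ.1
  refine le_antisymm ?_ (zeta_nonneg_of_bddBelow (bddBelow_zetaRaw hd hpos hT.integrable_norm hp0
    (hm.trans_le (hgm _ hpQ).1)) _)
  rw [zeta, sub_nonpos]
  refine le_ciInf fun y => ?_
  -- For a fixed particle the inequality against almost every y is a continuous upper bound for P;
  -- the mean value inequality makes it hold at every y, as the infimum requires.
  have hle := pot_le_of_ae_le hd hT.integrable hT.singleton
    (h := fun y => g p.1 / 2 * ‖y‖ ^ 2 - zetaRaw g μ p.1 p.2 / p.1) y (by fun_prop) (by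
      filter_upwards [hp] with z hz
      rw [zetaRaw_eq hpos p.1 z, ← div_le_iff₀' hp0] at hz
      linarith)
  rw [zetaRaw_eq hpos p.1 y, ← div_le_iff₀' hp0]
  linarith

/-- P is upper semicontinuous, so `zetaRaw` is lower semicontinuous along charges in Q when g is
continuous. If some y beat p strictly, it would beat all nearby particles with charge in Q, among
which there are some with ζ = 0. -/
theorem IsEnergyMinimizer.zeta_eq_zero_of_mem_support (hd : 2 ≤ d) (hq : 0 < qmin)
    (hν : ν (Icc qmin qmax)ᶜ = 0) (hg : AEMeasurable g ν) (hm : 0 < m)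
    (hgm : ∀ t ∈ Icc qmin qmax, m ≤ g t ∧ g t ≤ M) (hμ : IsEnergyMinimizer g ν μ)
    (hgc : ContinuousOn g (Icc qmin qmax)) {p : ℝ × Space d} (hp : p ∈ μ.support) :
    zeta g μ p.1 p.2 = 0 := by
  have hpr : IsProbabilityMeasure μ := hμ.1.1
  have hμQ := hμ.ae_mem hν
  have hpos : ∀ᵐ p ∂μ, 0 < p.1 := hμQ.mono fun p hp => hq.trans_le hp.1
  have hfin := isFiniteMeasure_chargeMeasure hμQ
  obtain ⟨R, hR, hT⟩ := hμ.exists_isTame hd hq hν hg hm hgm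
  have hz := hμ.ae_zeta_eq_zero hd hq hν hg hm hgm
  have hfr : ∀ U ∈ 𝓝 p, ∃ p' ∈ U, p'.1 ∈ Icc qmin qmax ∧ zeta g μ p'.1 p'.2 = 0 := by
    intro U hU
    by_contra! hcon
    have hnull : μ U = 0 := by
      refine measure_mono_null ?_ (show μ {p' | ¬ (p'.1 ∈ Icc qmin qmax ∧ zeta g μ p'.1 p'.2 = 0)} = 0
        from ae_iff.1 (hμQ.and hz))
      intro p' hp' h
      exact hcon p' hp' h.1 h.2
    exact ((Measure.mem_support_iff_forall p).1 hp U hU).ne' hnull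
  have hpQ : p.1 ∈ Icc qmin qmax := by
    have : p.1 ∈ closure (Icc qmin qmax) := by
      rw [mem_closure_iff_nhds]
      intro V hV
      obtain ⟨p', hp'V, hp'Q, -⟩ := hfr (Prod.fst ⁻¹' V) (continuous_fst.continuousAt hV)
      exact ⟨p'.1, hp'V, hp'Q⟩
    rwa [isClosed_Icc.closure_eq] at this
  have hp0 : 0 < p.1 := hq.trans_le hpQ.1
  have hgp : 0 < g p.1 := hm.trans_le (hgm _ hpQ).1
  refine le_antisymm ?_ (zeta_nonneg_of_bddBelow
    (bddBelow_zetaRaw hd hpos hT.integrable_norm hp0 hgp) _)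
  rw [zeta, sub_nonpos]
  refine le_ciInf fun y => ?_
  set ρ := chargeMeasure μ with hρ
  by_contra hlt
  push Not at hlt
  rw [zetaRaw_eq hpos, zetaRaw_eq hpos] at hlt
  have hlt' := lt_of_mul_lt_mul_left hlt hp0.le
  -- A third of the gap: one third is lost to semicontinuity of P, one to continuity of g and the
  -- norm, and one remains for the contradiction.
  set δ := ((g p.1 / 2 * ‖p.2‖ ^ 2 - pot ρ p.2) - (g p.1 / 2 * ‖y‖ ^ 2 - pot ρ y)) / 3 with hδ
  have hδ0 : 0 < δ := by linarith
  have e1 : ∀ᶠ x in 𝓝 p.2, pot ρ x < pot ρ p.2 + δ :=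
    eventually_pot_lt hd hT.bounded hT.integrable hT.singleton _ (by linarith)
  have hgcont : Tendsto (fun p' : ℝ × Space d => g p'.1) (𝓝[Prod.fst ⁻¹' (Icc qmin qmax)] p)
      (𝓝 (g p.1)) := by
    refine (hgc p.1 hpQ).tendsto.comp ?_
    exact tendsto_nhdsWithin_iff.2 ⟨continuous_fst.continuousAt.mono_left nhdsWithin_le_nhds,
      eventually_mem_nhdsWithin⟩
  have hcont : Tendsto (fun p' : ℝ × Space d => g p'.1 / 2 * ‖p'.2‖ ^ 2 - g p'.1 / 2 * ‖y‖ ^ 2)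
      (𝓝[Prod.fst ⁻¹' (Icc qmin qmax)] p)
      (𝓝 (g p.1 / 2 * ‖p.2‖ ^ 2 - g p.1 / 2 * ‖y‖ ^ 2)) := by
    have hn : Tendsto (fun p' : ℝ × Space d => ‖p'.2‖ ^ 2) (𝓝[Prod.fst ⁻¹' (Icc qmin qmax)] p)
        (𝓝 (‖p.2‖ ^ 2)) :=
      (Continuous.continuousAt (by fun_prop)).mono_left nhdsWithin_le_nhds
    exact ((hgcont.div_const 2).mul hn).sub ((hgcont.div_const 2).mul_const _)
  have e2 := hcont.eventually (lt_mem_nhds (sub_lt_self _ hδ0))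
  have e3 : ∀ᶠ p' in 𝓝 p, pot ρ p'.2 < pot ρ p.2 + δ := continuous_snd.continuousAt.eventually e1
  rw [eventually_nhdsWithin_iff] at e2
  obtain ⟨p', ⟨h3, h2⟩, hp'Q, hp'z⟩ := hfr _ (e3.and e2)
  have h2' := h2 hp'Q
  have hp'0 : 0 < p'.1 := hq.trans_le hp'Q.1
  have h5 : zetaRaw g μ p'.1 p'.2 ≤ zetaRaw g μ p'.1 y := by
    rw [zeta, sub_eq_zero] at hp'z
    rw [hp'z]
    exact ciInf_le (bddBelow_zetaRaw hd hpos hT.integrable_norm hp'0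
      (hm.trans_le (hgm _ hp'Q).1)) y
  rw [zetaRaw_eq hpos, zetaRaw_eq hpos, ← hρ] at h5
  have h6 := le_of_mul_le_mul_left h5 hp'0
  linarith

end minimizer

/-! ### The Coulomb field as weak gradient of the potential. -/

/-- The gradient `c_d a / |a|^d` of `a ↦ W(|a|)`. -/
def gradW {d : ℕ} (a : Space d) : Space d := (dimConst d * (‖a‖ ^ d)⁻¹) • a

@[fun_prop]
lemma measurable_gradW {d : ℕ} : Measurable (gradW (d := d)) := by unfold gradW; fun_prop

lemma norm_gradW {d : ℕ} (hd : 2 ≤ d) (a : Space d) : ‖gradW a‖ = dimConst d * riesz a := by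
  rw [gradW, norm_smul, norm_mul, Real.norm_eq_abs, abs_of_pos (dimConst_pos hd), riesz, norm_inv,
    norm_pow, norm_norm, mul_assoc]
  congr 1
  rcases eq_or_ne a 0 with rfl | ha
  · have : d - 1 ≠ 0 := by omega
    simp [zero_pow this]
  · have h0 : ‖a‖ ≠ 0 := norm_ne_zero_iff.2 ha
    have : ‖a‖ ^ d = ‖a‖ ^ (d - 1) * ‖a‖ := by rw [← pow_succ]; congr 1; omega
    rw [this]; field_simp

/-- A smooth approximation of `a ↦ W(|a|)`. -/
def regW (d : ℕ) (s : ℝ) (a : Space d) : ℝ := coulombW d (√(‖a‖ ^ 2 + s ^ 2))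

lemma sqrt_pos_of_pos {d : ℕ} {s : ℝ} (hs : 0 < s) (a : Space d) : 0 < √(‖a‖ ^ 2 + s ^ 2) := by
  positivity

lemma hasGradientAt_regW {d : ℕ} (hd : 2 ≤ d) {s : ℝ} (hs : 0 < s) (a : Space d) :
    HasFDerivAt (regW d s)
      (innerSL ℝ ((dimConst d * (√(‖a‖ ^ 2 + s ^ 2) ^ d)⁻¹) • a)) a := by
  have hpos := sqrt_pos_of_pos hs a
  have h1 : HasFDerivAt (fun a : Space d => ‖a‖ ^ 2 + s ^ 2) (2 • innerSL ℝ a) a :=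
    (hasStrictFDerivAt_norm_sq a).hasFDerivAt.add_const _
  have h2 := h1.sqrt (by positivity)
  have h3 := (hasDerivAt_coulombW hd hpos).comp_hasFDerivAt a h2
  refine h3.congr_fderiv ?_
  ext v
  have : √(‖a‖ ^ 2 + s ^ 2) ^ d = √(‖a‖ ^ 2 + s ^ 2) ^ (d - 1) * √(‖a‖ ^ 2 + s ^ 2) := by
    rw [← pow_succ]; congr 1; omega
  simp only [smul_apply, innerSL_apply_apply, smul_eq_mul, nsmul_eq_mul,
    inner_smul_left, this]
  simp
  field_simp

lemma le_sqrt_add {d : ℕ} (s : ℝ) (a : Space d) : ‖a‖ ≤ √(‖a‖ ^ 2 + s ^ 2) :=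
  Real.le_sqrt_of_sq_le (by linarith [sq_nonneg s])

lemma abs_regW_le {d : ℕ} (hd : 2 ≤ d) {s : ℝ} (hs : 0 < s) (hs1 : s ≤ 1) {a : Space d}
    (ha : a ≠ 0) : |regW d s a| ≤ 2 + ‖a‖ + riesz a := by
  have hpos := sqrt_pos_of_pos hs a
  refine (abs_coulombW_le hd hpos.le).trans ?_
  have h1 : √(‖a‖ ^ 2 + s ^ 2) ≤ ‖a‖ + 1 := by
    refine Real.sqrt_le_iff.2 ⟨by positivity, ?_⟩
    nlinarith [norm_nonneg a]
  have h2 : (√(‖a‖ ^ 2 + s ^ 2) ^ (d - 1))⁻¹ ≤ riesz a := by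
    have := le_sqrt_add s a
    have : 0 < ‖a‖ := norm_pos_iff.2 ha
    unfold riesz
    gcongr
  linarith

lemma tendsto_sqrt_add {d : ℕ} (a : Space d) :
    Tendsto (fun n : ℕ => √(‖a‖ ^ 2 + (1 / ((n : ℝ) + 1)) ^ 2)) atTop (𝓝 ‖a‖) := by
  have h : Tendsto (fun n : ℕ => √(‖a‖ ^ 2 + (1 / ((n : ℝ) + 1)) ^ 2)) atTop
      (𝓝 (√(‖a‖ ^ 2 + 0 ^ 2))) :=
    ((tendsto_one_div_add_atTop_nhds_zero_nat.pow 2).const_add _).sqrt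
  simpa using h

/-- The singularity is integrated in the Lebesgue variable first, with a bound uniform in the source
point. This licenses all exchanges of integrals for potentials and fields. -/
lemma integrable_of_norm_le_riesz {d : ℕ} (hd : 2 ≤ d) {E : Type*} [NormedAddCommGroup E]
    {k : Space d → E} (hk : StronglyMeasurable k) {C : ℝ}
    (hkC : ∀ a, ‖k a‖ ≤ C * (1 + ‖a‖ + riesz a)) {τ : Measure (Space d)} [IsFiniteMeasure τ]
    {R : ℝ} (hτ : ∀ᵐ x ∂τ, ‖x‖ ≤ R) {T : ℝ} :
    Integrable (fun z : Space d × Space d => k (z.1 - z.2))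
      ((volume.restrict (closedBall (0 : Space d) T)).prod τ) := by
  have hfin : IsFiniteMeasure (volume.restrict (closedBall (0 : Space d) T)) :=
    isFiniteMeasure_restrict.2 measure_closedBall_lt_top.ne
  have hr : Integrable (fun z : Space d × Space d => riesz (z.1 - z.2))
      ((volume.restrict (closedBall (0 : Space d) T)).prod τ) := by
    refine ⟨Measurable.aestronglyMeasurable (by fun_prop), ?_⟩
    rw [hasFiniteIntegral_iff_ofReal (Eventually.of_forall fun z => riesz_nonneg _),
      lintegral_prod_symm _ (by fun_prop)]
    refine lt_of_le_of_lt (lintegral_mono fun x => lintegral_riesz_le hd x _) ?_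
    rw [lintegral_const]
    exact ENNReal.mul_lt_top (ENNReal.add_lt_top.2
      ⟨ENNReal.ofReal_lt_top, measure_closedBall_lt_top⟩) (measure_lt_top _ _)
  refine Integrable.mono' (((integrable_const (1 + T + R)).add hr).const_mul |C|)
    (hk.comp_measurable (by fun_prop)).aestronglyMeasurable ?_
  filter_upwards [Measure.quasiMeasurePreserving_fst.ae (ae_restrict_mem measurableSet_closedBall),
    Measure.quasiMeasurePreserving_snd.ae hτ] with z h1 h2
  have h1' : ‖z.1‖ ≤ T := by simpa using h1
  refine (hkC _).trans ?_
  simp only [Pi.add_apply]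
  have h3 := norm_sub_le z.1 z.2
  have h4 := riesz_nonneg (z.1 - z.2)
  calc C * (1 + ‖z.1 - z.2‖ + riesz (z.1 - z.2))
      ≤ |C| * (1 + ‖z.1 - z.2‖ + riesz (z.1 - z.2)) := by
        gcongr
        exact le_abs_self C
    _ ≤ _ := mul_le_mul_of_nonneg_left (by linarith) (abs_nonneg C)

lemma norm_coulombW_le {d : ℕ} (hd : 2 ≤ d) (a : Space d) :
    ‖coulombW d ‖a‖‖ ≤ 1 * (1 + ‖a‖ + riesz a) := by
  rw [one_mul]; exact abs_coulombW_le hd (norm_nonneg a)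

lemma norm_gradW_le {d : ℕ} (hd : 2 ≤ d) (a : Space d) :
    ‖gradW a‖ ≤ dimConst d * (1 + ‖a‖ + riesz a) := by
  rw [norm_gradW hd]
  have := (dimConst_pos hd).le
  gcongr
  linarith [norm_nonneg a]

/-- A continuous function times `f` is integrable on a ball where `f` is. -/
lemma locallyIntegrable_of_closedBall {d : ℕ} {E : Type*} [NormedAddCommGroup E]
    {f : Space d → E} (hf : ∀ T : ℝ, IntegrableOn f (closedBall 0 T)) : LocallyIntegrable f := by
  intro x
  refine ⟨closedBall 0 (‖x‖ + 1), ?_, hf _⟩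
  refine mem_of_superset (ball_mem_nhds x one_pos) fun y hy => ?_
  have h1 : ‖y - x‖ < 1 := by simpa [dist_eq_norm] using hy
  have h2 := norm_le_norm_add_norm_sub' y x
  simp only [mem_closedBall, dist_zero_right]
  linarith

lemma locallyIntegrable_convolution {d : ℕ} (hd : 2 ≤ d) {E : Type*} [NormedAddCommGroup E]
    [NormedSpace ℝ E] {k : Space d → E} (hk : StronglyMeasurable k) {C : ℝ}
    (hkC : ∀ a, ‖k a‖ ≤ C * (1 + ‖a‖ + riesz a)) {τ : Measure (Space d)} [IsFiniteMeasure τ]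
    {R : ℝ} (hτ : ∀ᵐ x ∂τ, ‖x‖ ≤ R) :
    LocallyIntegrable (fun y => ∫ x, k (y - x) ∂τ) :=
  locallyIntegrable_of_closedBall fun _ =>
    (integrable_of_norm_le_riesz hd hk hkC hτ).integral_prod_left

lemma exists_closedBall_support {d : ℕ} {E : Type*} [NormedAddCommGroup E] {h : Space d → E}
    (hh : HasCompactSupport h) : ∃ T : ℝ, ∀ y, y ∉ closedBall (0 : Space d) T → h y = 0 := by
  obtain ⟨T, hT⟩ := hh.isCompact.isBounded.subset_closedBall 0
  exact ⟨T, fun y hy => image_eq_zero_of_notMem_tsupport fun h' => hy (hT h')⟩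

lemma integral_smul_convolution {d : ℕ} (hd : 2 ≤ d) {E : Type*} [NormedAddCommGroup E]
    [NormedSpace ℝ E] [CompleteSpace E] {k : Space d → E} (hk : StronglyMeasurable k) {C : ℝ}
    (hkC : ∀ a, ‖k a‖ ≤ C * (1 + ‖a‖ + riesz a)) {τ : Measure (Space d)} [IsFiniteMeasure τ]
    {R : ℝ} (hτ : ∀ᵐ x ∂τ, ‖x‖ ≤ R) {h : Space d → ℝ} (hh : Continuous h)
    (hhc : HasCompactSupport h) :
    ∫ y, h y • ∫ x, k (y - x) ∂τ = ∫ x, (∫ y, h y • k (y - x)) ∂τ := by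
  obtain ⟨T, hT⟩ := exists_closedBall_support hhc
  obtain ⟨B, hB⟩ := hh.bounded_above_of_compact_support hhc
  have h1 := integrable_of_norm_le_riesz hd hk hkC hτ (T := T)
  have h2 : Integrable (fun z : Space d × Space d => h z.1 • k (z.1 - z.2))
      ((volume.restrict (closedBall (0 : Space d) T)).prod τ) :=
    h1.bdd_smul (φ := fun z : Space d × Space d => h z.1) B
      (Continuous.aestronglyMeasurable (by fun_prop)) (Eventually.of_forall fun z => hB z.1)
  have e1 : ∀ f : Space d → E, ∫ y, h y • f y = ∫ y in closedBall (0 : Space d) T, h y • f y := by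
    intro f
    rw [setIntegral_eq_integral_of_forall_compl_eq_zero]
    intro y hy
    rw [hT y hy, zero_smul]
  rw [e1, integral_congr_ae (Eventually.of_forall fun x => e1 fun y => k (y - x)),
    ← integral_integral_swap h2]
  simp_rw [integral_smul]

lemma integral_convolution_smul {d : ℕ} (hd : 2 ≤ d) {E : Type*} [NormedAddCommGroup E]
    [NormedSpace ℝ E] [CompleteSpace E] {k : Space d → ℝ} (hk : StronglyMeasurable k) {C : ℝ}
    (hkC : ∀ a, ‖k a‖ ≤ C * (1 + ‖a‖ + riesz a)) {τ : Measure (Space d)} [IsFiniteMeasure τ]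
    {R : ℝ} (hτ : ∀ᵐ x ∂τ, ‖x‖ ≤ R) {h : Space d → E} (hh : Continuous h)
    (hhc : HasCompactSupport h) :
    ∫ y, (∫ x, k (y - x) ∂τ) • h y = ∫ x, (∫ y, k (y - x) • h y) ∂τ := by
  obtain ⟨T, hT⟩ := exists_closedBall_support hhc
  obtain ⟨B, hB⟩ := hh.bounded_above_of_compact_support hhc
  have h1 := integrable_of_norm_le_riesz hd hk hkC hτ (T := T)
  have h2 : Integrable (fun z : Space d × Space d => k (z.1 - z.2) • h z.1)
      ((volume.restrict (closedBall (0 : Space d) T)).prod τ) :=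
    h1.smul_bdd (f := fun z : Space d × Space d => h z.1) B
      (Continuous.aestronglyMeasurable (by fun_prop)) (Eventually.of_forall fun z => hB z.1)
  have e1 : ∀ f : Space d → ℝ, ∫ y, f y • h y = ∫ y in closedBall (0 : Space d) T, f y • h y := by
    intro f
    rw [setIntegral_eq_integral_of_forall_compl_eq_zero]
    intro y hy
    rw [hT y hy, smul_zero]
  rw [e1, integral_congr_ae (Eventually.of_forall fun x => e1 fun y => k (y - x)),
    ← integral_integral_swap h2]
  simp_rw [integral_smul_const]

lemma locallyIntegrable_kernel {d : ℕ} (hd : 2 ≤ d) {E : Type*} [NormedAddCommGroup E]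
    [NormedSpace ℝ E] [CompleteSpace E] {k : Space d → E} (hk : StronglyMeasurable k) {C : ℝ}
    (hkC : ∀ a, ‖k a‖ ≤ C * (1 + ‖a‖ + riesz a)) (x : Space d) :
    LocallyIntegrable (fun y => k (y - x)) := by
  have hx : ∀ᵐ z ∂(Measure.dirac x), ‖z‖ ≤ ‖x‖ := by simp [ae_dirac_eq]
  have := locallyIntegrable_convolution hd hk hkC hx
  simpa using this

lemma locallyIntegrable_coulombW {d : ℕ} (hd : 2 ≤ d) (x : Space d) :
    LocallyIntegrable (fun y => coulombW d ‖y - x‖) :=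
  locallyIntegrable_kernel hd (k := fun a => coulombW d ‖a‖)
    (Measurable.stronglyMeasurable (by fun_prop)) (norm_coulombW_le hd) x

lemma locallyIntegrable_gradW {d : ℕ} (hd : 2 ≤ d) (x : Space d) :
    LocallyIntegrable (fun y => gradW (y - x)) :=
  locallyIntegrable_kernel hd (Measurable.stronglyMeasurable (by fun_prop)) (norm_gradW_le hd) x

/-- Integration by parts is legitimate for the smoothed kernel W(√(|a|² + s²)). Its values are
dominated by a locally integrable function, its gradient by that of the true kernel, so dominated
convergence as s → 0 applies on both sides. -/
lemma integral_coulombW_mul_fderiv {d : ℕ} (hd : 2 ≤ d) (x v : Space d) {φ : Space d → ℝ}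
    (hφ : ContDiff ℝ ∞ φ) (hφc : HasCompactSupport φ) :
    ∫ y, coulombW d ‖y - x‖ * fderiv ℝ φ y v = -∫ y, ⟪gradW (y - x), v⟫ * φ y := by
  have hnt := nontrivial_space hd
  have hφd : Differentiable ℝ φ := hφ.differentiable (by simp)
  have hdφ : Continuous fun y => fderiv ℝ φ y v :=
    (hφ.continuous_fderiv (by simp)).clm_apply continuous_const
  have hdφc : HasCompactSupport fun y => fderiv ℝ φ y v := hφc.fderiv_apply (𝕜 := ℝ) v
  have hs : ∀ n : ℕ, 0 < 1 / ((n : ℝ) + 1) := fun n => by positivity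
  have hs1 : ∀ n : ℕ, 1 / ((n : ℝ) + 1) ≤ 1 := fun n => by
    rw [div_le_one (by positivity)]
    linarith [(Nat.cast_nonneg n : (0 : ℝ) ≤ n)]
  have hne : ∀ᵐ y : Space d, y - x ≠ 0 := by
    have : ∀ᵐ y : Space d, y ≠ x := by simp [ae_iff]
    filter_upwards [this] with y hy using sub_ne_zero.2 hy
  have hgrad : ∀ (n : ℕ) (y : Space d), HasFDerivAt (fun y => regW d (1 / ((n : ℝ) + 1)) (y - x))
      (innerSL ℝ ((dimConst d * (√(‖y - x‖ ^ 2 + (1 / ((n : ℝ) + 1)) ^ 2) ^ d)⁻¹) • (y - x))) y := by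
    intro n y
    exact (hasGradientAt_regW hd (hs n) (y - x)).comp y ((hasFDerivAt_id y).sub_const x)
  have hfd : ∀ (n : ℕ) (y : Space d), fderiv ℝ (fun y => regW d (1 / ((n : ℝ) + 1)) (y - x)) y v =
      ⟪(dimConst d * (√(‖y - x‖ ^ 2 + (1 / ((n : ℝ) + 1)) ^ 2) ^ d)⁻¹) • (y - x), v⟫ := by
    intro n y
    rw [(hgrad n y).fderiv, innerSL_apply_apply]
  have hcont : ∀ n : ℕ, Continuous (fun y : Space d => regW d (1 / ((n : ℝ) + 1)) (y - x)) :=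
    fun n => continuous_iff_continuousAt.2 fun y => (hgrad n y).continuousAt
  have hcont' : ∀ n : ℕ, Continuous (fun y : Space d =>
      ⟪(dimConst d * (√(‖y - x‖ ^ 2 + (1 / ((n : ℝ) + 1)) ^ 2) ^ d)⁻¹) • (y - x), v⟫) := by
    intro n
    have h1 : Continuous fun y : Space d => √(‖y - x‖ ^ 2 + (1 / ((n : ℝ) + 1)) ^ 2) ^ d := by
      fun_prop
    have h2 : ∀ y : Space d, √(‖y - x‖ ^ 2 + (1 / ((n : ℝ) + 1)) ^ 2) ^ d ≠ 0 := fun y =>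
      pow_ne_zero _ (sqrt_pos_of_pos (hs n) (y - x)).ne'
    exact ((continuous_const.mul (h1.inv₀ h2)).smul (continuous_id.sub continuous_const)).inner
      continuous_const
  have hparts : ∀ n : ℕ, ∫ y, regW d (1 / ((n : ℝ) + 1)) (y - x) * fderiv ℝ φ y v =
      -∫ y, ⟪(dimConst d * (√(‖y - x‖ ^ 2 + (1 / ((n : ℝ) + 1)) ^ 2) ^ d)⁻¹) • (y - x), v⟫ * φ y := by
    intro n
    have := integral_mul_fderiv_eq_neg_fderiv_mul_of_integrable (μ := volume) (v := v)
      (f := fun y => regW d (1 / ((n : ℝ) + 1)) (y - x)) (g := φ)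
      (by
        simp_rw [hfd]
        exact ((hcont' n).mul hφ.continuous).integrable_of_hasCompactSupport hφc.mul_left)
      (((hcont n).mul hdφ).integrable_of_hasCompactSupport hdφc.mul_left)
      (((hcont n).mul hφ.continuous).integrable_of_hasCompactSupport hφc.mul_left)
      (fun y _ => (hgrad n y).differentiableAt) (fun y _ => hφd y)
    simp_rw [hfd] at this
    exact this
  have hl1 : Tendsto (fun n : ℕ => ∫ y, regW d (1 / ((n : ℝ) + 1)) (y - x) * fderiv ℝ φ y v) atTop
      (𝓝 (∫ y, coulombW d ‖y - x‖ * fderiv ℝ φ y v)) := by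
    refine tendsto_integral_of_dominated_convergence
      (fun y => (2 + ‖y - x‖ + riesz (y - x)) * ‖fderiv ℝ φ y v‖)
      (fun n => ((hcont n).mul hdφ).aestronglyMeasurable) ?_ ?_ ?_
    · have h := locallyIntegrable_kernel hd (k := fun a : Space d => 2 + ‖a‖ + riesz a)
        (Measurable.stronglyMeasurable (by fun_prop)) (C := 2) (fun a => by
          have := riesz_nonneg a
          have := norm_nonneg a
          rw [Real.norm_eq_abs, abs_of_nonneg (by positivity)]; linarith) x
      exact h.integrable_smul_right_of_hasCompactSupport hdφ.norm hdφc.norm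
    · intro n
      filter_upwards [hne] with y hy
      rw [norm_mul]
      gcongr
      exact abs_regW_le hd (hs n) (hs1 n) hy
    · filter_upwards [hne] with y hy
      refine Tendsto.mul_const _ ?_
      exact (hasDerivAt_coulombW hd (norm_pos_iff.2 hy)).continuousAt.tendsto.comp
        (tendsto_sqrt_add (y - x))
  have hl2 : Tendsto (fun n : ℕ => ∫ y, ⟪(dimConst d *
      (√(‖y - x‖ ^ 2 + (1 / ((n : ℝ) + 1)) ^ 2) ^ d)⁻¹) • (y - x), v⟫ * φ y) atTop
      (𝓝 (∫ y, ⟪gradW (y - x), v⟫ * φ y)) := by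
    refine tendsto_integral_of_dominated_convergence
      (fun y => ‖gradW (y - x)‖ * (‖v‖ * ‖φ y‖))
      (fun n => ((hcont' n).mul hφ.continuous).aestronglyMeasurable) ?_ ?_ ?_
    · have h := locallyIntegrable_kernel hd (k := fun a : Space d => ‖gradW a‖)
        (Measurable.stronglyMeasurable (by fun_prop)) (fun a => by
          rw [norm_norm]; exact norm_gradW_le hd a) x
      exact h.integrable_smul_right_of_hasCompactSupport
        (continuous_const.mul hφ.continuous.norm) (hφc.norm.mul_left)
    · intro n
      filter_upwards [hne] with y hy
      rw [norm_mul, ← mul_assoc]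
      gcongr
      refine (norm_inner_le_norm _ _).trans ?_
      gcongr
      rw [gradW, norm_smul, norm_smul, norm_mul, norm_mul, norm_inv, norm_inv, norm_pow, norm_pow,
        norm_norm, Real.norm_eq_abs √_, abs_of_pos (sqrt_pos_of_pos (hs n) _)]
      have h0 : 0 < ‖y - x‖ := norm_pos_iff.2 hy
      have := le_sqrt_add (1 / ((n : ℝ) + 1)) (y - x)
      gcongr
    · filter_upwards [hne] with y hy
      refine Tendsto.mul_const _ (Tendsto.inner (Tendsto.smul_const (Tendsto.const_mul _ ?_) _)
        tendsto_const_nhds)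
      exact ((tendsto_sqrt_add (y - x)).pow d).inv₀ (pow_ne_zero _ (norm_ne_zero_iff.2 hy))
  refine tendsto_nhds_unique hl1 ?_
  simp_rw [hparts]
  exact hl2.neg

lemma continuous_gradient {d : ℕ} {φ : Space d → ℝ} (hφ : ContDiff ℝ ∞ φ) :
    Continuous (gradient φ) :=
  (InnerProductSpace.toDual ℝ (Space d)).symm.continuous.comp (hφ.continuous_fderiv (by simp))

lemma hasCompactSupport_gradient {d : ℕ} {φ : Space d → ℝ} (hφc : HasCompactSupport φ) :
    HasCompactSupport (gradient φ) :=
  (hφc.fderiv (𝕜 := ℝ)).comp_left (g := (InnerProductSpace.toDual ℝ (Space d)).symm) (map_zero _)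

lemma integral_coulombW_smul_gradient {d : ℕ} (hd : 2 ≤ d) (x : Space d) {φ : Space d → ℝ}
    (hφ : ContDiff ℝ ∞ φ) (hφc : HasCompactSupport φ) :
    ∫ y, coulombW d ‖y - x‖ • gradient φ y = -∫ y, φ y • gradW (y - x) := by
  refine ext_inner_left ℝ fun v => ?_
  have h1 := (locallyIntegrable_coulombW hd x).integrable_smul_right_of_hasCompactSupport
    (continuous_gradient hφ) (hasCompactSupport_gradient hφc)
  have h2 := (locallyIntegrable_gradW hd x).integrable_smul_left_of_hasCompactSupport
    hφ.continuous hφc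
  rw [inner_neg_right, ← integral_inner h1, ← integral_inner h2]
  have := integral_coulombW_mul_fderiv hd x v hφ hφc
  have e1 : ∀ y, ⟪v, coulombW d ‖y - x‖ • gradient φ y⟫ = coulombW d ‖y - x‖ * fderiv ℝ φ y v := by
    intro y
    rw [real_inner_smul_right, real_inner_comm, inner_gradient_left]
  have e2 : ∀ y, ⟪v, φ y • gradW (y - x)⟫ = ⟪gradW (y - x), v⟫ * φ y := by
    intro y
    rw [real_inner_smul_right, real_inner_comm, mul_comm]
  simp only [e1, e2, this]

lemma hasWeakGradient_coulombW {d : ℕ} (hd : 2 ≤ d) (x : Space d) :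
    HasWeakGradient (fun y => coulombW d ‖y - x‖) (fun y => gradW (y - x)) :=
  ⟨locallyIntegrable_coulombW hd x, locallyIntegrable_gradW hd x,
    fun _ hφ hφc => integral_coulombW_smul_gradient hd x hφ hφc⟩

/-- The gradient field of the potential of a measure. -/
def field {d : ℕ} (τ : Measure (Space d)) (y : Space d) : Space d := ∫ x, gradW (y - x) ∂τ

lemma locallyIntegrable_pot {d : ℕ} (hd : 2 ≤ d) {τ : Measure (Space d)} [IsFiniteMeasure τ]
    {R : ℝ} (hτ : ∀ᵐ x ∂τ, ‖x‖ ≤ R) : LocallyIntegrable (pot τ) :=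
  locallyIntegrable_convolution hd (k := fun a => coulombW d ‖a‖)
    (Measurable.stronglyMeasurable (by fun_prop)) (norm_coulombW_le hd) hτ

lemma locallyIntegrable_field {d : ℕ} (hd : 2 ≤ d) {τ : Measure (Space d)} [IsFiniteMeasure τ]
    {R : ℝ} (hτ : ∀ᵐ x ∂τ, ‖x‖ ≤ R) : LocallyIntegrable (field τ) :=
  locallyIntegrable_convolution hd
    (Measurable.stronglyMeasurable (by fun_prop)) (norm_gradW_le hd) hτ

lemma hasWeakGradient_pot {d : ℕ} (hd : 2 ≤ d) {τ : Measure (Space d)} [IsFiniteMeasure τ]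
    {R : ℝ} (hτ : ∀ᵐ x ∂τ, ‖x‖ ≤ R) : HasWeakGradient (pot τ) (field τ) := by
  refine ⟨locallyIntegrable_pot hd hτ, locallyIntegrable_field hd hτ, fun φ hφ hφc => ?_⟩
  have h1 := integral_convolution_smul hd (k := fun a : Space d => coulombW d ‖a‖)
    (Measurable.stronglyMeasurable (by fun_prop)) (norm_coulombW_le hd) hτ
    (continuous_gradient hφ) (hasCompactSupport_gradient hφc)
  have h2 := integral_smul_convolution hd (k := gradW (d := d))
    (Measurable.stronglyMeasurable (by fun_prop)) (norm_gradW_le hd) hτ hφ.continuous hφc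
  unfold pot field
  rw [h1, h2, ← integral_neg]
  exact integral_congr_ae (Eventually.of_forall fun x =>
    integral_coulombW_smul_gradient hd x hφ hφc)

lemma HasWeakGradient.sub_smul {d : ℕ} {f₁ f₂ : Space d → ℝ} {G₁ G₂ : Space d → Space d}
    (h₁ : HasWeakGradient f₁ G₁) (h₂ : HasWeakGradient f₂ G₂) (c : ℝ) :
    HasWeakGradient (fun y => f₁ y - c * f₂ y) (fun y => G₁ y - c • G₂ y) := by
  refine ⟨h₁.1.sub (h₂.1.smul c), h₁.2.1.sub (h₂.2.1.smul c), fun φ hφ hφc => ?_⟩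
  have hg := continuous_gradient hφ
  have hgc := hasCompactSupport_gradient hφc
  have a1 := h₁.1.integrable_smul_right_of_hasCompactSupport hg hgc
  have a2 := h₂.1.integrable_smul_right_of_hasCompactSupport hg hgc
  have b1 := h₁.2.1.integrable_smul_left_of_hasCompactSupport hφ.continuous hφc
  have b2 := h₂.2.1.integrable_smul_left_of_hasCompactSupport hφ.continuous hφc
  have e1 : ∀ y, (f₁ y - c * f₂ y) • gradient φ y =
      f₁ y • gradient φ y - c • f₂ y • gradient φ y := fun y => by
    rw [_root_.sub_smul, mul_smul]
  have e2 : ∀ y, φ y • (G₁ y - c • G₂ y) = φ y • G₁ y - c • φ y • G₂ y := fun y => by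
    rw [smul_sub, smul_comm]
  simp only [e1, e2]
  have a3 : Integrable (fun y => c • f₂ y • gradient φ y) := a2.smul c
  have b3 : Integrable (fun y => c • φ y • G₂ y) := b2.smul c
  rw [integral_sub a1 a3, integral_sub b1 b3, integral_smul, integral_smul,
    h₁.2.2 φ hφ hφc, h₂.2.2 φ hφ hφc]
  simp only [smul_neg, neg_sub]
  abel

/-- Weak gradients are unique almost everywhere. -/
lemma HasWeakGradient.ae_eq {d : ℕ} {f : Space d → ℝ} {G₁ G₂ : Space d → Space d}
    (h₁ : HasWeakGradient f G₁) (h₂ : HasWeakGradient f G₂) : G₁ =ᵐ[volume] G₂ := by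
  refine ae_eq_of_integral_contDiff_smul_eq h₁.2.1 h₂.2.1 fun φ hφ hφc => ?_
  have := (h₁.2.2 φ hφ hφc).symm.trans (h₂.2.2 φ hφ hφc)
  exact neg_injective this

/-- The weak gradient is tested against each ∂_i φ, and the i-th components are summed. -/
lemma HasWeakGradient.integral_mul_laplacian {d : ℕ} {f : Space d → ℝ} {G : Space d → Space d}
    (h : HasWeakGradient f G) {φ : Space d → ℝ} (hφ : ContDiff ℝ ∞ φ)
    (hφc : HasCompactSupport φ) :
    ∫ y, f y * Laplacian.laplacian φ y = -∫ y, ⟪G y, gradient φ y⟫ := by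
  set e := EuclideanSpace.basisFun (Fin d) ℝ with he
  set ψ : Fin d → Space d → ℝ := fun i y => fderiv ℝ φ y (e i) with hψ
  have hψs : ∀ i, ContDiff ℝ ∞ (ψ i) := fun i =>
    (hφ.fderiv_right (m := ∞) (by simp)).clm_apply contDiff_const
  have hψc : ∀ i, HasCompactSupport (ψ i) := fun i => hφc.fderiv_apply (𝕜 := ℝ) (e i)
  have hlap : ∀ y, Laplacian.laplacian φ y = ∑ i, fderiv ℝ (ψ i) y (e i) := by
    intro y
    rw [InnerProductSpace.laplacian_eq_iteratedFDeriv_orthonormalBasis φ e]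
    refine Finset.sum_congr rfl fun i _ => ?_
    rw [iteratedFDeriv_two_apply]
    simp only [Matrix.cons_val_zero, Matrix.cons_val_one, hψ]
    have hdd : DifferentiableAt ℝ (fderiv ℝ φ) y :=
      (hφ.fderiv_right (m := ∞) (by simp)).differentiable (by simp) y
    rw [fderiv_clm_apply hdd (differentiableAt_const _)]
    simp
  have hi1 : ∀ i, Integrable (fun y => f y • gradient (ψ i) y) := fun i =>
    h.1.integrable_smul_right_of_hasCompactSupport (continuous_gradient (hψs i))
      (hasCompactSupport_gradient (hψc i))
  have hi2 : ∀ i, Integrable (fun y => ψ i y • G y) := fun i =>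
    h.2.1.integrable_smul_left_of_hasCompactSupport (hψs i).continuous (hψc i)
  have key : ∀ i, ∫ y, f y * fderiv ℝ (ψ i) y (e i) = -∫ y, ψ i y * ⟪e i, G y⟫ := by
    intro i
    have : ⟪e i, ∫ y, f y • gradient (ψ i) y⟫ = ⟪e i, -∫ y, ψ i y • G y⟫ := by
      rw [h.2.2 (ψ i) (hψs i) (hψc i)]
    rw [inner_neg_right, ← integral_inner (hi1 i), ← integral_inner (hi2 i)] at this
    simp_rw [real_inner_smul_right] at this
    rw [← this]
    refine integral_congr_ae (Eventually.of_forall fun y => ?_)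
    simp only
    rw [real_inner_comm, inner_gradient_left]
  have hj1 : ∀ i, Integrable (fun y => f y * fderiv ℝ (ψ i) y (e i)) := fun i => by
    refine ((hi1 i).inner_const (e i)).congr (Eventually.of_forall fun y => ?_)
    simp only
    rw [real_inner_smul_left, inner_gradient_left]
  have hj2 : ∀ i, Integrable (fun y => ψ i y * ⟪e i, G y⟫) := fun i => by
    refine ((hi2 i).const_inner (e i)).congr (Eventually.of_forall fun y => ?_)
    simp only
    rw [real_inner_smul_right]
  simp_rw [hlap, Finset.mul_sum]
  rw [integral_finsetSum _ fun i _ => hj1 i]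
  simp_rw [key]
  rw [Finset.sum_neg_distrib, ← integral_finsetSum _ fun i _ => hj2 i]
  congr 1
  refine integral_congr_ae (Eventually.of_forall fun y => ?_)
  simp only [hψ]
  rw [← e.sum_inner_mul_inner (G y) (gradient φ y)]
  refine Finset.sum_congr rfl fun i _ => ?_
  rw [← inner_gradient_left, real_inner_comm (G y), real_inner_comm (e i) (gradient φ y)]
  ring

/-! ### Flux of the Coulomb field in polar coordinates and Poisson's equation. -/

lemma pow_mul_inner_gradW {d : ℕ} (hd : 2 ≤ d) {w : Space d} {r : ℝ} (hr : 0 < r)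
    (hw : ‖w‖ = 1) (v : Space d) :
    r ^ (d - 1) * ⟪gradW (r • w), v⟫ = dimConst d * ⟪w, v⟫ := by
  obtain ⟨e, rfl⟩ : ∃ e, d = e + 1 := ⟨d - 1, by omega⟩
  rw [gradW, norm_smul, hw, Real.norm_of_nonneg hr.le, real_inner_smul_left, real_inner_smul_left]
  simp only [Nat.add_sub_cancel, mul_one]
  field_simp
  ring

/-- The flux of a gradient field `G = ∇φ` against the Coulomb field of a point `x`, outside a ball
around `x`, is a spherical mean of the potential. -/
lemma integral_inner_gradW_compl_closedBall {d : ℕ} (hd : 2 ≤ d) {x : Space d} {φ : Space d → ℝ}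
    {G : Space d → Space d} {η : ℝ} (hη : 0 ≤ η)
    (hi : IntegrableOn (fun y => ⟪gradW (y - x), G y⟫) (closedBall x η)ᶜ)
    (hφ : ∀ᵐ w : sphere (0 : Space d) 1 ∂(sphereMeasure d),
      ContinuousWithinAt (fun r : ℝ => φ (x + r • (w : Space d))) (Ici η) η ∧
      (∀ r, η < r → HasDerivAt (fun r : ℝ => φ (x + r • (w : Space d)))
        ⟪(w : Space d), G (x + r • (w : Space d))⟫ r) ∧
      Tendsto (fun r : ℝ => φ (x + r • (w : Space d))) atTop (𝓝 0)) :
    ∫ y in (closedBall x η)ᶜ, ⟪gradW (y - x), G y⟫ =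
      -dimConst d * ∫ w : sphere (0 : Space d) 1, φ (x + η • (w : Space d)) ∂(sphereMeasure d) := by
  have hms : MeasurableSet (closedBall x η)ᶜ := measurableSet_closedBall.compl
  set F : Space d → ℝ := (closedBall x η)ᶜ.indicator (fun y => ⟪gradW (y - x), G y⟫) with hF
  have hFi : Integrable F := hi.integrable_indicator hms
  have hFx : Integrable (fun z => F (x + z)) := hFi.comp_add_left x
  obtain ⟨h1, h2⟩ := integral_polar hd hFx
  rw [← integral_indicator hms, ← hF, ← integral_add_left_eq_self F x, h1, ← integral_const_mul]
  refine integral_congr_ae ?_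
  filter_upwards [h2, hφ] with w hw hφw
  have hw1 : ‖(w : Space d)‖ = 1 := by simp
  -- The Jacobian r^{d-1} cancels the decay of the Coulomb field; what is left is c_d times the
  -- radial derivative of the potential.
  have hin : ∀ r : ℝ, 0 < r → r ^ (d - 1) * F (x + r • (w : Space d)) =
      (Ioi η).indicator (fun r : ℝ => dimConst d * ⟪(w : Space d), G (x + r • (w : Space d))⟫) r := by
    intro r hr
    have hmem : x + r • (w : Space d) ∈ (closedBall x η)ᶜ ↔ r ∈ Ioi η := by
      simp [mem_closedBall, dist_eq_norm, norm_smul, hw1, abs_of_pos hr]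
    by_cases h : r ∈ Ioi η
    · rw [hF, indicator_of_mem (hmem.2 h), indicator_of_mem h, add_sub_cancel_left,
        pow_mul_inner_gradW hd hr hw1]
    · rw [hF, indicator_of_notMem (fun h' => h (hmem.1 h')), indicator_of_notMem h, mul_zero]
  have hsub : Ioi η ∩ Ioi (0 : ℝ) = Ioi η := inter_eq_left.2 (Ioi_subset_Ioi hη)
  have hint : IntegrableOn (fun r : ℝ => dimConst d * ⟪(w : Space d), G (x + r • (w : Space d))⟫)
      (Ioi η) := by
    have := (integrableOn_congr_fun (fun r hr => hin r hr) measurableSet_Ioi).1 hw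
    have h' := (integrable_indicator_iff (μ := volume.restrict (Ioi (0 : ℝ)))
      (measurableSet_Ioi (a := η))).1 this
    rwa [IntegrableOn, Measure.restrict_restrict measurableSet_Ioi, hsub] at h'
  rw [setIntegral_congr_fun measurableSet_Ioi (fun r hr => hin r hr),
    setIntegral_indicator measurableSet_Ioi, inter_comm, hsub, integral_const_mul]
  have hint' : IntegrableOn (fun r : ℝ => ⟪(w : Space d), G (x + r • (w : Space d))⟫) (Ioi η) := by
    refine (hint.const_mul (dimConst d)⁻¹).congr (Eventually.of_forall fun r => ?_)
    simp only
    rw [inv_mul_cancel_left₀ (dimConst_pos hd).ne']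
  -- Each ray contributes by the fundamental theorem of calculus: zero at infinity minus the value
  -- at radius η.
  rw [integral_Ioi_of_hasDerivAt_of_tendsto hφw.1 (fun r hr => hφw.2.1 r hr) hint' hφw.2.2]
  ring

lemma hasDerivAt_ray {d : ℕ} {φ : Space d → ℝ} {x w G : Space d} {r : ℝ}
    (h : HasGradientAt φ G (x + r • w)) :
    HasDerivAt (fun r : ℝ => φ (x + r • w)) ⟪w, G⟫ r := by
  have h1 : HasDerivAt (fun r : ℝ => x + r • w) w r := by
    simpa using ((hasDerivAt_id r).smul_const w).const_add x
  have := h.hasFDerivAt.comp_hasDerivAt r h1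
  simp only [InnerProductSpace.toDual_apply_apply] at this
  rwa [real_inner_comm]

lemma tendsto_norm_ray {d : ℕ} (x : Space d) {w : Space d} (hw : ‖w‖ = 1) :
    Tendsto (fun r : ℝ => ‖x + r • w‖) atTop atTop := by
  refine tendsto_atTop_mono (f := fun r : ℝ => r - ‖x‖) (fun r => ?_)
    (tendsto_atTop_add_const_right _ _ tendsto_id)
  have h1 : ‖r • w‖ ≤ ‖x + r • w‖ + ‖x‖ := by
    simpa using norm_sub_le (x + r • w) x
  rw [norm_smul, hw, mul_one, Real.norm_eq_abs] at h1
  linarith [le_abs_self r]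

/-- The flux identity at η = 0: the removed ball is a null point and the spherical mean is the value
at x times the area. -/
lemma integral_inner_gradW_gradient {d : ℕ} (hd : 2 ≤ d) (x : Space d) {φ : Space d → ℝ}
    (hφ : ContDiff ℝ ∞ φ) (hφc : HasCompactSupport φ) :
    ∫ y, ⟪gradW (y - x), gradient φ y⟫ = -(coulombConst d * φ x) := by
  have hnt := nontrivial_space hd
  have hφd : Differentiable ℝ φ := hφ.differentiable (by simp)
  have hi : Integrable (fun y => ⟪gradW (y - x), gradient φ y⟫) := by
    have h := (locallyIntegrable_kernel hd (k := fun a : Space d => ‖gradW a‖)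
        (Measurable.stronglyMeasurable (by fun_prop)) (fun a => by
          rw [norm_norm]; exact norm_gradW_le hd a) x).integrable_smul_right_of_hasCompactSupport
      (continuous_gradient hφ).norm (hasCompactSupport_gradient hφc).norm
    refine h.mono' (AEStronglyMeasurable.inner
      (Measurable.aestronglyMeasurable (by fun_prop)) (continuous_gradient hφ).aestronglyMeasurable)
      (Eventually.of_forall fun y => ?_)
    exact norm_inner_le_norm _ _
  have key := integral_inner_gradW_compl_closedBall hd (x := x) (φ := φ) (G := gradient φ) le_rfl
    hi.integrableOn (Eventually.of_forall fun w => ⟨?_, ?_, ?_⟩)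
  · have hae : ((closedBall x 0)ᶜ : Set (Space d)) =ᵐ[volume] univ := by
      rw [closedBall_zero, ae_eq_univ]; simp
    rw [setIntegral_congr_set hae, setIntegral_univ] at key
    rw [key, coulombConst_eq]
    simp [sphereArea, Measure.real]
    ring
  · have : Continuous fun r : ℝ => φ (x + r • (w : Space d)) := by
      have := hφ.continuous
      fun_prop
    exact this.continuousWithinAt
  · intro r _
    exact hasDerivAt_ray (hφd _).hasGradientAt
  · have hw1 : ‖(w : Space d)‖ = 1 := by simp
    have h1 : Tendsto (fun r : ℝ => x + r • (w : Space d)) atTop (cocompact _) := by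
      rw [← Metric.cobounded_eq_cocompact, ← tendsto_norm_atTop_iff_cobounded]
      exact tendsto_norm_ray x hw1
    refine tendsto_const_nhds.congr' ?_
    have := hφc.isCompact.compl_mem_cocompact
    filter_upwards [h1 this] with r hr
    exact (image_eq_zero_of_notMem_tsupport hr).symm

lemma integral_coulombW_mul_laplacian {d : ℕ} (hd : 2 ≤ d) (x : Space d) {φ : Space d → ℝ}
    (hφ : ContDiff ℝ ∞ φ) (hφc : HasCompactSupport φ) :
    ∫ y, coulombW d ‖y - x‖ * Laplacian.laplacian φ y = coulombConst d * φ x := by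
  rw [(hasWeakGradient_coulombW hd x).integral_mul_laplacian hφ hφc,
    integral_inner_gradW_gradient hd x hφ hφc, neg_neg]

lemma continuous_laplacian {d : ℕ} {φ : Space d → ℝ} (hφ : ContDiff ℝ ∞ φ) :
    Continuous (Laplacian.laplacian φ) := by
  rw [InnerProductSpace.laplacian_eq_iteratedFDeriv_orthonormalBasis φ
    (EuclideanSpace.basisFun (Fin d) ℝ)]
  refine continuous_finsetSum _ fun i _ => ?_
  have := hφ.continuous_iteratedFDeriv (m := 2) ENat.LEInfty.out
  fun_prop

lemma hasCompactSupport_laplacian {d : ℕ} {φ : Space d → ℝ} (hφc : HasCompactSupport φ) :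
    HasCompactSupport (Laplacian.laplacian φ) := by
  refine hφc.of_isClosed_subset (isClosed_tsupport _) (closure_minimal (fun y hy => ?_)
    (isClosed_tsupport _))
  by_contra h
  refine hy ?_
  have := notMem_tsupport_iff_eventuallyEq.1 h
  rw [InnerProductSpace.laplacian_eq_iteratedFDeriv_orthonormalBasis φ
    (EuclideanSpace.basisFun (Fin d) ℝ)]
  simp [(this.iteratedFDeriv ℝ 2).eq_of_nhds]

lemma integral_pot_mul_laplacian {d : ℕ} (hd : 2 ≤ d) {τ : Measure (Space d)} [IsFiniteMeasure τ]
    {R : ℝ} (hτ : ∀ᵐ x ∂τ, ‖x‖ ≤ R) {φ : Space d → ℝ} (hφ : ContDiff ℝ ∞ φ)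
    (hφc : HasCompactSupport φ) :
    ∫ y, pot τ y * Laplacian.laplacian φ y = coulombConst d * ∫ x, φ x ∂τ := by
  have h1 := integral_convolution_smul hd (k := fun a : Space d => coulombW d ‖a‖)
    (Measurable.stronglyMeasurable (by fun_prop)) (norm_coulombW_le hd) hτ
    (continuous_laplacian hφ) (hasCompactSupport_laplacian hφc)
  simp only [smul_eq_mul, integral_coulombW_mul_laplacian hd _ hφ hφc] at h1
  rw [integral_const_mul] at h1
  exact h1

lemma isFiniteMeasure_pointMeasure {d N : ℕ} (q : Fin N → ℝ) (x : Fin N → Space d) :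
    IsFiniteMeasure (pointMeasure q x) := by
  unfold pointMeasure; infer_instance

lemma ae_pointMeasure {d N : ℕ} (q : Fin N → ℝ) (x : Fin N → Space d) {p : ℝ × Space d → Prop}
    (hp : ∀ i, p (q i, x i)) : ∀ᵐ z ∂(pointMeasure q x), p z := by
  rw [pointMeasure, ae_iff, Measure.finsetSum_apply]
  refine Finset.sum_eq_zero fun i _ => ?_
  rw [← ae_iff]
  simpa [ae_dirac_eq] using hp i

lemma integral_pointMeasure {d N : ℕ} {E : Type*} [NormedAddCommGroup E] [NormedSpace ℝ E]
    [CompleteSpace E] (q : Fin N → ℝ) (x : Fin N → Space d) (f : ℝ × Space d → E) : ∫ p, f p ∂(pointMeasure q x) = ∑ i, f (q i, x i) := by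
  rw [pointMeasure, integral_finsetSum_measure fun i _ => integrable_dirac (by simp)]
  simp

/-- Point charges and background are both treated as finite measures of bounded support, so one
identity for potentials of measures serves twice. -/
lemma solvesPoisson_fluctPotential {d N : ℕ} (hd : 2 ≤ d) {qmin qmax R : ℝ} (hq : 0 < qmin)
    {μ : Measure (ℝ × Space d)} [IsFiniteMeasure μ] (hμQ : ∀ᵐ p ∂μ, p.1 ∈ Icc qmin qmax)
    (hR : ∀ᵐ x ∂(chargeMeasure μ), ‖x‖ ≤ R) {q : Fin N → ℝ} {x : Fin N → Space d}
    (hqi : ∀ i, q i ∈ Icc qmin qmax) : SolvesPoisson μ q x (fluctPotential μ q x) := by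
  have hfp := isFiniteMeasure_pointMeasure q x
  have hpQ : ∀ᵐ p ∂(pointMeasure q x), p.1 ∈ Icc qmin qmax := ae_pointMeasure q x hqi
  have hf1 := isFiniteMeasure_chargeMeasure hμQ
  have hf2 := isFiniteMeasure_chargeMeasure hpQ
  have hpos : ∀ᵐ p ∂μ, 0 < p.1 := hμQ.mono fun p hp => hq.trans_le hp.1
  have hpos' : ∀ᵐ p ∂(pointMeasure q x), 0 < p.1 := hpQ.mono fun p hp => hq.trans_le hp.1
  have hR' : ∀ᵐ y ∂(chargeMeasure (pointMeasure q x)), ‖y‖ ≤ ∑ i, ‖x i‖ := by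
    refine ae_chargeMeasure_of_ae (measurableSet_le measurable_norm measurable_const)
      (ae_pointMeasure q x fun i => ?_)
    exact Finset.single_le_sum (f := fun i => ‖x i‖) (fun j _ => norm_nonneg _) (Finset.mem_univ i)
  have hfun : fluctPotential μ q x =
      fun y => pot (chargeMeasure (pointMeasure q x)) y - (N : ℝ) * pot (chargeMeasure μ) y := by
    funext y
    rw [fluctPotential, pot_chargeMeasure hpos, pot_chargeMeasure hpos']
  have hl1 := locallyIntegrable_pot hd hR'
  have hl2 := locallyIntegrable_pot hd hR
  refine ⟨by rw [hfun]; exact hl1.sub (hl2.smul (N : ℝ)), fun φ hφ hφc => ?_⟩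
  have i1 := hl1.integrable_smul_right_of_hasCompactSupport (continuous_laplacian hφ)
    (hasCompactSupport_laplacian hφc)
  have i2 := hl2.integrable_smul_right_of_hasCompactSupport (continuous_laplacian hφ)
    (hasCompactSupport_laplacian hφc)
  simp only [smul_eq_mul] at i1 i2
  have hφm := hφ.continuous.stronglyMeasurable
  simp only [hfun, sub_mul, mul_assoc]
  rw [integral_sub i1 (i2.const_mul _), integral_const_mul, integral_pot_mul_laplacian hd hR' hφ hφc,
    integral_pot_mul_laplacian hd hR hφ hφc, integral_chargeMeasure hpos hφm,
    integral_chargeMeasure hpos' hφm]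
  simp only [smul_eq_mul]
  ring

/-! ### Fields relative to a reference: decay, domination and overlap. -/

/-- A smooth reference potential with the growth of the Coulomb kernel at infinity; it is needed in
dimension two only, where the Coulomb field is not square integrable at infinity. -/
def refPot (d : ℕ) (y : Space d) : ℝ := if d = 2 then regW d 1 y else 0

/-- The gradient of `refPot`. -/
def refField {d : ℕ} (y : Space d) : Space d :=
  if d = 2 then (dimConst d * (√(‖y‖ ^ 2 + 1 ^ 2) ^ d)⁻¹) • y else 0

/-- The Coulomb field of a point, minus the reference field. -/
def relField {d : ℕ} (x y : Space d) : Space d := gradW (y - x) - refField y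

/-- The Coulomb potential of a point, minus the reference potential. -/
def relPot {d : ℕ} (x y : Space d) : ℝ := coulombW d ‖y - x‖ - refPot d y

/-- A rate of decay of `relField` at infinity. -/
def decayExp (d : ℕ) : ℕ := max 2 (d - 1)

/-- Makes the product of two relative fields integrable at infinity. -/
lemma lt_two_mul_decayExp {d : ℕ} (hd : 2 ≤ d) : d < decayExp d + decayExp d := by
  unfold decayExp; omega

/-- Makes a relative field integrable at infinity against a bare Coulomb field or the reference
field, which decay only like |y|^{1-d}. -/
lemma lt_decayExp_add {d : ℕ} (hd : 2 ≤ d) : d < (d - 1) + decayExp d := by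
  unfold decayExp; omega

lemma hasGradientAt_refPot {d : ℕ} (hd : 2 ≤ d) (y : Space d) :
    HasGradientAt (refPot d) (refField y) y := by
  rw [hasGradientAt_iff_hasFDerivAt]
  unfold refPot refField
  split_ifs with h
  · exact hasGradientAt_regW hd one_pos y
  · simpa using hasFDerivAt_const (0 : ℝ) y

lemma continuous_refPot {d : ℕ} (hd : 2 ≤ d) : Continuous (refPot d) :=
  continuous_iff_continuousAt.2 fun y => (hasGradientAt_refPot hd y).hasFDerivAt.continuousAt

lemma measurable_refField {d : ℕ} : Measurable (refField (d := d)) := by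
  unfold refField
  split_ifs
  · exact ((by fun_prop : Continuous fun y : Space d =>
      √(‖y‖ ^ 2 + 1 ^ 2) ^ d).measurable.inv.const_mul _).smul measurable_id
  · exact measurable_const

@[fun_prop]
lemma measurable_relField {d : ℕ} :
    Measurable (fun p : Space d × Space d => relField p.1 p.2) := by
  unfold relField
  exact (measurable_gradW.comp (measurable_snd.sub measurable_fst)).sub
    (measurable_refField.comp measurable_snd)

lemma refField_of_ne {d : ℕ} (h : d ≠ 2) (y : Space d) : refField y = 0 := if_neg h

lemma refPot_of_ne {d : ℕ} (h : d ≠ 2) (y : Space d) : refPot d y = 0 := if_neg h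

lemma refField_two (y : Space 2) : refField y = (‖y‖ ^ 2 + 1)⁻¹ • y := by
  rw [refField, if_pos rfl, Real.sq_sqrt (by positivity)]
  simp [dimConst]

lemma norm_refField_le {d : ℕ} (y : Space d) : ‖refField y‖ ≤ 2 * (1 + ‖y‖)⁻¹ := by
  by_cases h : d = 2
  · subst h
    rw [refField_two, norm_smul, norm_inv, Real.norm_of_nonneg (by positivity)]
    have := norm_nonneg y
    rw [inv_mul_eq_div, ← div_eq_mul_inv, div_le_div_iff₀ (by positivity) (by positivity)]
    nlinarith [sq_nonneg (‖y‖ - 1)]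
  · rw [refField_of_ne h, norm_zero]
    positivity

lemma norm_refField_le_pow {d : ℕ} (hd : 2 ≤ d) (y : Space d) :
    ‖refField y‖ ≤ 2 * ((1 + ‖y‖) ^ (d - 1))⁻¹ := by
  by_cases h : d = 2
  · subst h
    simpa using norm_refField_le y
  · rw [refField_of_ne h, norm_zero]
    positivity

lemma half_le_norm_sub {d : ℕ} {R : ℝ} {x y : Space d} (hx : ‖x‖ ≤ R) (hy : 2 * R + 1 ≤ ‖y‖) :
    (1 + ‖y‖) / 2 ≤ ‖y - x‖ := by
  have := norm_sub_norm_le y x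
  linarith

lemma norm_gradW_far_le {d : ℕ} (hd : 2 ≤ d) {R : ℝ} {x y : Space d} (hx : ‖x‖ ≤ R)
    (hy : 2 * R + 1 ≤ ‖y‖) :
    ‖gradW (y - x)‖ ≤ dimConst d * 2 ^ (d - 1) * ((1 + ‖y‖) ^ (d - 1))⁻¹ := by
  have h := half_le_norm_sub hx hy
  have hD := (dimConst_pos hd).le
  rw [norm_gradW hd, riesz, mul_assoc]
  refine mul_le_mul_of_nonneg_left ?_ hD
  calc (‖y - x‖ ^ (d - 1))⁻¹ ≤ (((1 + ‖y‖) / 2) ^ (d - 1))⁻¹ := by gcongr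
    _ = _ := by rw [div_pow, inv_div, div_eq_mul_inv]

/-- The leading terms y/|y|² of the two fields cancel: over the common denominator |y - x|²(|y|² +
1) the numerator is only O(|y|²), which gains one power. -/
lemma norm_relField_two_far_le {R : ℝ} (hR : 0 ≤ R) {x y : Space 2} (hx : ‖x‖ ≤ R)
    (hy : 2 * R + 1 ≤ ‖y‖) :
    ‖relField x y‖ ≤ (R + (1 + R) ^ 2) * 4 * ((1 + ‖y‖) ^ 2)⁻¹ := by
  have h := half_le_norm_sub hx hy
  have hy0 := norm_nonneg y
  have ha : 0 < ‖y - x‖ := by linarith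
  set s : ℝ := ‖y‖ ^ 2 + 1 with hs
  have hs0 : 0 < s := by positivity
  have e : relField x y = (‖y - x‖ ^ 2 * s)⁻¹ • (s • (-x) + (s - ‖y - x‖ ^ 2) • y) := by
    rw [relField, refField_two, ← hs, gradW]
    have : dimConst 2 = 1 := by simp [dimConst]
    rw [this, one_mul]
    have h1 : s • (-x) + (s - ‖y - x‖ ^ 2) • y = s • (y - x) - ‖y - x‖ ^ 2 • y := by
      module
    rw [h1, smul_sub (‖y - x‖ ^ 2 * s)⁻¹, smul_smul, smul_smul]
    congr 2 <;> field_simp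
  have hnum : ‖s • (-x) + (s - ‖y - x‖ ^ 2) • y‖ ≤ s * (R + (1 + R) ^ 2) := by
    refine (norm_add_le _ _).trans ?_
    rw [norm_smul, norm_smul, norm_neg, Real.norm_of_nonneg hs0.le, Real.norm_eq_abs]
    have h2 : |s - ‖y - x‖ ^ 2| ≤ 1 + 2 * R * ‖y‖ + R ^ 2 := by
      rw [norm_sub_sq_real, hs]
      have := abs_real_inner_le_norm y x
      have h3 : ‖y‖ * ‖x‖ ≤ ‖y‖ * R := by gcongr
      have h4 : ‖x‖ ^ 2 ≤ R ^ 2 := by gcongr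
      have h5 := sq_nonneg ‖x‖
      rw [abs_le] at this ⊢
      constructor <;> nlinarith
    have h6 : |s - ‖y - x‖ ^ 2| * ‖y‖ ≤ s * (1 + R) ^ 2 := by
      calc _ ≤ (1 + 2 * R * ‖y‖ + R ^ 2) * ‖y‖ := by gcongr
        _ ≤ s * (1 + R) ^ 2 := by
          have : ‖y‖ ≤ s := by nlinarith [sq_nonneg (‖y‖ - 1)]
          have : ‖y‖ ^ 2 ≤ s := by linarith
          nlinarith [mul_nonneg hR hR, mul_le_mul_of_nonneg_left this hR,
            mul_le_mul_of_nonneg_left ‹‖y‖ ≤ s› (sq_nonneg R)]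
    have h7 : s * ‖x‖ ≤ s * R := by gcongr
    linarith
  rw [e, norm_smul, norm_inv, Real.norm_of_nonneg (by positivity)]
  calc (‖y - x‖ ^ 2 * s)⁻¹ * ‖s • (-x) + (s - ‖y - x‖ ^ 2) • y‖
      ≤ (‖y - x‖ ^ 2 * s)⁻¹ * (s * (R + (1 + R) ^ 2)) := by gcongr
    _ = (R + (1 + R) ^ 2) * (‖y - x‖ ^ 2)⁻¹ := by field_simp
    _ ≤ (R + (1 + R) ^ 2) * (((1 + ‖y‖) / 2) ^ 2)⁻¹ := by gcongr
    _ = _ := by rw [div_pow, inv_div, div_eq_mul_inv]; ring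

lemma exists_norm_relField_far_le {d : ℕ} (hd : 2 ≤ d) {R : ℝ} (hR : 0 ≤ R) :
    ∃ C : ℝ, 0 ≤ C ∧ ∀ x y : Space d, ‖x‖ ≤ R → 2 * R + 1 ≤ ‖y‖ →
      ‖relField x y‖ ≤ C * ((1 + ‖y‖) ^ decayExp d)⁻¹ := by
  by_cases h : d = 2
  · subst h
    exact ⟨(R + (1 + R) ^ 2) * 4, by positivity, fun x y hx hy => norm_relField_two_far_le hR hx hy⟩
  · refine ⟨dimConst d * 2 ^ (d - 1), mul_nonneg (dimConst_pos hd).le (by positivity),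
      fun x y hx hy => ?_⟩
    have : decayExp d = d - 1 := by unfold decayExp; omega
    rw [relField, refField_of_ne h, sub_zero, this]
    exact norm_gradW_far_le hd hx hy

/-- In dimension two this is the logarithm of |y - x|/√(|y|² + 1), a ratio that tends to 1; in
higher dimension the kernel itself decays. -/
lemma tendsto_relPot {d : ℕ} (hd : 2 ≤ d) (x : Space d) :
    Tendsto (relPot x) (Bornology.cobounded (Space d)) (𝓝 0) := by
  have h1 : Tendsto (fun y : Space d => ‖y - x‖) (Bornology.cobounded (Space d)) atTop := by
    refine tendsto_atTop_mono (f := fun y : Space d => ‖y‖ - ‖x‖) (fun y => norm_sub_norm_le y x)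
      (tendsto_atTop_add_const_right _ _ tendsto_norm_cobounded_atTop)
  rcases eq_two_or_eq_add_three hd with rfl | ⟨n, rfl⟩
  · have hs : Tendsto (fun y : Space 2 => √(‖y‖ ^ 2 + 1)) (Bornology.cobounded _) atTop := by
      refine tendsto_atTop_mono (f := fun y : Space 2 => ‖y‖) (fun y => ?_)
        tendsto_norm_cobounded_atTop
      exact Real.le_sqrt_of_sq_le (by linarith)
    have hr : Tendsto (fun y : Space 2 => ‖y - x‖ / √(‖y‖ ^ 2 + 1)) (Bornology.cobounded _)
        (𝓝 1) := by
      have hz : Tendsto (fun y : Space 2 => (‖y - x‖ - √(‖y‖ ^ 2 + 1)) / √(‖y‖ ^ 2 + 1))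
          (Bornology.cobounded _) (𝓝 0) := by
        refine squeeze_zero_norm (a := fun y : Space 2 => (‖x‖ + 1) / √(‖y‖ ^ 2 + 1)) (fun y => ?_)
          (hs.const_div_atTop _)
        rw [norm_div, Real.norm_of_nonneg (Real.sqrt_nonneg _), Real.norm_eq_abs]
        gcongr
        have h3 : ‖y‖ ≤ √(‖y‖ ^ 2 + 1) := Real.le_sqrt_of_sq_le (by linarith)
        have h4 : √(‖y‖ ^ 2 + 1) ≤ ‖y‖ + 1 :=
          Real.sqrt_le_iff.2 ⟨by positivity, by nlinarith [norm_nonneg y]⟩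
        have h5 := norm_sub_le y x
        have h6 := norm_sub_norm_le y x
        have := norm_nonneg x
        rw [abs_le]
        constructor <;> linarith
      have := hz.const_add 1
      rw [add_zero] at this
      refine this.congr fun y => ?_
      have : 0 < √(‖y‖ ^ 2 + 1) := by positivity
      field_simp
      ring
    have hl := ((Real.continuousAt_log one_ne_zero).tendsto.comp hr)
    rw [Real.log_one] at hl
    refine hl.congr' ?_
    filter_upwards [h1.eventually_gt_atTop 0] with y hy
    simp only [Function.comp, relPot, refPot, if_true, regW, coulombW_two, one_pow]
    rw [Real.log_div hy.ne' (by positivity)]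
  · have : relPot x = fun y : Space (n + 3) => coulombW (n + 3) ‖y - x‖ := by
      funext y
      rw [relPot, refPot_of_ne (by omega), sub_zero]
    rw [this]
    simp only [coulombW_add_three]
    simpa using ((tendsto_pow_atTop (n := n + 1) (by omega)).comp h1).inv_tendsto_atTop.neg

lemma hasGradientAt_coulombW {d : ℕ} (hd : 2 ≤ d) {x y : Space d} (h : y ≠ x) :
    HasGradientAt (fun y => coulombW d ‖y - x‖) (gradW (y - x)) y := by
  have hpos : 0 < ‖y - x‖ := norm_pos_iff.2 (sub_ne_zero.2 h)
  have h0 : HasFDerivAt (fun y : Space d => y - x) (ContinuousLinearMap.id ℝ (Space d)) y :=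
    (hasFDerivAt_id y).sub_const x
  have h1 : HasFDerivAt (fun y : Space d => ‖y - x‖ ^ 2) (2 • innerSL ℝ (y - x)) y := by
    refine (HasFDerivAt.comp (g := fun a : Space d => ‖a‖ ^ 2) y
      (hasStrictFDerivAt_norm_sq (y - x)).hasFDerivAt h0).congr_fderiv ?_
    ext v
    simp
  have h2 := h1.sqrt (by positivity)
  have h3 := (hasDerivAt_coulombW hd (r := √(‖y - x‖ ^ 2)) (by positivity)).comp_hasFDerivAt y h2
  rw [hasGradientAt_iff_hasFDerivAt]
  simp only [Function.comp_def, Real.sqrt_sq (norm_nonneg _)] at h3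
  refine h3.congr_fderiv ?_
  ext v
  have : ‖y - x‖ ^ d = ‖y - x‖ ^ (d - 1) * ‖y - x‖ := by
    rw [← pow_succ]; congr 1; omega
  simp only [smul_apply, innerSL_apply_apply, smul_eq_mul, nsmul_eq_mul, gradW,
    InnerProductSpace.toDual_apply_apply, inner_smul_left, this]
  simp
  field_simp

lemma hasGradientAt_relPot {d : ℕ} (hd : 2 ≤ d) {x y : Space d} (h : y ≠ x) :
    HasGradientAt (relPot x) (relField x y) y := by
  have := (hasGradientAt_coulombW hd h).hasFDerivAt.sub (hasGradientAt_refPot hd y).hasFDerivAt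
  rw [hasGradientAt_iff_hasFDerivAt, relField, map_sub]
  exact this

/-- Along almost every ray, `relPot` is differentiable and tends to zero. -/
lemma relPot_ray {d : ℕ} (hd : 2 ≤ d) {x x' : Space d} {η : ℝ} (hη : 0 ≤ η)
    (h : x = x' → 0 < η) :
    ∀ᵐ w : sphere (0 : Space d) 1 ∂(sphereMeasure d),
      ContinuousWithinAt (fun r : ℝ => relPot x' (x + r • (w : Space d))) (Ici η) η ∧
      (∀ r, η < r → HasDerivAt (fun r : ℝ => relPot x' (x + r • (w : Space d)))
        ⟪(w : Space d), relField x' (x + r • (w : Space d))⟫ r) ∧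
      Tendsto (fun r : ℝ => relPot x' (x + r • (w : Space d))) atTop (𝓝 0) := by
  -- The one direction from x towards x' is discarded; every other ray starting at radius η avoids
  -- the singularity.
  filter_upwards [sphereMeasure_ae_ne hd (‖x' - x‖⁻¹ • (x' - x))] with w hw
  have hw1 : ‖(w : Space d)‖ = 1 := by simp
  have hne : ∀ r, η ≤ r → x + r • (w : Space d) ≠ x' := by
    intro r hr heq
    have hr0 : 0 ≤ r := hη.trans hr
    have e : x' - x = r • (w : Space d) := by rw [← heq]; abel
    have hn : ‖x' - x‖ = r := by rw [e, norm_smul, hw1, mul_one, Real.norm_of_nonneg hr0]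
    rcases hr0.eq_or_lt with h0 | h0
    · have : x = x' := by
        rw [← h0, zero_smul, sub_eq_zero] at e
        exact e.symm
      linarith [h this]
    · refine hw ?_
      rw [hn, e, smul_smul, inv_mul_cancel₀ h0.ne', one_smul]
  have hder : ∀ r, η ≤ r → HasDerivAt (fun r : ℝ => relPot x' (x + r • (w : Space d)))
        ⟪(w : Space d), relField x' (x + r • (w : Space d))⟫ r := fun r hr =>
    hasDerivAt_ray (hasGradientAt_relPot hd (hne r hr))
  refine ⟨(hder η le_rfl).continuousAt.continuousWithinAt, fun r hr => hder r hr.le, ?_⟩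
  exact (tendsto_relPot hd x').comp
    (tendsto_norm_atTop_iff_cobounded.1 (tendsto_norm_ray x hw1))

lemma integrable_inv_one_add_norm_pow {d n : ℕ} (h : d < n) :
    Integrable (fun y : Space d => ((1 + ‖y‖) ^ n)⁻¹) := by
  have := integrable_one_add_norm (E := Space d) (μ := volume) (r := n) (by simpa using h)
  refine this.congr (Eventually.of_forall fun y => ?_)
  have : 0 < 1 + ‖y‖ := by positivity
  simp only
  rw [Real.rpow_neg this.le, Real.rpow_natCast]

/-- The vector field `A` has at most a Coulomb singularity at `x` and decays like `‖y‖⁻ⁿ`. -/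
structure IsDominated {d : ℕ} (t C : ℝ) (n : ℕ) (x : Space d) (A : Space d → Space d) : Prop where
  near : ∀ᵐ y, y ∈ ball (0 : Space d) t → ‖A y‖ ≤ C * riesz (y - x)
  far : ∀ y, t ≤ ‖y‖ → ‖A y‖ ≤ C * ((1 + ‖y‖) ^ n)⁻¹

/-- Lets a bounded field be counted as having a Coulomb singularity at any chosen point of the ball.
-/
lemma one_le_mul_riesz {d : ℕ} {t : ℝ} {x y : Space d} (hx : ‖x‖ ≤ t)
    (hy : y ∈ ball (0 : Space d) t) (hne : y ≠ x) : 1 ≤ (2 * t) ^ (d - 1) * riesz (y - x) := by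
  have h1 : 0 < ‖y - x‖ := norm_pos_iff.2 (sub_ne_zero.2 hne)
  have h2 : ‖y - x‖ ≤ 2 * t := by
    have := norm_sub_le y x
    have : ‖y‖ < t := by simpa using hy
    linarith
  rw [riesz, ← div_eq_mul_inv, one_le_div (by positivity)]
  gcongr

lemma ae_ne_point {d : ℕ} (hd : 2 ≤ d) (x : Space d) : ∀ᵐ y : Space d, y ≠ x := by
  have := nontrivial_space hd
  simp [ae_iff]

lemma exists_isDominated {d : ℕ} (hd : 2 ≤ d) {R : ℝ} (hR : 0 ≤ R) :
    ∃ C : ℝ, 0 ≤ C ∧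
      (∀ x : Space d, ‖x‖ ≤ R → IsDominated (2 * R + 1) C (decayExp d) x (relField x)) ∧
      (∀ x : Space d, ‖x‖ ≤ R → IsDominated (2 * R + 1) C (d - 1) x (fun y => gradW (y - x))) ∧
      ∀ x : Space d, ‖x‖ ≤ R → IsDominated (2 * R + 1) C (d - 1) x refField := by
  obtain ⟨C₁, hC₁, h₁⟩ := exists_norm_relField_far_le hd hR
  have hD := (dimConst_pos hd).le
  have ht : 0 ≤ 2 * R + 1 := by positivity
  set t := 2 * R + 1 with htd
  have hnear : ∀ x : Space d, ‖x‖ ≤ R → ∀ y ∈ ball (0 : Space d) t, y ≠ x →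
      ‖refField y‖ ≤ 2 * (2 * t) ^ (d - 1) * riesz (y - x) := by
    intro x hx y hy hne
    have h := one_le_mul_riesz (t := t) (hx.trans (by linarith)) hy hne
    have h2 : ‖refField y‖ ≤ 2 * 1 := by
      refine (norm_refField_le y).trans (mul_le_mul_of_nonneg_left ?_ zero_le_two)
      exact inv_le_one_of_one_le₀ (by linarith [norm_nonneg y])
    rw [mul_assoc]
    linarith
  have e₂ : 0 ≤ dimConst d * 2 ^ (d - 1) := by positivity
  have e₃ : 0 ≤ 2 * (2 * t) ^ (d - 1) := by positivity
  refine ⟨C₁ + dimConst d * 2 ^ (d - 1) + (dimConst d + 2 * (2 * t) ^ (d - 1)) + 2,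
    by positivity, fun x hx => ?_, fun x hx => ?_, fun x hx => ?_⟩
  · refine ⟨?_, fun y hy => ?_⟩
    · filter_upwards [ae_ne_point hd x] with y hne hy
      have h3 := hnear x hx y hy hne
      have h4 := riesz_nonneg (y - x)
      calc ‖relField x y‖ ≤ ‖gradW (y - x)‖ + ‖refField y‖ := norm_sub_le _ _
        _ ≤ dimConst d * riesz (y - x) + 2 * (2 * t) ^ (d - 1) * riesz (y - x) := by
          rw [norm_gradW hd]; gcongr
        _ = (dimConst d + 2 * (2 * t) ^ (d - 1)) * riesz (y - x) := by ring
        _ ≤ _ := mul_le_mul_of_nonneg_right (by linarith) h4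
    · exact (h₁ x y hx hy).trans (mul_le_mul_of_nonneg_right (by linarith) (by positivity))
  · refine ⟨Eventually.of_forall fun y _ => ?_, fun y hy => ?_⟩
    · rw [norm_gradW hd]
      exact mul_le_mul_of_nonneg_right (by linarith) (riesz_nonneg _)
    · exact (norm_gradW_far_le hd hx hy).trans
        (mul_le_mul_of_nonneg_right (by linarith) (by positivity))
  · refine ⟨?_, fun y _ => ?_⟩
    · filter_upwards [ae_ne_point hd x] with y hne hy
      exact (hnear x hx y hy hne).trans
        (mul_le_mul_of_nonneg_right (by linarith) (riesz_nonneg _))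
    · exact (norm_refField_le_pow hd y).trans
        (mul_le_mul_of_nonneg_right (by linarith) (by positivity))

/-- The overlap of two fields with Coulomb singularities is controlled by the Coulomb interaction
of the singular points. -/
lemma exists_lintegral_mul_le {d : ℕ} (hd : 2 ≤ d) {t : ℝ} (ht : 0 < t) {n m : ℕ} (h : d < n + m)
    {C : ℝ} (hC : 0 ≤ C) :
    ∃ C' : ℝ, 0 ≤ C' ∧ ∀ (x x' : Space d) (A A' : Space d → Space d), ‖x‖ ≤ t → ‖x'‖ ≤ t →
      x ≠ x' → IsDominated t C n x A → IsDominated t C m x' A' →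
      ∫⁻ y, ‖A y‖ₑ * ‖A' y‖ₑ ≤ ENNReal.ofReal (C' * (1 + |coulombW d ‖x - x'‖|)) := by
  obtain ⟨C₁, hC₁, h₁⟩ := exists_lintegral_riesz_mul_riesz_le hd ht
  have hfar := (integrable_inv_one_add_norm_pow h).const_mul (C ^ 2)
  set I := ∫ y : Space d, C ^ 2 * ((1 + ‖y‖) ^ (n + m))⁻¹ with hI
  have hI0 : 0 ≤ I := integral_nonneg fun y => by positivity
  refine ⟨C ^ 2 * C₁ + I, by positivity, fun x x' A A' hx hx' hne hA hA' => ?_⟩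
  have hW := abs_nonneg (coulombW d ‖x - x'‖)
  rw [← lintegral_add_compl _ (measurableSet_ball (x := (0 : Space d)) (ε := t))]
  have near : ∫⁻ y in ball 0 t, ‖A y‖ₑ * ‖A' y‖ₑ ≤
      ENNReal.ofReal (C ^ 2 * (C₁ * (1 + |coulombW d ‖x - x'‖|))) := by
    calc ∫⁻ y in ball 0 t, ‖A y‖ₑ * ‖A' y‖ₑ
        ≤ ∫⁻ y in ball 0 t, ENNReal.ofReal (C ^ 2) *
            ENNReal.ofReal (riesz (y - x) * riesz (y - x')) := by
          refine lintegral_mono_ae ?_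
          filter_upwards [ae_restrict_mem measurableSet_ball, ae_restrict_of_ae hA.near,
            ae_restrict_of_ae hA'.near] with y hy h1 h2
          rw [← ofReal_norm, ← ofReal_norm, ← ENNReal.ofReal_mul (norm_nonneg _),
            ← ENNReal.ofReal_mul (by positivity)]
          refine ENNReal.ofReal_le_ofReal ?_
          have := riesz_nonneg (y - x)
          calc ‖A y‖ * ‖A' y‖ ≤ (C * riesz (y - x)) * (C * riesz (y - x')) := by
                gcongr
                · exact h1 hy
                · exact h2 hy
            _ = _ := by ring
      _ = ENNReal.ofReal (C ^ 2) * ∫⁻ y in ball 0 t,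
            ENNReal.ofReal (riesz (y - x) * riesz (y - x')) := by
          rw [lintegral_const_mul _ (by fun_prop)]
      _ ≤ _ := by
          rw [ENNReal.ofReal_mul (by positivity)]
          gcongr
          exact h₁ x x' hx hx' hne
  have far : ∫⁻ y in (ball 0 t)ᶜ, ‖A y‖ₑ * ‖A' y‖ₑ ≤ ENNReal.ofReal I := by
    rw [hI, ofReal_integral_eq_lintegral_ofReal hfar (Eventually.of_forall fun y => by positivity)]
    refine le_trans (setLIntegral_mono' measurableSet_ball.compl fun y hy => ?_)
      (setLIntegral_le_lintegral _ _)
    have hy' : t ≤ ‖y‖ := by simpa using hy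
    rw [← ofReal_norm, ← ofReal_norm, ← ENNReal.ofReal_mul (norm_nonneg _)]
    refine ENNReal.ofReal_le_ofReal ?_
    calc ‖A y‖ * ‖A' y‖ ≤ (C * ((1 + ‖y‖) ^ n)⁻¹) * (C * ((1 + ‖y‖) ^ m)⁻¹) := by
          gcongr
          · exact hA.far y hy'
          · exact hA'.far y hy'
      _ = _ := by rw [pow_add, mul_inv]; ring
  refine (add_le_add near far).trans ?_
  rw [← ENNReal.ofReal_add (by positivity) hI0]
  refine ENNReal.ofReal_le_ofReal ?_
  nlinarith

/-- The square of a field with a Coulomb singularity is integrable away from the singularity. -/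
lemma IsDominated.integrableOn_norm_sq {d : ℕ} {t C : ℝ} (hC : 0 ≤ C)
    {n : ℕ} (h : d < n + n)
    {x : Space d} {A : Space d → Space d} (hA : IsDominated t C n x A)
    (hAm : AEStronglyMeasurable A) {η : ℝ} (hη : 0 < η) :
    IntegrableOn (fun y => ‖A y‖ ^ 2) (ball x η)ᶜ := by
  have hfar := (integrable_inv_one_add_norm_pow h).const_mul (C ^ 2)
  have hb : IntegrableOn (fun _ : Space d => (C * (η ^ (d - 1))⁻¹) ^ 2) (ball 0 t) :=
    integrableOn_const measure_ball_lt_top.ne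
  have hb' := (integrable_indicator_iff measurableSet_ball).2 hb
  refine Integrable.mono' (hfar.add hb').integrableOn (hAm.norm.pow 2).restrict ?_
  filter_upwards [ae_restrict_mem measurableSet_ball.compl, ae_restrict_of_ae hA.near] with y hy h1
  rw [Real.norm_of_nonneg (by positivity), Pi.add_apply]
  have hyx : η ≤ ‖y - x‖ := by simpa [dist_eq_norm] using hy
  by_cases hyt : y ∈ ball (0 : Space d) t
  · rw [indicator_of_mem hyt]
    have h2 : ‖A y‖ ≤ C * (η ^ (d - 1))⁻¹ := (h1 hyt).trans (by unfold riesz; gcongr)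
    have : ‖A y‖ ^ 2 ≤ (C * (η ^ (d - 1))⁻¹) ^ 2 := by gcongr
    have : 0 ≤ C ^ 2 * ((1 + ‖y‖) ^ (n + n))⁻¹ := by positivity
    linarith
  · rw [indicator_of_notMem hyt, add_zero]
    calc ‖A y‖ ^ 2 ≤ (C * ((1 + ‖y‖) ^ n)⁻¹) ^ 2 := by
          gcongr
          exact hA.far y (by simpa using hyt)
      _ = _ := by rw [mul_pow, pow_add, inv_pow, mul_inv]; ring

lemma integrable_inner_of_lintegral {α : Type*} [MeasurableSpace α] {d : ℕ} {τ : Measure α}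
    {A B : α → Space d}
    (hA : AEStronglyMeasurable A τ) (hB : AEStronglyMeasurable B τ)
    (h : ∫⁻ y, ‖A y‖ₑ * ‖B y‖ₑ ∂τ ≠ ⊤) : Integrable (fun y => ⟪A y, B y⟫) τ := by
  refine ⟨hA.inner hB, lt_of_le_of_lt (lintegral_mono fun y => ?_) h.lt_top⟩
  rw [← ofReal_norm, ← ofReal_norm, ← ofReal_norm, ← ENNReal.ofReal_mul (norm_nonneg _)]
  exact ENNReal.ofReal_le_ofReal (norm_inner_le_norm _ _)

lemma measurable_relField_right {d : ℕ} (x : Space d) : Measurable (relField x) :=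
  (measurable_gradW.comp (measurable_id.sub_const x)).sub measurable_refField

lemma integrable_inner_relField {d : ℕ} (hd : 2 ≤ d) {x x' : Space d} (h : x ≠ x') :
    Integrable (fun y => ⟪relField x y, relField x' y⟫) := by
  have hR : 0 ≤ ‖x‖ + ‖x'‖ := by positivity
  obtain ⟨C, hC, h₁, -, -⟩ := exists_isDominated hd hR
  obtain ⟨C', -, h'⟩ := exists_lintegral_mul_le hd (t := 2 * (‖x‖ + ‖x'‖) + 1) (by positivity)
    (lt_two_mul_decayExp hd) hC
  have hx : ‖x‖ ≤ ‖x‖ + ‖x'‖ := by linarith [norm_nonneg x']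
  have hx' : ‖x'‖ ≤ ‖x‖ + ‖x'‖ := by linarith [norm_nonneg x]
  exact integrable_inner_of_lintegral (measurable_relField_right x).aestronglyMeasurable
    (measurable_relField_right x').aestronglyMeasurable
    (ne_top_of_le_ne_top ENNReal.ofReal_ne_top
      (h' x x' _ _ (by linarith) (by linarith) h (h₁ x hx) (h₁ x' hx')))

lemma integrable_inner_gradW_relField {d : ℕ} (hd : 2 ≤ d) {x x' : Space d} (h : x ≠ x') :
    Integrable (fun y => ⟪gradW (y - x), relField x' y⟫) := by
  have hR : 0 ≤ ‖x‖ + ‖x'‖ := by positivity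
  obtain ⟨C, hC, h₁, h₂, -⟩ := exists_isDominated hd hR
  obtain ⟨C', -, h'⟩ := exists_lintegral_mul_le hd (t := 2 * (‖x‖ + ‖x'‖) + 1) (by positivity)
    (lt_decayExp_add hd) hC
  have hx : ‖x‖ ≤ ‖x‖ + ‖x'‖ := by linarith [norm_nonneg x']
  have hx' : ‖x'‖ ≤ ‖x‖ + ‖x'‖ := by linarith [norm_nonneg x]
  exact integrable_inner_of_lintegral (Measurable.aestronglyMeasurable (by fun_prop))
    (measurable_relField_right x').aestronglyMeasurable
    (ne_top_of_le_ne_top ENNReal.ofReal_ne_top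
      (h' x x' _ _ (by linarith) (by linarith) h (h₂ x hx) (h₁ x' hx')))

lemma integrable_inner_refField_relField {d : ℕ} (hd : 2 ≤ d) (x' : Space d) :
    Integrable (fun y => ⟪refField y, relField x' y⟫) := by
  have hnt := nontrivial_space hd
  -- The reference field has no singularity, so any point other than x' may be assigned to it in the
  -- overlap bound.
  obtain ⟨x, h⟩ := exists_ne x'
  have hR : 0 ≤ ‖x‖ + ‖x'‖ := by positivity
  obtain ⟨C, hC, h₁, -, h₃⟩ := exists_isDominated hd hR
  obtain ⟨C', -, h'⟩ := exists_lintegral_mul_le hd (t := 2 * (‖x‖ + ‖x'‖) + 1) (by positivity)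
    (lt_decayExp_add hd) hC
  have hx : ‖x‖ ≤ ‖x‖ + ‖x'‖ := by linarith [norm_nonneg x']
  have hx' : ‖x'‖ ≤ ‖x‖ + ‖x'‖ := by linarith [norm_nonneg x]
  exact integrable_inner_of_lintegral measurable_refField.aestronglyMeasurable
    (measurable_relField_right x').aestronglyMeasurable
    (ne_top_of_le_ne_top ENNReal.ofReal_ne_top
      (h' x x' _ _ (by linarith) (by linarith) h (h₃ x hx) (h₁ x' hx')))

/-- The flux identity at η = 0 with the relative potential of x' as φ. Its singularity lies away
from x, and almost every ray misses it. -/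
lemma integral_inner_gradW_relField {d : ℕ} (hd : 2 ≤ d) {x x' : Space d} (h : x ≠ x') :
    ∫ y, ⟪gradW (y - x), relField x' y⟫ = -(coulombConst d * relPot x' x) := by
  have hnt := nontrivial_space hd
  have key := integral_inner_gradW_compl_closedBall hd (x := x) (φ := relPot x')
    (G := relField x') le_rfl (integrable_inner_gradW_relField hd h).integrableOn
    (relPot_ray hd le_rfl fun h' => absurd h' h)
  have hae : ((closedBall x 0)ᶜ : Set (Space d)) =ᵐ[volume] univ := by
    rw [closedBall_zero, ae_eq_univ]; simp
  rw [setIntegral_congr_set hae, setIntegral_univ] at key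
  rw [key, coulombConst_eq]
  simp [sphereArea, Measure.real]
  ring

/-! ### Two-point pairing and renormalized self-interaction. -/

/-- The interaction of the reference field with the relative field of a point. -/
def refPairing {d : ℕ} (x : Space d) : ℝ := ∫ y, ⟪refField y, relField x y⟫

lemma integral_inner_relField_aux {d : ℕ} (hd : 2 ≤ d) {x x' : Space d} (h : x ≠ x') :
    ∫ y, ⟪relField x y, relField x' y⟫ = -(coulombConst d * relPot x' x) - refPairing x' := by
  rw [← integral_inner_gradW_relField hd h, refPairing,
    ← integral_sub (integrable_inner_gradW_relField hd h) (integrable_inner_refField_relField hd x')]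
  refine integral_congr_ae (Eventually.of_forall fun y => ?_)
  simp only [relField, inner_sub_left]

/-- The pairing of two relative fields is symmetric, while its formula treats x and x' differently.
Equating the two versions at x' = 0 shows that `refPairing` plus k_d `refPot` is constant, so the
pairing with the reference field never has to be computed. -/
lemma exists_refPairing_eq {d : ℕ} (hd : 2 ≤ d) :
    ∃ K : ℝ, (d ≠ 2 → K = 0) ∧ ∀ x : Space d, refPairing x = K - coulombConst d * refPot d x := by
  refine ⟨refPairing (0 : Space d) + coulombConst d * refPot d 0, fun h => ?_, fun x => ?_⟩
  · simp [refPairing, refField_of_ne h, refPot_of_ne h]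
  · by_cases h : x = 0
    · rw [h]; ring
    · have h1 := integral_inner_relField_aux hd h
      have h2 := integral_inner_relField_aux hd (Ne.symm h)
      simp only [real_inner_comm] at h1 h2
      have e : ∫ y, ⟪relField x y, relField (0 : Space d) y⟫ =
          ∫ y, ⟪relField (0 : Space d) y, relField x y⟫ := by
        simp only [real_inner_comm]
      rw [integral_inner_relField_aux hd h, integral_inner_relField_aux hd (Ne.symm h)] at e
      simp only [relPot, norm_sub_rev x 0] at e
      linarith

lemma integral_inner_relField {d : ℕ} (hd : 2 ≤ d) {K : ℝ}
    (hK : ∀ x : Space d, refPairing x = K - coulombConst d * refPot d x) {x x' : Space d}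
    (h : x ≠ x') :
    ∫ y, ⟪relField x y, relField x' y⟫ = -(coulombConst d * coulombW d ‖x - x'‖) +
      coulombConst d * refPot d x + coulombConst d * refPot d x' - K := by
  rw [integral_inner_relField_aux hd h, hK, relPot]
  ring

lemma tendsto_setIntegral_of_eventually_mem {d : ℕ} {f : Space d → ℝ} (hf : Integrable f)
    {s : ℝ → Set (Space d)} (hs : ∀ η, MeasurableSet (s η))
    (h : ∀ᵐ y, ∀ᶠ η in 𝓝[>] 0, y ∈ s η) :
    Tendsto (fun η => ∫ y in s η, f y) (𝓝[>] 0) (𝓝 (∫ y, f y)) := by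
  simp_rw [← integral_indicator (hs _)]
  refine tendsto_integral_filter_of_dominated_convergence (fun y => ‖f y‖)
    (Eventually.of_forall fun η => hf.aestronglyMeasurable.indicator (hs η))
    (Eventually.of_forall fun η => Eventually.of_forall fun y => norm_indicator_le_norm_self _ _)
    hf.norm ?_
  filter_upwards [h] with y hy
  refine tendsto_const_nhds.congr' ?_
  filter_upwards [hy] with η hη
  rw [indicator_of_mem hη]

lemma tendsto_integral_sphere {d : ℕ} {f : Space d → ℝ} (hf : Continuous f) (x : Space d) :
    Tendsto (fun η : ℝ => ∫ w : sphere (0 : Space d) 1, f (x + η • (w : Space d)) ∂(sphereMeasure d))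
      (𝓝[>] 0) (𝓝 (sphereArea d * f x)) := by
  obtain ⟨B, hB⟩ := (isCompact_closedBall x 1).exists_bound_of_continuousOn hf.continuousOn
  have hc : sphereArea d * f x = ∫ _w : sphere (0 : Space d) 1, f x ∂(sphereMeasure d) := by
    simp [sphereArea, Measure.real]
  rw [hc]
  refine tendsto_integral_filter_of_dominated_convergence (fun _ => B) ?_ ?_
    (integrable_const B) ?_
  · refine Eventually.of_forall fun η => Continuous.aestronglyMeasurable ?_
    fun_prop
  · filter_upwards [Ioo_mem_nhdsGT (zero_lt_one (α := ℝ))] with η hη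
    refine Eventually.of_forall fun w => hB _ ?_
    have hw1 : ‖(w : Space d)‖ = 1 := by simp
    simp only [mem_closedBall, dist_eq_norm, add_sub_cancel_left, norm_smul, hw1, mul_one,
      Real.norm_of_nonneg hη.1.le]
    exact hη.2.le
  · refine Eventually.of_forall fun w => ?_
    have : Continuous fun η : ℝ => f (x + η • (w : Space d)) := by fun_prop
    have h := this.tendsto 0
    simp only [zero_smul, add_zero] at h
    exact h.mono_left nhdsWithin_le_nhds

lemma compl_ball_ae_eq {d : ℕ} (x : Space d) {η : ℝ} (hη : 0 < η) :
    ((ball x η)ᶜ : Set (Space d)) =ᵐ[volume] (closedBall x η)ᶜ := by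
  refine EventuallyEq.compl ?_
  rw [← ball_union_sphere]
  exact (union_ae_eq_left_of_ae_eq_empty (ae_eq_empty.2 (Measure.addHaar_sphere_of_ne_zero _ _ hη.ne'))).symm

lemma integrableOn_norm_relField_sq {d : ℕ} (hd : 2 ≤ d) (x : Space d) {η : ℝ} (hη : 0 < η) :
    IntegrableOn (fun y => ‖relField x y‖ ^ 2) (ball x η)ᶜ := by
  obtain ⟨C, hC, h₁, -, -⟩ := exists_isDominated hd (norm_nonneg x)
  exact (h₁ x le_rfl).integrableOn_norm_sq hC (lt_two_mul_decayExp hd)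
    (measurable_relField_right x).aestronglyMeasurable hη

/-- The renormalized self-interaction of a point. -/
lemma tendsto_setIntegral_norm_relField_sq {d : ℕ} (hd : 2 ≤ d) {K : ℝ}
    (hK : ∀ x : Space d, refPairing x = K - coulombConst d * refPot d x) (x : Space d) :
    Tendsto (fun η => (∫ y in (ball x η)ᶜ, ‖relField x y‖ ^ 2) + coulombConst d * coulombW d η)
      (𝓝[>] 0) (𝓝 (2 * coulombConst d * refPot d x - K)) := by
  have hI := integrable_inner_refField_relField hd x
  have h1 := tendsto_integral_sphere (continuous_refPot hd) x
  have h2 := tendsto_setIntegral_of_eventually_mem hI (s := fun η => (closedBall x η)ᶜ)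
    (fun η => measurableSet_closedBall.compl) (by
      filter_upwards [ae_ne_point hd x] with y hy
      have : 0 < dist y x := dist_pos.2 hy
      filter_upwards [Ioo_mem_nhdsGT this] with η hη
      simpa using hη.2)
  have h3 := (h1.const_mul (dimConst d)).sub h2
  have e : dimConst d * (sphereArea d * refPot d x) - ∫ y, ⟪refField y, relField x y⟫ =
      2 * coulombConst d * refPot d x - K := by
    have := hK x
    rw [refPairing] at this
    rw [this, coulombConst_eq]
    ring
  rw [e] at h3
  refine h3.congr' ?_
  filter_upwards [self_mem_nhdsWithin] with η hη
  have hη0 : 0 < η := hη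
  rw [setIntegral_congr_set (compl_ball_ae_eq x hη0)]
  have hsq : IntegrableOn (fun y => ‖relField x y‖ ^ 2) (closedBall x η)ᶜ :=
    (integrableOn_norm_relField_sq hd x hη0).mono_set (compl_subset_compl.2 ball_subset_closedBall)
  -- The square is the pairing with the bare Coulomb field, which the flux identity turns into a
  -- spherical mean, minus the pairing with the reference field, which is integrable. On the sphere
  -- of radius η the mean is W(η) up to the continuous `refPot`, and the divergence cancels.
  have hdec : ∀ y, ⟪gradW (y - x), relField x y⟫ =
      ‖relField x y‖ ^ 2 + ⟪refField y, relField x y⟫ := by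
    intro y
    rw [← real_inner_self_eq_norm_sq, ← inner_add_left, relField, sub_add_cancel]
  have hg : IntegrableOn (fun y => ⟪gradW (y - x), relField x y⟫) (closedBall x η)ᶜ := by
    simp only [hdec]
    exact hsq.add hI.integrableOn
  have key := integral_inner_gradW_compl_closedBall hd (x := x) (φ := relPot x)
    (G := relField x) hη0.le hg (relPot_ray hd hη0.le fun _ => hη0)
  simp only [hdec] at key
  rw [integral_add hsq hI.integrableOn] at key
  have hrel : ∫ w : sphere (0 : Space d) 1, relPot x (x + η • (w : Space d)) ∂(sphereMeasure d) =
      sphereArea d * coulombW d η -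
        ∫ w : sphere (0 : Space d) 1, refPot d (x + η • (w : Space d)) ∂(sphereMeasure d) := by
    have hc : sphereArea d * coulombW d η =
        ∫ _w : sphere (0 : Space d) 1, coulombW d η ∂(sphereMeasure d) := by
      simp [sphereArea, Measure.real]
    have hcr := continuous_refPot hd
    have hint : Integrable (fun w : sphere (0 : Space d) 1 => refPot d (x + η • (w : Space d)))
        (sphereMeasure d) :=
      Continuous.integrable_of_hasCompactSupport (by fun_prop) (HasCompactSupport.of_compactSpace _)
    rw [hc, ← integral_sub (integrable_const _) hint]
    refine integral_congr_ae (Eventually.of_forall fun w => ?_)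
    have hw1 : ‖(w : Space d)‖ = 1 := by simp
    simp only [relPot, add_sub_cancel_left, norm_smul, hw1, mul_one, Real.norm_of_nonneg hη0.le]
  rw [hrel] at key
  rw [coulombConst_eq]
  refine Eq.trans ?_ (congrArg (· + dimConst d * sphereArea d * coulombW d η)
    (eq_sub_of_add_eq key).symm)
  ring

/-! ### The background field. -/

section

lemma IsTame.mono {d : ℕ} {ρ : Measure (Space d)} {R R' : ℝ} (h : IsTame ρ R) (hR : R ≤ R') :
    IsTame ρ R' :=
  ⟨h.bounded.mono fun _ hx => hx.trans hR, h.integrable, h.singleton, h.energy⟩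

/-- The mean of the relative fields of the points of a charge distribution. -/
def meanField {d : ℕ} (ρ : Measure (Space d)) (y : Space d) : Space d := ∫ x, relField x y ∂ρ

variable {d : ℕ} {ρ : Measure (Space d)} [IsFiniteMeasure ρ] {R : ℝ}

lemma stronglyMeasurable_meanField : StronglyMeasurable (meanField ρ) := by
  unfold meanField
  exact StronglyMeasurable.integral_prod_left (f := fun x y => relField x y)
    measurable_relField.stronglyMeasurable

lemma ae_integrable_gradW (hd : 2 ≤ d) (hρ : ∀ᵐ x ∂ρ, ‖x‖ ≤ R) :
    ∀ᵐ y : Space d, Integrable (fun x => gradW (y - x)) ρ := by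
  have h : ∀ n : ℕ, ∀ᵐ y : Space d, y ∈ closedBall (0 : Space d) n →
      Integrable (fun x => gradW (y - x)) ρ := fun n => by
    refine (ae_restrict_iff' measurableSet_closedBall).1 ?_
    exact (integrable_of_norm_le_riesz hd (k := gradW (d := d))
      (Measurable.stronglyMeasurable (by fun_prop)) (norm_gradW_le hd) hρ).prod_right_ae
  filter_upwards [ae_all_iff.2 h] with y hy
  obtain ⟨n, hn⟩ := exists_nat_ge ‖y‖
  exact hy n (by simpa using hn)

lemma ae_integrable_relField (hd : 2 ≤ d) (hρ : ∀ᵐ x ∂ρ, ‖x‖ ≤ R) :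
    ∀ᵐ y : Space d, Integrable (fun x => relField x y) ρ := by
  filter_upwards [ae_integrable_gradW hd hρ] with y hy using hy.sub (integrable_const _)

lemma meanField_ae_eq (hd : 2 ≤ d) (hρ : ∀ᵐ x ∂ρ, ‖x‖ ≤ R) :
    ∀ᵐ y : Space d, meanField ρ y = field ρ y - ρ.real univ • refField y := by
  filter_upwards [ae_integrable_gradW hd hρ] with y hy
  unfold meanField field relField
  rw [integral_sub hy (integrable_const _), integral_const]

lemma measurable_relField_left (y : Space d) : Measurable (fun x => relField x y) :=
  (measurable_gradW.comp (measurable_id.const_sub y)).sub measurable_const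

lemma measurable_overlap (x : Space d) :
    Measurable (Function.uncurry fun y x' : Space d => ‖relField x y‖ₑ * ‖relField x' y‖ₑ) := by
  have h1 : Measurable fun z : Space d × Space d => relField x z.1 :=
    (measurable_relField_right x).comp measurable_fst
  have h2 : Measurable fun z : Space d × Space d => relField z.2 z.1 :=
    (measurable_gradW.comp (measurable_fst.sub measurable_snd)).sub
      (measurable_refField.comp measurable_fst)
  exact h1.enorm.mul h2.enorm

/-- Fubini's theorem for the pairing of a vector field with `meanField`. -/
lemma integral_inner_meanField (hd : 2 ≤ d) (hρ : ∀ᵐ x ∂ρ, ‖x‖ ≤ R) {A : Space d → Space d}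
    (hA : StronglyMeasurable A)
    (hfin : ∫⁻ x, (∫⁻ y, ‖A y‖ₑ * ‖relField x y‖ₑ) ∂ρ ≠ ⊤) :
    Integrable (fun y => ⟪A y, meanField ρ y⟫) ∧
      ∫ y, ⟪A y, meanField ρ y⟫ = ∫ x, (∫ y, ⟪A y, relField x y⟫) ∂ρ := by
  have hAm : StronglyMeasurable fun z : Space d × Space d => A z.2 :=
    hA.comp_measurable measurable_snd
  have h : Integrable (fun z : Space d × Space d => ⟪A z.2, relField z.1 z.2⟫)
      (ρ.prod volume) := by
    refine integrable_inner_of_lintegral hAm.aestronglyMeasurable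
      measurable_relField.aestronglyMeasurable ?_
    have hm : Measurable fun z : Space d × Space d => ‖A z.2‖ₑ * ‖relField z.1 z.2‖ₑ :=
      hAm.enorm.mul measurable_relField.enorm
    rwa [lintegral_prod _ hm.aemeasurable]
  have e : ∀ᵐ y : Space d, ∫ x, ⟪A y, relField x y⟫ ∂ρ = ⟪A y, meanField ρ y⟫ := by
    filter_upwards [ae_integrable_relField hd hρ] with y hy
    rw [meanField, integral_inner hy]
  refine ⟨h.integral_prod_right.congr e, ?_⟩
  rw [integral_integral_swap (f := fun x y => ⟪A y, relField x y⟫) h]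
  exact (integral_congr_ae e).symm

lemma exists_lintegral_relField_le (hd : 2 ≤ d) (hR : 0 ≤ R) :
    ∃ C : ℝ, 0 ≤ C ∧ ∀ x x' : Space d, ‖x‖ ≤ R → ‖x'‖ ≤ R → x ≠ x' →
      ∫⁻ y, ‖relField x y‖ₑ * ‖relField x' y‖ₑ ≤
        ENNReal.ofReal (C * (1 + |coulombW d ‖x - x'‖|)) := by
  obtain ⟨C, hC, h₁, -, -⟩ := exists_isDominated hd hR
  obtain ⟨C', hC', h'⟩ := exists_lintegral_mul_le hd (t := 2 * R + 1) (by positivity)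
    (lt_two_mul_decayExp hd) hC
  exact ⟨C', hC', fun x x' hx hx' hne =>
    h' x x' _ _ (by linarith) (by linarith) hne (h₁ x hx) (h₁ x' hx')⟩

lemma IsTame.ae_ne {ρ : Measure (Space d)} (hρ : IsTame ρ R) (x : Space d) : ∀ᵐ x' ∂ρ, x ≠ x' := by
  have : ∀ᵐ x' ∂ρ, x' ≠ x := by
    rw [ae_iff]
    simpa using hρ.singleton x
  filter_upwards [this] with x' hx' using hx'.symm

lemma IsTame.integrable_refPot (hd : 2 ≤ d) (hρ : IsTame ρ R) : Integrable (refPot d) ρ := by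
  obtain ⟨B, hB⟩ := (isCompact_closedBall (0 : Space d) R).exists_bound_of_continuousOn
    (continuous_refPot hd).continuousOn
  refine Integrable.mono' (integrable_const B) (continuous_refPot hd).aestronglyMeasurable ?_
  filter_upwards [hρ.bounded] with x hx using hB x (by simpa using hx)

/-- The two-point identity integrated over x' against ρ. Overlaps are controlled by 1 + |W(|x -
x'|)|, integrable because the potential is finite at x; coincidences x' = x are null since ρ has no
atoms. -/
lemma IsTame.integral_inner_relField_meanField (hd : 2 ≤ d) (hR : 0 ≤ R) (hρ : IsTame ρ R) {K : ℝ}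
    (hK : ∀ x : Space d, refPairing x = K - coulombConst d * refPot d x) {x : Space d}
    (hx : ‖x‖ ≤ R) :
    Integrable (fun y => ⟪relField x y, meanField ρ y⟫) ∧
      ∫ y, ⟪relField x y, meanField ρ y⟫ = -(coulombConst d * pot ρ x) +
        coulombConst d * refPot d x * ρ.real univ + coulombConst d * (∫ x', refPot d x' ∂ρ) -
        K * ρ.real univ := by
  obtain ⟨C, hC, hCb⟩ := exists_lintegral_relField_le hd hR
  have hfin : ∫⁻ x', (∫⁻ y, ‖relField x y‖ₑ * ‖relField x' y‖ₑ) ∂ρ ≠ ⊤ := by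
    have hi : Integrable (fun x' => C * (1 + |coulombW d ‖x - x'‖|)) ρ :=
      ((integrable_const 1).add (hρ.integrable x).abs).const_mul C
    refine ne_top_of_le_ne_top hi.lintegral_lt_top.ne (lintegral_mono_ae ?_)
    filter_upwards [hρ.bounded, hρ.ae_ne x] with x' h1 h2 using hCb x x' hx h1 h2
  obtain ⟨h1, h2⟩ := integral_inner_meanField hd hρ.bounded
    (measurable_relField_right x).stronglyMeasurable hfin
  refine ⟨h1, ?_⟩
  have hw := hρ.integrable_refPot hd
  have e : ∀ᵐ x' ∂ρ, ∫ y, ⟪relField x y, relField x' y⟫ =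
      -(coulombConst d * coulombW d ‖x - x'‖) + coulombConst d * refPot d x +
        coulombConst d * refPot d x' - K := by
    filter_upwards [hρ.ae_ne x] with x' h using integral_inner_relField hd hK h
  have i1 : Integrable (fun x' => -(coulombConst d * coulombW d ‖x - x'‖)) ρ :=
    ((hρ.integrable x).const_mul _).neg
  have i2 : Integrable (fun x' => -(coulombConst d * coulombW d ‖x - x'‖) +
      coulombConst d * refPot d x) ρ := i1.add (integrable_const _)
  have i3 : Integrable (fun x' => coulombConst d * refPot d x') ρ := hw.const_mul _
  have i4 : Integrable (fun x' => -(coulombConst d * coulombW d ‖x - x'‖) +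
      coulombConst d * refPot d x + coulombConst d * refPot d x') ρ := i2.add i3
  rw [h2, integral_congr_ae e, integral_sub i4 (integrable_const _), integral_add i2 i3,
    integral_add i1 (integrable_const _), integral_neg, pot]
  simp only [integral_const_mul, integral_const, smul_eq_mul]
  ring

/-- A second integration over x against ρ. Fubini's theorem now rests on the finite energy of ρ,
through the same overlap bound. -/
lemma IsTame.integral_norm_meanField_sq (hd : 2 ≤ d) (hR : 0 ≤ R) (hρ : IsTame ρ R) {K : ℝ}
    (hK : ∀ x : Space d, refPairing x = K - coulombConst d * refPot d x) :
    Integrable (fun y => ⟪meanField ρ y, meanField ρ y⟫) ∧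
      ∫ y, ⟪meanField ρ y, meanField ρ y⟫ =
        -(coulombConst d * ∫ z, coulombW d ‖z.1 - z.2‖ ∂(ρ.prod ρ)) +
        2 * coulombConst d * (∫ x, refPot d x ∂ρ) * ρ.real univ - K * ρ.real univ ^ 2 := by
  obtain ⟨C, hC, hCb⟩ := exists_lintegral_relField_le hd hR
  have hi : Integrable (fun z : Space d × Space d => C * (1 + |coulombW d ‖z.1 - z.2‖|))
      (ρ.prod ρ) := ((integrable_const 1).add hρ.energy.abs).const_mul C
  have hfin : ∫⁻ x, (∫⁻ y, ‖meanField ρ y‖ₑ * ‖relField x y‖ₑ) ∂ρ ≠ ⊤ := by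
    refine ne_top_of_le_ne_top hi.lintegral_lt_top.ne ?_
    rw [lintegral_prod _ (Measurable.aemeasurable (by fun_prop))]
    refine lintegral_mono_ae ?_
    filter_upwards [hρ.bounded] with x hx
    calc ∫⁻ y, ‖meanField ρ y‖ₑ * ‖relField x y‖ₑ
        ≤ ∫⁻ y, ∫⁻ x', ‖relField x y‖ₑ * ‖relField x' y‖ₑ ∂ρ := by
          refine lintegral_mono fun y => ?_
          rw [lintegral_const_mul _ (measurable_relField_left y).enorm, mul_comm]
          exact mul_le_mul_right (enorm_integral_le_lintegral_enorm _) _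
      _ = ∫⁻ x', (∫⁻ y, ‖relField x y‖ₑ * ‖relField x' y‖ₑ) ∂ρ := by
          exact lintegral_lintegral_swap (measurable_overlap x).aemeasurable
      _ ≤ _ := by
          refine lintegral_mono_ae ?_
          filter_upwards [hρ.bounded, hρ.ae_ne x] with x' h1 h2 using hCb x x' hx h1 h2
  obtain ⟨h1, h2⟩ := integral_inner_meanField hd hρ.bounded stronglyMeasurable_meanField hfin
  refine ⟨h1, ?_⟩
  have hw := hρ.integrable_refPot hd
  have hp : Integrable (fun x => pot ρ x) ρ := hρ.energy.integral_prod_left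
  have hpe : ∫ x, pot ρ x ∂ρ = ∫ z, coulombW d ‖z.1 - z.2‖ ∂(ρ.prod ρ) :=
    (integral_prod _ hρ.energy).symm
  have e : ∀ᵐ x ∂ρ, ∫ y, ⟪meanField ρ y, relField x y⟫ = -(coulombConst d * pot ρ x) +
        coulombConst d * refPot d x * ρ.real univ + (coulombConst d * (∫ x', refPot d x' ∂ρ) -
        K * ρ.real univ) := by
    filter_upwards [hρ.bounded] with x hx
    have := (hρ.integral_inner_relField_meanField hd hR hK hx).2
    rw [add_sub_assoc] at this
    rw [← this]
    exact integral_congr_ae (Eventually.of_forall fun y => real_inner_comm _ _)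
  have i1 : Integrable (fun x => -(coulombConst d * pot ρ x)) ρ := (hp.const_mul _).neg
  have i2 : Integrable (fun x => coulombConst d * refPot d x * ρ.real univ) ρ :=
    (hw.const_mul _).mul_const _
  have i3 : Integrable (fun x => -(coulombConst d * pot ρ x) +
        coulombConst d * refPot d x * ρ.real univ) ρ := i1.add i2
  rw [h2, integral_congr_ae e, integral_add i3 (integrable_const _), integral_add i1 i2,
    integral_neg]
  simp only [integral_const_mul, integral_mul_const, integral_const, smul_eq_mul, hpe]
  ring

end

/-! ### Renormalized energy of point charges in the background. -/

section

lemma measurableSet_compl_iUnion_ball {d N : ℕ} (x : Fin N → Space d) (η : ℝ) :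
    MeasurableSet (⋃ i, ball (x i) η)ᶜ :=
  (MeasurableSet.iUnion fun _ => measurableSet_ball).compl

lemma ae_eventually_mem_compl {d N : ℕ} (hd : 2 ≤ d) (x : Fin N → Space d) :
    ∀ᵐ y : Space d, ∀ᶠ η in 𝓝[>] (0 : ℝ), y ∈ (⋃ i, ball (x i) η)ᶜ := by
  filter_upwards [ae_all_iff.2 fun i => ae_ne_point hd (x i)] with y hy
  have : ∀ i, ∀ᶠ η in 𝓝[>] (0 : ℝ), η ≤ dist y (x i) := fun i => by
    filter_upwards [Ioo_mem_nhdsGT (dist_pos.2 (hy i))] with η hη using hη.2.le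
  filter_upwards [eventually_all.2 this] with η hη
  simpa using hη

/-- The renormalized self-interaction of one of several points. -/
lemma tendsto_setIntegral_norm_relField_sq_iUnion {d N : ℕ} (hd : 2 ≤ d) {K : ℝ}
    (hK : ∀ x : Space d, refPairing x = K - coulombConst d * refPot d x) {x : Fin N → Space d}
    (hx : Function.Injective x) (i : Fin N) :
    Tendsto (fun η => (∫ y in (⋃ j, ball (x j) η)ᶜ, ‖relField (x i) y‖ ^ 2) +
      coulombConst d * coulombW d η) (𝓝[>] 0) (𝓝 (2 * coulombConst d * refPot d (x i) - K)) := by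
  -- Below half the distances to the other points, the balls around those points stay outside the
  -- δ-ball around x_i. There the square of the relative field of x_i is integrable, so removing
  -- these shrinking balls changes nothing in the limit.
  obtain ⟨δ, hδ, hδ0⟩ : ∃ δ : ℝ, (∀ j, j ≠ i → δ < dist (x j) (x i) / 2) ∧ 0 < δ := by
    have h : ∀ j, ∀ᶠ δ in 𝓝[>] (0 : ℝ), j ≠ i → δ < dist (x j) (x i) / 2 := fun j => by
      by_cases hj : j = i
      · exact Eventually.of_forall fun δ h => absurd hj h
      · filter_upwards [Ioo_mem_nhdsGT (half_pos (dist_pos.2 (hx.ne hj)))] with η hη _ using hη.2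
    exact ((eventually_all.2 h).and self_mem_nhdsWithin).exists
  set f : Space d → ℝ := (ball (x i) δ)ᶜ.indicator fun y => ‖relField (x i) y‖ ^ 2 with hf
  have hfi : Integrable f :=
    (integrableOn_norm_relField_sq hd (x i) hδ0).integrable_indicator measurableSet_ball.compl
  set S : ℝ → Set (Space d) := fun η => (ball (x i) η)ᶜ \ (⋃ j, ball (x j) η)ᶜ with hS
  have hSm : ∀ η, MeasurableSet (S η) := fun η =>
    measurableSet_ball.compl.diff (measurableSet_compl_iUnion_ball x η)
  have hlim : Tendsto (fun η => ∫ y in S η, f y) (𝓝[>] 0) (𝓝 0) := by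
    have h := tendsto_setIntegral_of_eventually_mem hfi (s := fun η => (S η)ᶜ)
      (fun η => (hSm η).compl) (by
        filter_upwards [ae_eventually_mem_compl hd x] with y hy
        filter_upwards [hy] with η hη
        exact fun h' => h'.2 hη)
    have h' := h.const_sub (∫ y, f y)
    rw [sub_self] at h'
    refine h'.congr fun η => ?_
    rw [← integral_add_compl (hSm η) hfi]
    ring
  have h2 := (tendsto_setIntegral_norm_relField_sq hd hK (x i)).sub hlim
  rw [sub_zero] at h2
  refine h2.congr' ?_
  filter_upwards [Ioo_mem_nhdsGT hδ0] with η hη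
  have hsub : (⋃ j, ball (x j) η)ᶜ ⊆ (ball (x i) η)ᶜ :=
    compl_subset_compl.2 (subset_iUnion (fun j => ball (x j) η) i)
  have hint := integrableOn_norm_relField_sq hd (x i) hη.1
  have hdiff := setIntegral_sdiff (measurableSet_compl_iUnion_ball x η) hint hsub
  have hSf : ∫ y in S η, f y = ∫ y in S η, ‖relField (x i) y‖ ^ 2 := by
    refine setIntegral_congr_fun (hSm η) fun y hy => ?_
    have h1 : η ≤ dist y (x i) := by simpa using hy.1
    have h3 : ∃ j, dist y (x j) < η := by simpa using hy.2
    obtain ⟨j, hj⟩ := h3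
    have hji : j ≠ i := by
      rintro rfl
      linarith
    have h4 := hδ j hji
    have h5 := dist_triangle_left (x j) (x i) y
    have : y ∈ (ball (x i) δ)ᶜ := by
      simp only [mem_compl_iff, mem_ball, not_lt]
      linarith [hη.2]
    rw [hf, indicator_of_mem this]
  rw [hSf]
  simp only [hS]
  rw [hdiff]
  ring

variable {d N : ℕ} {ρ : Measure (Space d)} [IsFiniteMeasure ρ] {R : ℝ}

/-- The Coulomb field of the point charges `q i` at `x i` minus that of `c` times `ρ`. -/
def excessField (q : Fin N → ℝ) (x : Fin N → Space d) (c : ℝ) (ρ : Measure (Space d))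
    (y : Space d) : Space d :=
  ∑ i, q i • gradW (y - x i) - c • field ρ y

/-- The reference fields enter with the total charge as coefficient. In dimension two neutrality
cancels them; in higher dimension they are zero. -/
lemma excessField_ae_eq (hd : 2 ≤ d) (hρ : ∀ᵐ x ∂ρ, ‖x‖ ≤ R) (q : Fin N → ℝ)
    (x : Fin N → Space d) (c : ℝ) (hneutral : d = 2 → ∑ i, q i = c * ρ.real univ) :
    ∀ᵐ y, excessField q x c ρ y = ∑ i, q i • relField (x i) y - c • meanField ρ y := by
  filter_upwards [meanField_ae_eq hd hρ] with y hy
  have h0 : (∑ i, q i) • refField y = (c * ρ.real univ) • refField y := by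
    by_cases h : d = 2
    · rw [hneutral h]
    · rw [refField_of_ne h, smul_zero, smul_zero]
  rw [hy, excessField]
  simp only [relField, smul_sub, Finset.sum_sub_distrib, ← Finset.sum_smul, h0, smul_smul]
  abel

lemma norm_sub_smul_sq (q : Fin N → ℝ) (v : Fin N → Space d) (c : ℝ) (m : Space d) :
    ‖∑ i, q i • v i - c • m‖ ^ 2 = ∑ i, q i ^ 2 * ‖v i‖ ^ 2 +
      (∑ i, ∑ j ∈ Finset.univ.erase i, q i * q j * ⟪v i, v j⟫ -
        2 * c * ∑ i, q i * ⟪v i, m⟫ + c ^ 2 * ⟪m, m⟫) := by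
  have h1 : ⟪∑ i, q i • v i, ∑ i, q i • v i⟫ = ∑ i, q i ^ 2 * ‖v i‖ ^ 2 +
      ∑ i, ∑ j ∈ Finset.univ.erase i, q i * q j * ⟪v i, v j⟫ := by
    rw [sum_inner, ← Finset.sum_add_distrib]
    refine Finset.sum_congr rfl fun i _ => ?_
    rw [inner_sum, ← Finset.add_sum_erase _ _ (Finset.mem_univ i)]
    congr 1
    · rw [real_inner_smul_left, real_inner_smul_right, real_inner_self_eq_norm_sq]
      ring
    · refine Finset.sum_congr rfl fun j _ => ?_
      rw [real_inner_smul_left, real_inner_smul_right]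
      ring
  rw [norm_sub_sq_real, ← real_inner_self_eq_norm_sq, h1, ← real_inner_self_eq_norm_sq (c • m),
    real_inner_smul_right, real_inner_smul_right, real_inner_smul_left, sum_inner]
  simp only [real_inner_smul_left]
  ring

/-- The renormalized self-terms 2k w_i - K are the pair terms at i = j without the kernel, so the
terms in w and K complete to double sums over all pairs and factor through the total charge. -/
lemma sum_self_add_sum_erase (q w : Fin N → ℝ) (U : Fin N → Fin N → ℝ) (k K : ℝ) :
    ∑ i, q i ^ 2 * (2 * k * w i - K) + ∑ i, ∑ j ∈ Finset.univ.erase i, q i * q j *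
      (-(k * U i j) + k * w i + k * w j - K) =
    -k * (∑ i, ∑ j ∈ Finset.univ.erase i, q i * q j * U i j) +
      2 * k * (∑ i, q i) * (∑ i, q i * w i) - K * (∑ i, q i) ^ 2 := by
  have h1 : ∀ i, q i ^ 2 * (2 * k * w i - K) + ∑ j ∈ Finset.univ.erase i, q i * q j *
      (-(k * U i j) + k * w i + k * w j - K) =
      -k * (∑ j ∈ Finset.univ.erase i, q i * q j * U i j) +
        ∑ j, q i * q j * (k * w i + k * w j - K) := by
    intro i
    rw [← Finset.add_sum_erase _ _ (Finset.mem_univ i), Finset.mul_sum, add_left_comm,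
      ← Finset.sum_add_distrib]
    congr 1
    · ring
    · exact Finset.sum_congr rfl fun j _ => by ring
  have h2 : ∀ i, ∑ j, q i * q j * (k * w i + k * w j - K) =
      k * (∑ j, q j) * (q i * w i) + (k * (∑ j, q j * w j) - K * ∑ j, q j) * q i := by
    intro i
    simp only [Finset.mul_sum, Finset.sum_mul, ← Finset.sum_sub_distrib, ← Finset.sum_add_distrib]
    exact Finset.sum_congr rfl fun j _ => by ring
  rw [← Finset.sum_add_distrib]
  simp only [h1, h2, Finset.sum_add_distrib, ← Finset.mul_sum]
  ring

/-- The renormalized energy of the Coulomb field of point charges in a background. -/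
lemma hasRenormalizedEnergy_excessField (hd : 2 ≤ d) (hR : 0 ≤ R) (hρ : IsTame ρ R)
    {q : Fin N → ℝ} {x : Fin N → Space d} {c : ℝ} (hx : Function.Injective x)
    (hxR : ∀ i, ‖x i‖ ≤ R) (hneutral : d = 2 → ∑ i, q i = c * ρ.real univ)
    {G : Space d → Space d} (hG : G =ᵐ[volume] excessField q x c ρ) :
    HasRenormalizedEnergy q x G (fun _ => 1)
      (coulombConst d * (-(∑ i, ∑ j ∈ Finset.univ.erase i, q i * q j * coulombW d ‖x i - x j‖) +
        2 * c * ∑ i, q i * pot ρ (x i) -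
        c ^ 2 * ∫ z, coulombW d ‖z.1 - z.2‖ ∂(ρ.prod ρ))) := by
  obtain ⟨K, hK0, hK⟩ := exists_refPairing_eq hd
  set reg : Space d → ℝ := fun y =>
    ∑ i, ∑ j ∈ Finset.univ.erase i, q i * q j * ⟪relField (x i) y, relField (x j) y⟫ -
        2 * c * ∑ i, q i * ⟪relField (x i) y, meanField ρ y⟫ +
        c ^ 2 * ⟪meanField ρ y, meanField ρ y⟫ with hreg
  have hGsq : ∀ᵐ y, (1 : ℝ) * ‖G y‖ ^ 2 = ∑ i, q i ^ 2 * ‖relField (x i) y‖ ^ 2 + reg y := by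
    filter_upwards [hG, excessField_ae_eq hd hρ.bounded q x c hneutral] with y h1 h2
    rw [one_mul, h1, h2, norm_sub_smul_sq]
  have i1 : ∀ i, ∀ j ∈ Finset.univ.erase i,
      Integrable (fun y => q i * q j * ⟪relField (x i) y, relField (x j) y⟫) := fun i j hj =>
    (integrable_inner_relField hd (hx.ne (Finset.ne_of_mem_erase hj).symm)).const_mul _
  have i2 : ∀ i, Integrable (fun y => q i * ⟪relField (x i) y, meanField ρ y⟫) := fun i =>
    (hρ.integral_inner_relField_meanField hd hR hK (hxR i)).1.const_mul _
  have i3 := (hρ.integral_norm_meanField_sq hd hR hK).1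
  have s1 : Integrable (fun y => ∑ i, ∑ j ∈ Finset.univ.erase i,
      q i * q j * ⟪relField (x i) y, relField (x j) y⟫) :=
    integrable_finsetSum _ fun i _ => integrable_finsetSum _ (i1 i)
  have s2 : Integrable (fun y => 2 * c * ∑ i, q i * ⟪relField (x i) y, meanField ρ y⟫) :=
    (integrable_finsetSum _ fun i _ => i2 i).const_mul _
  have s3 : Integrable (fun y => c ^ 2 * ⟪meanField ρ y, meanField ρ y⟫) := i3.const_mul _
  have s12 : Integrable (fun y => ∑ i, ∑ j ∈ Finset.univ.erase i,
      q i * q j * ⟪relField (x i) y, relField (x j) y⟫ -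
      2 * c * ∑ i, q i * ⟪relField (x i) y, meanField ρ y⟫) := s1.sub s2
  have hregi : Integrable reg := s12.add s3
  set J := ∫ x, refPot d x ∂ρ with hJ
  set M := ρ.real univ with hM
  have hregv : ∫ y, reg y = ∑ i, ∑ j ∈ Finset.univ.erase i, q i * q j *
      (-(coulombConst d * coulombW d ‖x i - x j‖) + coulombConst d * refPot d (x i) +
        coulombConst d * refPot d (x j) - K) -
      2 * c * ∑ i, q i * (-(coulombConst d * pot ρ (x i)) +
        coulombConst d * refPot d (x i) * M + coulombConst d * J - K * M) +
      c ^ 2 * (-(coulombConst d * ∫ z, coulombW d ‖z.1 - z.2‖ ∂(ρ.prod ρ)) +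
        2 * coulombConst d * J * M - K * M ^ 2) := by
    have r1 : ∫ y, ∑ i, ∑ j ∈ Finset.univ.erase i,
        q i * q j * ⟪relField (x i) y, relField (x j) y⟫ =
        ∑ i, ∑ j ∈ Finset.univ.erase i, q i * q j *
          (-(coulombConst d * coulombW d ‖x i - x j‖) + coulombConst d * refPot d (x i) +
          coulombConst d * refPot d (x j) - K) := by
      rw [integral_finsetSum _ (fun i _ => integrable_finsetSum _ (i1 i))]
      refine Finset.sum_congr rfl fun i _ => ?_
      rw [integral_finsetSum _ (i1 i)]
      refine Finset.sum_congr rfl fun j hj => ?_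
      rw [integral_const_mul,
        integral_inner_relField hd hK (hx.ne (Finset.ne_of_mem_erase hj).symm)]
    have r2 : ∫ y, ∑ i, q i * ⟪relField (x i) y, meanField ρ y⟫ =
        ∑ i, q i * (-(coulombConst d * pot ρ (x i)) +
        coulombConst d * refPot d (x i) * M + coulombConst d * J - K * M) := by
      rw [integral_finsetSum _ (fun i _ => i2 i)]
      refine Finset.sum_congr rfl fun i _ => ?_
      rw [integral_const_mul, (hρ.integral_inner_relField_meanField hd hR hK (hxR i)).2]
    rw [hreg, integral_add s12 s3, integral_sub s1 s2, integral_const_mul, integral_const_mul,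
      (hρ.integral_norm_meanField_sq hd hR hK).2, r1, r2]
  have hsq : ∀ η, 0 < η → ∀ i, IntegrableOn (fun y => q i ^ 2 * ‖relField (x i) y‖ ^ 2)
      (⋃ j, ball (x j) η)ᶜ := fun η hη i =>
    ((integrableOn_norm_relField_sq hd (x i) hη).mono_set
      (compl_subset_compl.2 (subset_iUnion (fun j => ball (x j) η) i))).const_mul _
  refine ⟨fun η hη => ?_, ?_⟩
  · have : IntegrableOn (fun y => ∑ i, q i ^ 2 * ‖relField (x i) y‖ ^ 2 + reg y)
        (⋃ j, ball (x j) η)ᶜ :=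
      (integrable_finsetSum _ fun i _ => hsq η hη i).add hregi.integrableOn
    refine Integrable.congr this ?_
    filter_upwards [ae_restrict_of_ae hGsq] with y hy using hy.symm
  · have h1 := tendsto_finsetSum Finset.univ fun i _ =>
      (tendsto_setIntegral_norm_relField_sq_iUnion hd hK hx i).const_mul (q i ^ 2)
    have h2 := tendsto_setIntegral_of_eventually_mem hregi
      (measurableSet_compl_iUnion_ball x) (ae_eventually_mem_compl hd x)
    have h3 := h1.add h2
    have key : ∑ i, q i ^ 2 * (2 * coulombConst d * refPot d (x i) - K) + ∫ y, reg y =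
        coulombConst d * (-(∑ i, ∑ j ∈ Finset.univ.erase i, q i * q j * coulombW d ‖x i - x j‖) +
        2 * c * ∑ i, q i * pot ρ (x i) -
        c ^ 2 * ∫ z, coulombW d ‖z.1 - z.2‖ ∂(ρ.prod ρ)) := by
      -- All leftovers from the reference field contain the excess charge as a factor. It vanishes
      -- in dimension two; otherwise `refPot` and K vanish.
      have hw : (∑ i, q i - c * M) * (∑ i, q i * refPot d (x i) - c * J) = 0 := by
        by_cases h : d = 2
        · rw [hneutral h, sub_self, zero_mul]
        · simp [hJ, refPot_of_ne h]
      have hk : K * (∑ i, q i - c * M) = 0 := by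
        by_cases h : d = 2
        · rw [hneutral h, sub_self, mul_zero]
        · rw [hK0 h, zero_mul]
      have hlin : ∑ i, q i * (-(coulombConst d * pot ρ (x i)) +
          coulombConst d * refPot d (x i) * M + coulombConst d * J - K * M) =
          -coulombConst d * (∑ i, q i * pot ρ (x i)) +
          coulombConst d * M * (∑ i, q i * refPot d (x i)) +
          (coulombConst d * J - K * M) * ∑ i, q i := by
        simp only [Finset.mul_sum, ← Finset.sum_add_distrib]
        exact Finset.sum_congr rfl fun i _ => by ring
      rw [hregv, ← add_assoc, ← add_sub_assoc, sum_self_add_sum_erase, hlin]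
      linear_combination 2 * coulombConst d * hw - (∑ i, q i - c * M) * hk
    rw [key] at h3
    refine h3.congr' ?_
    filter_upwards [self_mem_nhdsWithin] with η hη
    have hη0 : 0 < η := hη
    rw [integral_congr_ae (ae_restrict_of_ae hGsq),
      integral_add (integrable_finsetSum _ fun i _ => hsq η hη0 i) hregi.integrableOn,
      integral_finsetSum _ fun i _ => hsq η hη0 i]
    simp only [integral_const_mul, one_mul, mul_add, Finset.sum_add_distrib, ← Finset.sum_mul]
    ring

end

/-! ### Ground levels, their mean, and the correction term. -/

section minimizer

variable {d : ℕ} {qmin qmax : ℝ} {ν : Measure ℝ} {g : ℝ → ℝ} {m M : ℝ}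
  {μ : Measure (ℝ × Space d)}

lemma stronglyMeasurable_pot (ρ : Measure (Space d)) [SFinite ρ] : StronglyMeasurable (pot ρ) := by
  unfold pot
  exact StronglyMeasurable.integral_prod_right (f := fun x x' : Space d => coulombW d ‖x - x'‖)
    (Measurable.stronglyMeasurable (by fun_prop))

/-- The ground level of the reduced potential `s |y|² / 2 - P(y)`. -/
def reducedLevel (ρ : Measure (Space d)) (s : ℝ) : ℝ := ⨅ y : Space d, (s / 2 * ‖y‖ ^ 2 - pot ρ y)

lemma groundLevel_eq (hpos : ∀ᵐ p ∂μ, 0 < p.1) {t : ℝ} (ht : 0 ≤ t) :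
    groundLevel g μ t = t * reducedLevel (chargeMeasure μ) (g t) := by
  rw [groundLevel, reducedLevel, Real.mul_iInf_of_nonneg ht]
  simp only [zetaRaw_eq hpos]

/-- Monotonicity supplies the measurability of the ground level, which is an infimum over
uncountably many positions. -/
lemma monotoneOn_reducedLevel (hd : 2 ≤ d) {ρ : Measure (Space d)} [IsFiniteMeasure ρ]
    (hn : Integrable (fun x => ‖x‖) ρ) (hm : 0 < m) : MonotoneOn (reducedLevel ρ) (Ici m) := by
  obtain ⟨B, hB⟩ := exists_le_confined_pot hd hn hm
  intro s hs t _ hst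
  refine ciInf_mono ⟨B, ?_⟩ fun y => ?_
  · rintro _ ⟨y, rfl⟩
    exact hB s hs y
  · gcongr

lemma aemeasurable_groundLevel (hd : 2 ≤ d) (hq : 0 < qmin) (hν : ν (Icc qmin qmax)ᶜ = 0)
    (hg : AEMeasurable g ν) (hm : 0 < m) (hgm : ∀ t ∈ Icc qmin qmax, m ≤ g t)
    (hpos : ∀ᵐ p ∂μ, 0 < p.1) [IsFiniteMeasure (chargeMeasure μ)]
    (hn : Integrable (fun x => ‖x‖) (chargeMeasure μ)) : AEMeasurable (groundLevel g μ) ν := by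
  -- Cutting at m, where g never goes below on Q, makes the level monotone on the whole line and
  -- hence measurable.
  have hmono : Monotone fun s => reducedLevel (chargeMeasure μ) (max s m) := fun s t hst =>
    monotoneOn_reducedLevel hd hn hm (mem_Ici.2 (le_max_right s m)) (mem_Ici.2 (le_max_right t m))
      (max_le_max_right m hst)
  refine (aemeasurable_id.mul (hmono.measurable.comp_aemeasurable hg)).congr ?_
  have : ∀ᵐ t ∂ν, t ∈ Icc qmin qmax := by rw [ae_iff]; exact hν
  filter_upwards [this] with t ht
  simp only [Pi.mul_apply, Function.comp_apply, id_eq]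
  rw [groundLevel_eq hpos (hq.le.trans ht.1), max_eq_left (hgm t ht)]

/-- The mean ground level is half the confinement energy minus the interaction energy. -/
lemma IsEnergyMinimizer.integral_groundLevel (hd : 2 ≤ d) (hq : 0 < qmin)
    (hν : ν (Icc qmin qmax)ᶜ = 0) (hg : AEMeasurable g ν) (hm : 0 < m)
    (hgm : ∀ t ∈ Icc qmin qmax, m ≤ g t ∧ g t ≤ M) (hμ : IsEnergyMinimizer g ν μ) :
    ∫ t, groundLevel g μ t ∂ν = (∫ p, p.1 * g p.1 * confV p.2 ∂μ) / 2 -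
      ∫ z, z.1.1 * z.2.1 * coulombW d ‖z.1.2 - z.2.2‖ ∂(μ.prod μ) := by
  have hp : IsProbabilityMeasure μ := hμ.1.1
  have hμQ := hμ.ae_mem hν
  have hpos : ∀ᵐ p ∂μ, 0 < p.1 := hμQ.mono fun p hp => hq.trans_le hp.1
  have hfin := isFiniteMeasure_chargeMeasure hμQ
  obtain ⟨R, hR, hT⟩ := hμ.exists_isTame hd hq hν hg hm hgm
  have hc := aemeasurable_groundLevel hd hq hν hg hm (fun t ht => (hgm t ht).1) hpos
    hT.integrable_norm
  have h1 : ∫ t, groundLevel g μ t ∂ν = ∫ p, groundLevel g μ p.1 ∂μ := by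
    have hmap := hμ.1.2
    rw [← hmap] at hc ⊢
    rw [integral_map measurable_fst.aemeasurable hc.aestronglyMeasurable]
  -- By the Euler–Lagrange equation the infimum is attained at the position of almost every
  -- particle.
  have h2 : ∫ p, groundLevel g μ p.1 ∂μ =
      ∫ p, (p.1 * g p.1 * confV p.2 / 2 - p.1 • pot (chargeMeasure μ) p.2) ∂μ := by
    refine integral_congr_ae ?_
    filter_upwards [hμ.ae_zeta_eq_zero hd hq hν hg hm hgm] with p hp
    rw [zeta, sub_eq_zero] at hp
    rw [← hp, zetaRaw, pot_chargeMeasure hpos, smul_eq_mul]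
    ring
  have hpm := stronglyMeasurable_pot (chargeMeasure μ)
  have hpi : Integrable (fun p : ℝ × Space d => p.1 • pot (chargeMeasure μ) p.2) μ :=
    (integrable_chargeMeasure_iff hpos hpm).1 hT.energy.integral_prod_left
  rw [h1, h2, integral_sub (hμ.2.1.1.div_const 2) hpi, integral_div,
    ← integral_chargeMeasure hpos hpm]
  congr 1
  rw [← integral_chargeMeasure_prod hpos (F := fun z => coulombW d ‖z.1 - z.2‖) (by fun_prop),
    integral_prod _ hT.energy]
  rfl

lemma chargeMeasure_real_univ [IsFiniteMeasure (chargeMeasure μ)] (hpos : ∀ᵐ p ∂μ, 0 < p.1)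
    (hμ : μ.map Prod.fst = ν) : (chargeMeasure μ).real univ = ∫ t, t ∂ν := by
  have h := integral_chargeMeasure hpos (f := fun _ : Space d => (1 : ℝ)) stronglyMeasurable_const
  simp only [integral_const, smul_eq_mul, mul_one] at h
  rw [h, ← hμ, integral_map measurable_fst.aemeasurable (by fun_prop)]

variable {N : ℕ} {q : Fin N → ℝ} {x : Fin N → Space d}

lemma hasWeakGradient_fluctPotential {R : ℝ} (hd : 2 ≤ d) (hq : 0 < qmin) [IsFiniteMeasure μ]
    (hμQ : ∀ᵐ p ∂μ, p.1 ∈ Icc qmin qmax) (hR : ∀ᵐ x ∂(chargeMeasure μ), ‖x‖ ≤ R)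
    (hqi : ∀ i, q i ∈ Icc qmin qmax) :
    HasWeakGradient (fluctPotential μ q x) (excessField q x N (chargeMeasure μ)) := by
  have hfp := isFiniteMeasure_pointMeasure q x
  have hpQ : ∀ᵐ p ∂(pointMeasure q x), p.1 ∈ Icc qmin qmax := ae_pointMeasure q x hqi
  have hf1 := isFiniteMeasure_chargeMeasure hμQ
  have hf2 := isFiniteMeasure_chargeMeasure hpQ
  have hpos : ∀ᵐ p ∂μ, 0 < p.1 := hμQ.mono fun p hp => hq.trans_le hp.1
  have hpos' : ∀ᵐ p ∂(pointMeasure q x), 0 < p.1 := hpQ.mono fun p hp => hq.trans_le hp.1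
  have hR' : ∀ᵐ y ∂(chargeMeasure (pointMeasure q x)), ‖y‖ ≤ ∑ i, ‖x i‖ := by
    refine ae_chargeMeasure_of_ae (measurableSet_le measurable_norm measurable_const)
      (ae_pointMeasure q x fun i => ?_)
    exact Finset.single_le_sum (f := fun i => ‖x i‖) (fun j _ => norm_nonneg _) (Finset.mem_univ i)
  have h := (hasWeakGradient_pot hd hR').sub_smul (hasWeakGradient_pot hd hR) N
  have e1 : fluctPotential μ q x =
      fun y => pot (chargeMeasure (pointMeasure q x)) y - (N : ℝ) * pot (chargeMeasure μ) y := by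
    funext y
    rw [fluctPotential, pot_chargeMeasure hpos, pot_chargeMeasure hpos']
  have e2 : excessField q x N (chargeMeasure μ) =
      fun y => field (chargeMeasure (pointMeasure q x)) y - (N : ℝ) • field (chargeMeasure μ) y := by
    funext y
    have : field (chargeMeasure (pointMeasure q x)) y = ∑ i, q i • gradW (y - x i) := by
      rw [field, integral_chargeMeasure hpos'
        (f := fun x => gradW (y - x)) (Measurable.stronglyMeasurable (by fun_prop)),
        integral_pointMeasure]
    rw [excessField, this]
  rw [e1, e2]
  exact h

lemma correction_eq_zero_of_sum_dirac (h : ∑ i, Measure.dirac (q i) = (N : ℝ≥0∞) • ν)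
    (c : ℝ → ℝ) : ∑ i, c (q i) - (N : ℝ) * ∫ t, c t ∂ν = 0 := by
  have h1 : ∫ t, c t ∂(∑ i, Measure.dirac (q i)) = ∑ i, c (q i) := by
    rw [integral_finsetSum_measure fun i _ => integrable_dirac (by simp)]
    simp
  rw [← h1, h, integral_smul_measure]
  simp

/-- For constant g the ground level is proportional to the charge, so only the total charge matters.
-/
lemma correction_eq_zero_of_const (hq : 0 < qmin) (hν : ν (Icc qmin qmax)ᶜ = 0)
    (hpos : ∀ᵐ p ∂μ, 0 < p.1) (hqi : ∀ i, q i ∈ Icc qmin qmax) {a : ℝ}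
    (ha : ∀ t ∈ Icc qmin qmax, g t = a) (hsum : ∑ i, q i = (N : ℝ) * ∫ t, t ∂ν) :
    ∑ i, groundLevel g μ (q i) - (N : ℝ) * ∫ t, groundLevel g μ t ∂ν = 0 := by
  have hc : ∀ t ∈ Icc qmin qmax,
      groundLevel g μ t = t * reducedLevel (chargeMeasure μ) a := fun t ht => by
    rw [groundLevel_eq hpos (hq.le.trans ht.1), ha t ht]
  have hQ : ∀ᵐ t ∂ν, t ∈ Icc qmin qmax := by rw [ae_iff]; exact hν
  rw [Finset.sum_congr rfl fun i _ => hc _ (hqi i), integral_congr_ae (hQ.mono hc),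
    integral_mul_const, ← Finset.sum_mul, hsum]
  ring

end minimizer

end HeterogeneousGas

end

/-! ### The splitting formula. -/

theorem theorem2 (d : ℕ) (hd : 2 ≤ d)
    (qmin qmax : ℝ) (hqmin : 0 < qmin)
    (ν : Measure ℝ) [IsProbabilityMeasure ν] (hν : ν (Set.Icc qmin qmax)ᶜ = 0)
    (g : ℝ → ℝ) (hgpos : ∀ t ∈ Set.Icc qmin qmax, 0 < g t)
    (hg : ContinuousOn g (Set.Icc qmin qmax) ∨ MonotoneOn g (Set.Icc qmin qmax) ∨
      AntitoneOn g (Set.Icc qmin qmax))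
    (μ : Measure (ℝ × Space d)) (hμ : IsEnergyMinimizer g ν μ) :
    -- the effective potential is nonnegative and vanishes on the support of the minimizer
    (∀ t ∈ Set.Icc qmin qmax, ∀ y : Space d, 0 ≤ zeta g μ t y) ∧
    (∀ᵐ p ∂μ, zeta g μ p.1 p.2 = 0) ∧
    (ContinuousOn g (Set.Icc qmin qmax) → ∀ p ∈ μ.support, zeta g μ p.1 p.2 = 0) ∧
    -- the splitting formula
    ∀ (N : ℕ) (q : Fin N → ℝ) (x : Fin N → Space d),
      (∀ i, q i ∈ Set.Icc qmin qmax) → Function.Injective x →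
      (d = 2 → ∑ i, q i = (N : ℝ) * ∫ t, t ∂ν) →
      SolvesPoisson μ q x (fluctPotential μ q x) ∧
      (∃ G, HasWeakGradient (fluctPotential μ q x) G) ∧
      ∃ L : ℝ,
        (∀ G, HasWeakGradient (fluctPotential μ q x) G →
          HasRenormalizedEnergy q x G (fun _ => 1) L) ∧
        hamiltonian g q x =
          (N : ℝ) ^ 2 * intensiveEnergy g μ
            + 2 * (N : ℝ) * ∫ p, zeta g μ p.1 p.2 ∂(pointMeasure q x)
            + 1 / coulombConst d * L
            + 2 * (N : ℝ) *
              (∑ i, groundLevel g μ (q i) - (N : ℝ) * ∫ t, groundLevel g μ t ∂ν) ∧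
        -- no correction if the charges are distributed according to `ν`, or if `g` is constant
        -- and the total charges agree
        (((∑ i, Measure.dirac (q i) = (N : ℝ≥0∞) • ν) ∨
            ((∃ a, ∀ t ∈ Set.Icc qmin qmax, g t = a) ∧ ∑ i, q i = (N : ℝ) * ∫ t, t ∂ν)) →
          hamiltonian g q x =
            (N : ℝ) ^ 2 * intensiveEnergy g μ
              + 2 * (N : ℝ) * ∫ p, zeta g μ p.1 p.2 ∂(pointMeasure q x)
              + 1 / coulombConst d * L) := by
  have hp : IsProbabilityMeasure μ := hμ.1.1
  have hμQ := hμ.ae_mem hν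
  have hpos : ∀ᵐ p ∂μ, 0 < p.1 := hμQ.mono fun p hp => hqmin.trans_le hp.1
  have hfin := isFiniteMeasure_chargeMeasure hμQ
  have hqq : qmin ≤ qmax := by
    by_contra h
    rw [Set.Icc_eq_empty h, Set.compl_empty, measure_univ] at hν
    exact one_ne_zero hν
  obtain ⟨m, M, hm, hgm⟩ := exists_bounds hqq hgpos hg
  have hgν := aemeasurable_of_continuousOn_or_monotoneOn measurableSet_Icc hν hg
  obtain ⟨R, hR, hT⟩ := hμ.exists_isTame hd hqmin hν hgν hm hgm
  refine ⟨fun t ht y => zeta_nonneg_of_bddBelow (bddBelow_zetaRaw hd hpos hT.integrable_norm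
      (hqmin.trans_le ht.1) (hgpos t ht)) y, hμ.ae_zeta_eq_zero hd hqmin hν hgν hm hgm,
    fun hgc p hp => hμ.zeta_eq_zero_of_mem_support hd hqmin hν hgν hm hgm hgc hp,
    fun N q x hq hx hneutral => ?_⟩
  have hG₀ := hasWeakGradient_fluctPotential (x := x) hd hqmin hμQ hT.bounded hq
  refine ⟨solvesPoisson_fluctPotential hd hqmin hμQ hT.bounded hq, ⟨_, hG₀⟩,
    coulombConst d *
      (-(∑ i, ∑ j ∈ Finset.univ.erase i, q i * q j * coulombW d ‖x i - x j‖) +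
      2 * (N : ℝ) * ∑ i, q i * pot (chargeMeasure μ) (x i) -
      (N : ℝ) ^ 2 * ∫ z, coulombW d ‖z.1 - z.2‖ ∂((chargeMeasure μ).prod (chargeMeasure μ))),
    fun G hG => ?_, ?_⟩
  -- The radius is enlarged to contain the points x_i as well. An arbitrary weak gradient agrees
  -- almost everywhere with the explicit field, so it has the same energy.
  · have hT' : IsTame (chargeMeasure μ) (R + ∑ i, ‖x i‖) :=
      hT.mono (le_add_of_nonneg_right (Finset.sum_nonneg fun i _ => norm_nonneg _))
    refine hasRenormalizedEnergy_excessField hd (c := N)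
      (add_nonneg hR.le (Finset.sum_nonneg fun i _ => norm_nonneg (x i))) hT' hx (fun i => ?_)
      (fun h => ?_) (hG.ae_eq hG₀)
    · exact (Finset.single_le_sum (f := fun i => ‖x i‖) (fun j _ => norm_nonneg _)
        (Finset.mem_univ i)).trans (le_add_of_nonneg_left hR.le)
    · rw [chargeMeasure_real_univ hpos hμ.1.2]
      exact hneutral h
  · have hk := (coulombConst_pos hd).ne'
    have hmain : hamiltonian g q x = (N : ℝ) ^ 2 * intensiveEnergy g μ
        + 2 * (N : ℝ) * ∫ p, zeta g μ p.1 p.2 ∂(pointMeasure q x)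
        + 1 / coulombConst d * (coulombConst d *
          (-(∑ i, ∑ j ∈ Finset.univ.erase i, q i * q j * coulombW d ‖x i - x j‖) +
          2 * (N : ℝ) * ∑ i, q i * pot (chargeMeasure μ) (x i) -
          (N : ℝ) ^ 2 * ∫ z, coulombW d ‖z.1 - z.2‖ ∂((chargeMeasure μ).prod (chargeMeasure μ))))
        + 2 * (N : ℝ) *
          (∑ i, groundLevel g μ (q i) - (N : ℝ) * ∫ t, groundLevel g μ t ∂ν) := by
      have hz : ∫ p, zeta g μ p.1 p.2 ∂(pointMeasure q x) =
          (∑ i, q i * g (q i) * confV (x i)) / 2 - ∑ i, q i * pot (chargeMeasure μ) (x i) -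
            ∑ i, groundLevel g μ (q i) := by
        rw [integral_pointMeasure, Finset.sum_div, ← Finset.sum_sub_distrib,
          ← Finset.sum_sub_distrib]
        refine Finset.sum_congr rfl fun i _ => ?_
        rw [zeta, zetaRaw, pot_chargeMeasure hpos]
        ring
      -- The terms in P(x_i) and c(q_i) cancel, and the multiples of N² cancel because twice the
      -- mean ground level is the confinement energy minus twice the interaction.
      rw [one_div, inv_mul_cancel_left₀ hk, hz, hμ.integral_groundLevel hd hqmin hν hgν hm hgm,
        integral_chargeMeasure_prod hpos (F := fun z => coulombW d ‖z.1 - z.2‖) (by fun_prop),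
        intensiveEnergy, hamiltonian]
      ring
    refine ⟨hmain, fun hcase => ?_⟩
    have hzero : ∑ i, groundLevel g μ (q i) - (N : ℝ) * ∫ t, groundLevel g μ t ∂ν = 0 := by
      rcases hcase with h | ⟨⟨a, ha⟩, hsum⟩
      · exact correction_eq_zero_of_sum_dirac h _
      · exact correction_eq_zero_of_const hqmin hν hpos hq ha hsum
    rw [hmain, hzero, mul_zero, add_zero]
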